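/- Let $N\ge 2$, let $\kappa_N=(-1)^{N/2+1}$ if $N$ is even and $\kappa_N\in\{1,-1\}$ if $N$ is odd. Let $I\subseteq\mathbb R$ be open, let $u_0,\dots,u_{N-2}:I\to\mathbb C$ be smooth, and let $\mathcal L=\partial_x^N+u_{N-2}(x)\partial_x^{N-2}+\cdots+u_0(x)$. *Hadamard coefficients.* Let $A_N(z)=\frac1{2\pi i}\int_{c-i\infty}^{c+i\infty}e^{z\xi+\kappa_N\xi^N}\,d\xi$, where $c=0$ if $N$ is even, and, for $N$ odd, $c=1$ if $\kappa_N=(-1)^{(N+1)/2}$ and $c=-1$ if $\kappa_N=(-1)^{(N-1)/2}$. Put $E_j(x,y,t)=t^{-(j+1)/N}A_N^{(j)}\big((x-y)/t^{1/N}\big)$ for $t>0$. Let $U\subseteq I\times I$ be an open neighbourhood of the diagonal $\{(x,x):x\in I\}$. The Hadamard coefficients of $\partial_tv=\kappa_N\mathcal Lv$ are smooth functions $H_k^j:U\to\mathbb C$ ($k\ge1$, $0\le j\le N-2$) such that $$\mathcal H(x,y,t)=E_0(x,y,t)+\sum_{j=0}^{N-2}E_j(x,y,t)\sum_{k=1}^\infty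 H_k^j(x,y)t^k$$ is, for fixed $y$, a formal solution of $\partial_tv=\kappa_N\mathcal Lv$; that is, for every $M\ge0$, if $v_M$ denotes the expansion with the inner sums cut off at $k=M$, then $\partial_tv_M-\kappa_N\mathcal Lv_M$ is on $U\times(0,\infty)$ a finite combination of terms $t^kE_j$ with $k\ge M$, $0\le j\le N-2$, whose coefficients are functions of $(x,y)$. *Resolvent coefficients.* In the ring of formal pseudo-differential operators $\sum_{i\le m}r_i(x)\partial_x^i$ with coefficients smooth on $I$ and product determined by $\partial_x^k\cdot r=\sum_{i\ge0}\binom ki r^{(i)}\partial_x^{k-i}$ ($k\in\mathbb Z$), let $S=1+\sum_{k\ge1}\psi_k(x)\partial_x^{-k}$ satisfy $\mathcal L=S\partial_x^NS^{-1}$. Let $*$ be the anti-automorphism given by $\partial_x^*=-\partial_x$ and $r^*=r$ for functions $r$. Put $\Psi(x,z)=Se^{xz}$ and $\Psi^*(x,z)=(S^*)^{-1}e^{-xz}$, where $\partial_x^ie^{\pm xz}=(\pm z)^ie^{\pm xz}$ for $i\in\mathbb Z$. The functions $\omega_n(x,y)$, $x,y\in I$, are defined by $$\Psi(x,z)\Psi^*(y,z)=\Big(\sum_{n=0}^\infty\omega_n(x,y)z^{-n}\Big)e^{(x-y)z}.$$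 Then for all $k\ge1$ and $j\in\{0,\dots,N-2\}$, and all $x\ne y$ such that $(s,y)\in U$ for every $s$ in the closed interval with end points $x$ and $y$, $$H_k^j(x,y)=(-\kappa_NN)^k\sum_{n=1}^{k(N-1)-j}\omega_n(x,y)\;\mathrm{res}_{\partial_x}\!\left[\partial_x^{-n}\Big(\frac1{x-y}\,\partial_x^{N-1}\Big)^k\partial_x^{-j-1}\right],$$ where $\mathrm{res}_{\partial_x}$ is the coefficient of $\partial_x^{-1}$ and $y$ is a constant for $\partial_x$. -/

import Mathlib

open scoped ContDiff

noncomputable section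

/-- A formal pseudo-differential operator `∑_{i ≤ m} r_i(x) ∂_x^i`, given by its coefficient
functions. Smoothness of the coefficients on a given open set is imposed separately
(`PsiDO.SmoothOn`), and identities between operators are identities of coefficients on such a set
(`PsiDO.EqOn`). -/
structure PsiDO where
  coeff : ℤ → ℝ → ℂ
  bdd : ∃ m : ℤ, ∀ i, m < i → coeff i = 0

namespace PsiDO

/-- Product given by the generalized Leibniz rule
`(a ∂^i)(b ∂^j) = ∑_{l ≥ 0} (i choose l) a b^{(l)} ∂^{i+j-l}`; in the coefficient of `∂^n` one has
`j = n - i + l`. Only finitely many pairs `(i, l)` contribute to each coefficient. -/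
protected def mul (P Q : PsiDO) : PsiDO where
  coeff n x := ∑ᶠ i : ℤ, ∑ᶠ l : ℕ,
    ((Ring.choose i l : ℤ) : ℂ) * P.coeff i x * iteratedDeriv l (Q.coeff (n - i + l)) x
  bdd := by
    obtain ⟨p, hp⟩ := P.bdd
    obtain ⟨q, hq⟩ := Q.bdd
    refine ⟨p + q, fun n hn => funext fun x => ?_⟩
    refine finsum_eq_zero_of_forall_eq_zero fun i => finsum_eq_zero_of_forall_eq_zero fun l => ?_
    by_cases hi : p < i
    · simp [hp i hi]
    · rw [hq (n - i + l) (by omega)]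
      simp

instance : Mul PsiDO := ⟨PsiDO.mul⟩

/-- The operator of multiplication by the function `f`. -/
def ofFun (f : ℝ → ℂ) : PsiDO where
  coeff i := if i = 0 then f else 0
  bdd := ⟨0, fun i hi => if_neg (by omega)⟩

/-- The operator `∂_x^m`, `m ∈ ℤ`. -/
def dpow (m : ℤ) : PsiDO where
  coeff i := if i = m then 1 else 0
  bdd := ⟨m, fun i hi => if_neg (by omega)⟩

instance : One PsiDO := ⟨dpow 0⟩

/-- Powers `P^k`, `k ∈ ℕ`. -/
protected def npow (P : PsiDO) : ℕ → PsiDO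
  | 0 => 1
  | k + 1 => PsiDO.npow P k * P

instance : Pow PsiDO ℕ := ⟨PsiDO.npow⟩

/-- The formal adjoint `(∑ r_i ∂^i)^* = ∑ (-∂)^i r_i`. -/
def adjoint (P : PsiDO) : PsiDO where
  coeff n x := ∑ᶠ l : ℕ,
    (((n + l).negOnePow : ℤ) : ℂ) * ((Ring.choose (n + l) l : ℤ) : ℂ) *
      iteratedDeriv l (P.coeff (n + l)) x
  bdd := by
    obtain ⟨p, hp⟩ := P.bdd
    refine ⟨p, fun n hn => funext fun x => finsum_eq_zero_of_forall_eq_zero fun l => ?_⟩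
    rw [hp (n + l) (by omega)]
    simp

/-- The residue: the coefficient of `∂_x^{-1}`. -/
def res (P : PsiDO) : ℝ → ℂ := P.coeff (-1)

/-- All coefficients are smooth on `I`. -/
def SmoothOn (I : Set ℝ) (P : PsiDO) : Prop := ∀ i, ContDiffOn ℝ ∞ (P.coeff i) I

/-- Equality of pseudo-differential operators on `I`. -/
def EqOn (I : Set ℝ) (P Q : PsiDO) : Prop := ∀ i, Set.EqOn (P.coeff i) (Q.coeff i) I

/-- `Q = P⁻¹` in the ring of pseudo-differential operators with smooth coefficients on `I`. -/
def IsInverseOn (I : Set ℝ) (P Q : PsiDO) : Prop :=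
  Q.SmoothOn I ∧ EqOn I (P * Q) 1 ∧ EqOn I (Q * P) 1

end PsiDO

/-- The differential operator `𝓛 = ∂^N + u_{N-2} ∂^{N-2} + ⋯ + u_0` (for `N ≥ 2`). -/
def laxOp (N : ℕ) (u : ℕ → ℝ → ℂ) : PsiDO where
  coeff i := if i = N then 1 else if 0 ≤ i ∧ i + 2 ≤ N then u i.toNat else 0
  bdd := ⟨N, fun i hi => by rw [if_neg (by omega), if_neg (by omega)]⟩

/-- `𝓛 f` for a function `f` of `x`. -/
def laxApply (N : ℕ) (u : ℕ → ℝ → ℂ) (f : ℝ → ℂ) (x : ℝ) : ℂ :=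
  iteratedDeriv N f x + ∑ i ∈ Finset.range (N - 1), u i x * iteratedDeriv i f x

/-- `S = 1 + ∑_{k ≥ 1} ψ_k ∂^{-k}` with smooth coefficients on `I`, and `𝓛 = S ∂^N S⁻¹`. -/
def IsWaveOperator (I : Set ℝ) (N : ℕ) (u : ℕ → ℝ → ℂ) (S : PsiDO) : Prop :=
  S.SmoothOn I ∧ (∀ i : ℤ, 0 < i → ∀ x ∈ I, S.coeff i x = 0) ∧ (∀ x ∈ I, S.coeff 0 x = 1) ∧
  ∃ Sinv : PsiDO, PsiDO.IsInverseOn I S Sinv ∧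
    PsiDO.EqOn I (laxOp N u) (S * PsiDO.dpow N * Sinv)

/-- The coefficient `ψ_k` of the wave function `S e^{xz} = (∑ ψ_k(x) z^{-k}) e^{xz}`, where
`∂^i e^{xz} = z^i e^{xz}`. -/
def waveCoeff (S : PsiDO) (k : ℕ) (x : ℝ) : ℂ := S.coeff (-k) x

/-- The coefficient `ψ*_k` of the adjoint wave function `T e^{-xz} = (∑ ψ*_k(x) z^{-k}) e^{-xz}`,
`T = (S*)⁻¹`, where `∂^i e^{-xz} = (-z)^i e^{-xz}`. -/
def adjWaveCoeff (T : PsiDO) (k : ℕ) (x : ℝ) : ℂ := (-1) ^ k * T.coeff (-k) x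

/-- `w n x y = ω_n(x,y)` are the coefficients of the resolvent
`Ψ(x,z) Ψ*(y,z) = (∑ ω_n(x,y) z^{-n}) e^{(x-y)z}` of `𝓛` on `I`. -/
def IsResolventCoeffs (I : Set ℝ) (N : ℕ) (u : ℕ → ℝ → ℂ) (w : ℕ → ℝ → ℝ → ℂ) : Prop :=
  ∃ S T : PsiDO, IsWaveOperator I N u S ∧ PsiDO.IsInverseOn I S.adjoint T ∧
    ∀ n, ∀ x ∈ I, ∀ y ∈ I,
      w n x y = ∑ k ∈ Finset.range (n + 1), waveCoeff S k x * adjWaveCoeff T (n - k) y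

/-- The admissible signs `κ_N`. -/
def IsHeatSign (N : ℕ) (κ : ℝ) : Prop :=
  (Even N → κ = (-1) ^ (N / 2 + 1)) ∧ (Odd N → κ = 1 ∨ κ = -1)

/-- Abscissa of the vertical line of integration for the Airy-type function: `0` for even `N`;
for odd `N` it is `1` if `κ = (-1)^{(N+1)/2}` and `-1` if `κ = (-1)^{(N-1)/2}`. -/
def airyLine (N : ℕ) (κ : ℝ) : ℝ := if Even N then 0 else -κ * (-1) ^ ((N - 1) / 2)

/-- The Airy-type function `A_N(z;κ) = (2πi)⁻¹ ∫_{c-i∞}^{c+i∞} e^{zξ + κ ξ^N} dξ`, an absolutely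
convergent integral; the line is parametrized by `ξ = c + i s`. -/
def airyN (N : ℕ) (κ : ℝ) (z : ℝ) : ℂ :=
  (2 * (Real.pi : ℂ))⁻¹ * ∫ s : ℝ,
    Complex.exp ((z : ℂ) * ((airyLine N κ : ℂ) + Complex.I * s)
      + (κ : ℂ) * ((airyLine N κ : ℂ) + Complex.I * s) ^ N)

/-- `t^{-(j+1)/N} A_N^{(j)}((x-y)/t^{1/N})`. -/
def airyHeat (N : ℕ) (κ : ℝ) (j : ℕ) (x y t : ℝ) : ℂ :=
  ((t ^ (-((j : ℝ) + 1) / N) : ℝ) : ℂ) *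
    iteratedDeriv j (airyN N κ) ((x - y) / t ^ ((1 : ℝ) / N))

/-- The heat kernel expansion with coefficients `H k j = H_k^j`, truncated after the power `t^M`
of the coefficient series. -/
def heatTrunc (N : ℕ) (κ : ℝ) (H : ℕ → ℕ → ℝ → ℝ → ℂ) (M : ℕ) (x y t : ℝ) : ℂ :=
  airyHeat N κ 0 x y t +
    ∑ j ∈ Finset.range (N - 1),
      airyHeat N κ j x y t * ∑ k ∈ Finset.Icc 1 M, H k j x y * (t : ℂ) ^ k

/-- The formal expansion with coefficients `H k j` solves `∂_t v = κ 𝓛 v` on `U`: for every `M`,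
when the expansion truncated after `t^M` is substituted, `∂_t v - κ 𝓛 v` is a combination of terms
`t^k t^{-(j+1)/N} A_N^{(j)}((x-y)/t^{1/N})`, `0 ≤ j ≤ N-2`, with `k ≥ M` only. -/
def IsFormalHeatSolution (U : Set (ℝ × ℝ)) (N : ℕ) (κ : ℝ) (u : ℕ → ℝ → ℂ)
    (H : ℕ → ℕ → ℝ → ℝ → ℂ) : Prop :=
  ∀ M : ℕ, ∃ (m : ℕ) (r : ℕ → ℕ → ℝ → ℝ → ℂ), ∀ x y, (x, y) ∈ U → ∀ t : ℝ, 0 < t →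
    deriv (fun τ => heatTrunc N κ H M x y τ) t
        - (κ : ℂ) * laxApply N u (fun s => heatTrunc N κ H M s y t) x
      = ∑ k ∈ Finset.Ico M m, ∑ j ∈ Finset.range (N - 1),
          r k j x y * (t : ℂ) ^ k * airyHeat N κ j x y t

/-- `H k j = H_k^j` (`k ≥ 1`, `0 ≤ j ≤ N-2`) are the Hadamard coefficients of `∂_t v = κ 𝓛 v`:
smooth functions on the neighbourhood `U` of the diagonal whose expansion is a formal solution. -/
def IsHadamardCoeffs (U : Set (ℝ × ℝ)) (N : ℕ) (κ : ℝ) (u : ℕ → ℝ → ℂ)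
    (H : ℕ → ℕ → ℝ → ℝ → ℂ) : Prop :=
  (∀ k j, 1 ≤ k → j + 2 ≤ N → ContDiffOn ℝ ∞ (fun p : ℝ × ℝ => H k j p.1 p.2) U) ∧
  IsFormalHeatSolution U N κ u H

end

/-! ### Formal pseudo-differential operators over a differential ring. -/

noncomputable section

open scoped Differential

/-! Both families of coefficients come from operators that intertwine `𝓛` with `∂^N`, and such an
operator is unique once its behaviour at the diagonal is fixed. Write `s = x - y`, with `y` frozen.

From functions to operators. Formally `E_j` is the integral of `ξ^j e^{sξ + κ t ξ^N}`, so `∂_x E_j =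
E_{j+1}` and `∂_t E_j = κ E_{j+N}`. Integration by parts (the Airy equation) gives `-κ N t E_{j+N-1}
= s E_j + j E_{j-1}`. Hence `t^k E_j` behaves like the operator `∂^j Z^k` with `Z = (-κ N)⁻¹ ∂^{1-N}
s`: differentiation in `x` is left multiplication by `∂`, and differentiation in `t` is right
multiplication by `κ ∂^N`, because `[Z, κ ∂^N] = 1`. The dictionary loses nothing, since for `x ≠ y`
the functions `t^k E_j` (`k ∈ ℤ`, `0 ≤ j ≤ N-2`) are linearly independent
(`linearIndependent_airyHeat`). The expansion truncated at `t^M` becomes `V = 1 + ∑ H_k^j ∂^j Z^k`,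
and the formal heat equation says that `𝓛 V - V ∂^N` has very low order (`ord_lax_heatOp`).

The resolvent. `W = ∑ ω_n(x,y) ∂^{-n}` is `S` times an operator with constant coefficients, so `𝓛 W
= W ∂^N` exactly. The bilinear identity `res (∂^i 𝓛^m) = 0` (the operator is differential) makes
certain combinations of derivatives of the `ω_n` vanish on the diagonal (`exists_resolvent_op`,
`resolvent_flat`).

Uniqueness (`hadamard_eq_coeff`). If `V - W` has order `p < 0`, the leading term of `𝓛 (V - W) - (V
- W) ∂^N` is `N` times the derivative of the leading coefficient, which is therefore a constant `c`.
Choose `l` and `i` with `-p = l (N-1) - i`, `0 ≤ i ≤ N-2`. The coefficient of `∂^i` in `(V - W)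
Z^{-l}` is `(-κ N)^l s^{-l} c`, whereas for `V` alone it is `H_l^i`. After multiplication by `s^l`
the contribution of `V` tends to zero at the diagonal, because `H_l^i` is smooth there. That of `W`
does so by flatness: residues of powers of `s⁻¹ ∂^{N-1}` are finite-difference sums supported on
multiples of `N` (`exists_residue_formula`), and the diagonal identities cancel their poles
(`tendsto_newton_sum`). So `c = 0`, and the order drops until `H_k^j` is the coefficient of `∂^j` in
`W Z^{-k}`; as `Z⁻¹ = -κ N s⁻¹ ∂^{N-1}`, this is the asserted residue (`coeff_mul_timePow_neg`). -/

/-- Sequences `ℤ → A` vanishing for large indices: the symbols of formal pseudo-differential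
operators with coefficients in `A`. -/
def symbolSubgroup (A : Type*) [CommRing A] : AddSubgroup (ℤ → A) where
  carrier := {c | ∃ m : ℤ, ∀ i, m < i → c i = 0}
  zero_mem' := ⟨0, fun _ _ => rfl⟩
  add_mem' := by
    rintro a b ⟨m, hm⟩ ⟨n, hn⟩
    refine ⟨max m n, fun i hi => ?_⟩
    simp [hm i (lt_of_le_of_lt (le_max_left _ _) hi), hn i (lt_of_le_of_lt (le_max_right _ _) hi)]
  neg_mem' := by
    rintro a ⟨m, hm⟩
    exact ⟨m, fun i hi => by simp [hm i hi]⟩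

/-- Formal pseudo-differential operators over the differential ring `A`. -/
def Psi (A : Type*) [CommRing A] : Type _ := symbolSubgroup A

namespace Psi

variable {A : Type*} [CommRing A]

instance : AddCommGroup (Psi A) := inferInstanceAs (AddCommGroup (symbolSubgroup A))

/-- The coefficient of `∂^n`. -/
def coeff (P : Psi A) (n : ℤ) : A := P.1 n

/-- The operator has order at most `m`. -/
def Ord (P : Psi A) (m : ℤ) : Prop := ∀ i, m < i → P.coeff i = 0

/-- The operator with given coefficients. -/
def mk (c : ℤ → A) (m : ℤ) (h : ∀ i, m < i → c i = 0) : Psi A := ⟨c, m, h⟩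

@[simp] theorem coeff_mk (c : ℤ → A) (m : ℤ) (h : ∀ i, m < i → c i = 0) (n : ℤ) :
    (mk c m h).coeff n = c n := rfl

@[ext] theorem ext {P Q : Psi A} (h : ∀ n, P.coeff n = Q.coeff n) : P = Q :=
  Subtype.ext (funext h)

@[simp] theorem coeff_zero (n : ℤ) : (0 : Psi A).coeff n = 0 := rfl
@[simp] theorem coeff_add (P Q : Psi A) (n : ℤ) : (P + Q).coeff n = P.coeff n + Q.coeff n := rfl
@[simp] theorem coeff_sub (P Q : Psi A) (n : ℤ) : (P - Q).coeff n = P.coeff n - Q.coeff n := rfl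
@[simp] theorem coeff_neg (P : Psi A) (n : ℤ) : (-P).coeff n = -P.coeff n := rfl

/-- `coeff` as an additive map. -/
def coeffHom (n : ℤ) : Psi A →+ A where
  toFun P := P.coeff n
  map_zero' := rfl
  map_add' _ _ := rfl

@[simp] theorem coeffHom_apply (n : ℤ) (P : Psi A) : coeffHom n P = P.coeff n := rfl

theorem coeff_sum {ι : Type*} (s : Finset ι) (P : ι → Psi A) (n : ℤ) :
    (∑ i ∈ s, P i).coeff n = ∑ i ∈ s, (P i).coeff n :=
  map_sum (coeffHom n) P s

theorem exists_ord (P : Psi A) : ∃ m, P.Ord m := P.2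

theorem Ord.mono {P : Psi A} {m n : ℤ} (h : P.Ord m) (hmn : m ≤ n) : P.Ord n :=
  fun i hi => h i (lt_of_le_of_lt hmn hi)

theorem Ord.sub {P Q : Psi A} {m : ℤ} (hP : P.Ord m) (hQ : Q.Ord m) : (P - Q).Ord m :=
  fun i hi => by simp [hP i hi, hQ i hi]

theorem Ord.sum {ι : Type*} {s : Finset ι} {P : ι → Psi A} {m : ℤ}
    (h : ∀ i ∈ s, (P i).Ord m) : (∑ i ∈ s, P i).Ord m := fun n hn => by
  rw [coeff_sum]
  exact Finset.sum_eq_zero fun i hi => h i hi n hn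

/-- The monomial `a ∂^i`. -/
def mon (a : A) (i : ℤ) : Psi A := mk (fun n => if n = i then a else 0) i
  fun n hn => if_neg (by omega)

theorem coeff_mon (a : A) (i n : ℤ) : (mon a i).coeff n = if n = i then a else 0 := rfl

theorem ord_mon (a : A) (i : ℤ) : (mon a i).Ord i := fun n hn => if_neg (by omega)

theorem exists_trunc (P : Psi A) {m : ℤ} (hP : P.Ord m) (B : ℤ) :
    (P - ∑ i ∈ Finset.Ioc B m, mon (P.coeff i) i).Ord B := by
  intro n hn
  rw [coeff_sub, coeff_sum]
  simp only [coeff_mon]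
  rw [Finset.sum_ite_eq]
  split_ifs with h
  · simp
  · rw [hP n (by simp only [Finset.mem_Ioc, not_and, not_le] at h; exact h hn)]
    simp

/-- An additive map that shifts orders boundedly and kills monomials is zero. -/
theorem eq_zero_of_mon {φ : Psi A →+ Psi A} (c : ℤ) (hφ : ∀ P m, Ord P m → Ord (φ P) (m + c))
    (h : ∀ a i, φ (mon a i) = 0) (P : Psi A) : φ P = 0 := by
  ext n
  obtain ⟨m, hm⟩ := P.exists_ord
  have h1 := hφ _ _ (exists_trunc P hm (n - c - 1)) n (by omega)
  rw [map_sub, map_sum, Finset.sum_eq_zero fun i _ => h _ i, sub_zero] at h1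
  simpa using h1

/-- Continuity for the order filtration: additive maps that move orders by a bounded amount are
determined by finite truncations. Associativity and the rules for the adjoint are thereby reduced to
monomials. -/
theorem eq_of_mon {φ ψ : Psi A →+ Psi A} (c : ℤ) (hφ : ∀ P m, Ord P m → Ord (φ P) (m + c))
    (hψ : ∀ P m, Ord P m → Ord (ψ P) (m + c))
    (h : ∀ a i, φ (mon a i) = ψ (mon a i)) (P : Psi A) : φ P = ψ P :=
  sub_eq_zero.mp (eq_zero_of_mon (φ := φ - ψ) c (fun Q m hQ => (hφ Q m hQ).sub (hψ Q m hQ))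
    (fun a i => by simp [h]) P)

instance : One (Psi A) := ⟨mon 1 0⟩

theorem one_def : (1 : Psi A) = mon 1 0 := rfl

/-- The operator `∂^i`. -/
def dp (i : ℤ) : Psi A := mon 1 i

theorem dp_zero : dp 0 = (1 : Psi A) := rfl

theorem coeff_dp (i n : ℤ) : (dp i : Psi A).coeff n = if n = i then 1 else 0 := rfl

theorem ord_dp (i : ℤ) : (dp i : Psi A).Ord i := ord_mon 1 i

/-- Differential operators: no negative powers of `∂`. -/
def IsDiff (P : Psi A) : Prop := ∀ i < 0, P.coeff i = 0

theorem isDiff_dp {m : ℤ} (hm : 0 ≤ m) : (dp m : Psi A).IsDiff := fun i hi => if_neg (by omega)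

variable [Differential A]

/-- Iterated derivation as an additive map. -/
def iterD (l : ℕ) : A →+ A := ((Differential.deriv (R := A) : A →ₗ[ℤ] A) ^ l).toAddMonoidHom

theorem iterD_zero (a : A) : iterD 0 a = a := rfl

theorem iterD_succ (l : ℕ) (a : A) : iterD (l + 1) a = (iterD l a)′ := by
  simp [iterD, pow_succ']

theorem iterD_one (a : A) : iterD 1 a = a′ := by rw [iterD_succ, iterD_zero]

theorem support_dmul {v : Psi A} {m : ℤ} (hv : v.Ord m) (e : ℕ → ℤ) (n i : ℤ) :
    (Function.support fun l : ℕ => e l • iterD l (v.coeff (n - i + l))) ⊆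
      Finset.range (m - n + i + 1).toNat := by
  intro l hl
  by_contra h
  simp only [Finset.coe_range, Set.mem_Iio, not_lt] at h
  exact hl (by simp [hv (n - i + l) (by omega)])

/-- Left multiplication by `∂^i`, `i ∈ ℤ`. -/
def dmul (i : ℤ) : Psi A →+ Psi A where
  toFun v := ⟨fun n => ∑ᶠ l : ℕ, Ring.choose i l • iterD l (v.coeff (n - i + l)), by
    obtain ⟨m, hm⟩ := v.exists_ord
    refine ⟨m + i, fun n hn => finsum_eq_zero_of_forall_eq_zero fun l => ?_⟩
    rw [hm _ (by omega)]
    simp⟩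
  map_zero' := by
    ext n
    exact finsum_eq_zero_of_forall_eq_zero fun l => by simp
  map_add' v w := by
    ext n
    obtain ⟨m, hm⟩ := v.exists_ord
    obtain ⟨m', hm'⟩ := w.exists_ord
    refine Eq.trans (finsum_congr fun l => ?_)
      (finsum_add_distrib ((Finset.finite_toSet _).subset (support_dmul hm _ n i))
      ((Finset.finite_toSet _).subset (support_dmul hm' _ n i)))
    rw [coeff_add, map_add, smul_add]

theorem coeff_dmul' (i : ℤ) (v : Psi A) (n : ℤ) :
    (dmul i v).coeff n = ∑ᶠ l : ℕ, Ring.choose i l • iterD l (v.coeff (n - i + l)) := rfl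

theorem coeff_dmul {v : Psi A} {m : ℤ} (hv : v.Ord m) (i n : ℤ) {K : ℕ} (hK : m - n + i < K) :
    (dmul i v).coeff n = ∑ l ∈ Finset.range K, Ring.choose i l • iterD l (v.coeff (n - i + l)) := by
  rw [coeff_dmul']
  refine finsum_eq_sum_of_support_subset _ ((support_dmul hv _ n i).trans ?_)
  simp only [Finset.coe_range]
  exact Set.Iio_subset_Iio (by omega)

theorem ord_dmul {v : Psi A} {m : ℤ} (hv : v.Ord m) (i : ℤ) : (dmul i v).Ord (m + i) := fun n hn =>
  finsum_eq_zero_of_forall_eq_zero fun l => by rw [hv _ (by omega)]; simp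

theorem dmul_zero (v : Psi A) : dmul 0 v = v := by
  ext n
  rw [coeff_dmul', finsum_eq_single _ 0]
  · simp [iterD_zero]
  · intro l hl
    obtain ⟨l, rfl⟩ := Nat.exists_eq_succ_of_ne_zero hl
    simp [Ring.choose_zero_succ]

theorem coeff_dmul_one (v : Psi A) (n : ℤ) :
    (dmul 1 v).coeff n = (v.coeff n)′ + v.coeff (n - 1) := by
  obtain ⟨m, hm⟩ := v.exists_ord
  have hm' : v.Ord (max m n) := hm.mono (le_max_left _ _)
  have hch : ∀ l : ℕ, Ring.choose (1 : ℤ) l = (Nat.choose 1 l : ℤ) := fun l => by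
    simpa using Ring.choose_natCast (R := ℤ) 1 l
  rw [coeff_dmul hm' 1 n (K := (max m n - n).toNat + 2) (by omega), Finset.sum_range_succ',
    Finset.sum_range_succ', Finset.sum_eq_zero]
  · simp only [hch]
    simp [iterD_one, iterD_zero]
  · intro l _
    rw [hch, Nat.choose_eq_zero_of_lt (by omega)]
    simp

/-- This is Pascal's rule for generalized binomial coefficients. It reduces statements about `∂^i`
to the case `i = 1`. -/
theorem dmul_succ (i : ℤ) (v : Psi A) : dmul (i + 1) v = dmul 1 (dmul i v) := by
  ext n
  obtain ⟨m, hm⟩ := v.exists_ord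
  obtain ⟨K, hK⟩ : ∃ K : ℕ, m - n + i + 1 < K := ⟨(m - n + i + 1).toNat + 1, by omega⟩
  rw [coeff_dmul_one, coeff_dmul hm i n (K := K) (by omega),
    coeff_dmul hm i (n - 1) (K := K + 1) (by omega),
    coeff_dmul hm (i + 1) n (K := K + 1) (by push_cast; omega), Finset.sum_range_succ',
    Finset.sum_range_succ' _ K, map_sum, ← add_assoc, ← Finset.sum_add_distrib]
  congr 1
  · refine Finset.sum_congr rfl fun l _ => ?_
    rw [Ring.choose_succ_succ, add_smul, iterD_succ, map_zsmul]
    have e1 : n - (i + 1) + ((l + 1 : ℕ) : ℤ) = n - i + l := by push_cast; ring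
    have e2 : n - 1 - i + ((l + 1 : ℕ) : ℤ) = n - i + l := by push_cast; ring
    rw [e1, e2, iterD_succ]
  · simp only [Ring.choose_zero_right]
    congr 3
    push_cast; ring

/-- The top coefficient of `∂ v` is that of `v`, so a kernel element has order below every bound.
Cancelling `∂` carries the induction to negative exponents. -/
theorem dmul_one_injective : Function.Injective (dmul (A := A) 1) := by
  refine (injective_iff_map_eq_zero _).mpr fun v hv => ?_
  obtain ⟨m, hm⟩ := v.exists_ord
  have key : ∀ k : ℕ, v.Ord (m - k) := by
    intro k
    induction k with
    | zero => simpa using hm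
    | succ k ih =>
      intro i hi
      rcases lt_or_ge (m - k) i with h | h
      · exact ih i h
      · have h1 := coeff_dmul_one v (i + 1)
        rw [hv, ih (i + 1) (by push_cast at hi; omega)] at h1
        simpa using h1.symm
  ext n
  exact key (m - n + 1).toNat n (by omega)

theorem support_mul (P : Psi A) {Q : Psi A} {p q : ℤ} (hP : P.Ord p) (hQ : Q.Ord q) (n : ℤ) :
    (Function.support fun i : ℤ => P.coeff i * (dmul i Q).coeff n) ⊆ Finset.Icc (n - q) p := by
  intro i hi
  by_contra h
  simp only [Finset.coe_Icc, Set.mem_Icc, not_and_or, not_le] at h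
  rcases h with h | h
  · exact hi (by simp [ord_dmul hQ i n (by omega)])
  · exact hi (by simp [hP i h])

instance : Mul (Psi A) where
  mul P Q := ⟨fun n => ∑ᶠ i : ℤ, P.coeff i * (dmul i Q).coeff n, by
    obtain ⟨p, hp⟩ := P.exists_ord
    obtain ⟨q, hq⟩ := Q.exists_ord
    refine ⟨p + q, fun n hn => finsum_eq_zero_of_forall_eq_zero fun i => ?_⟩
    rcases lt_or_ge p i with h | h
    · simp [hp i h]
    · simp [ord_dmul hq i n (by omega)]⟩

theorem coeff_mul' (P Q : Psi A) (n : ℤ) :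
    (P * Q).coeff n = ∑ᶠ i : ℤ, P.coeff i * (dmul i Q).coeff n := rfl

theorem coeff_mul {P Q : Psi A} {p q : ℤ} (hP : P.Ord p) (hQ : Q.Ord q) (n : ℤ) {lo hi : ℤ}
    (hlo : lo ≤ n - q) (hhi : p ≤ hi) :
    (P * Q).coeff n = ∑ i ∈ Finset.Icc lo hi, P.coeff i * (dmul i Q).coeff n := by
  rw [coeff_mul']
  refine finsum_eq_sum_of_support_subset _ ((support_mul P hP hQ n).trans ?_)
  simp only [Finset.coe_Icc]
  exact Set.Icc_subset_Icc hlo hhi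

theorem Ord.mul {P Q : Psi A} {p q : ℤ} (hP : P.Ord p) (hQ : Q.Ord q) : (P * Q).Ord (p + q) :=
  fun n hn => by
    rw [coeff_mul hP hQ n le_rfl le_rfl, Finset.Icc_eq_empty (by omega), Finset.sum_empty]

theorem mon_mul (a : A) (i : ℤ) (Q : Psi A) (n : ℤ) :
    (mon a i * Q).coeff n = a * (dmul i Q).coeff n := by
  rw [coeff_mul', finsum_eq_single _ i fun k hk => by simp [coeff_mon, hk]]
  simp [coeff_mon]

theorem mul_add_aux (P Q R : Psi A) : P * (Q + R) = P * Q + P * R := by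
  obtain ⟨p, hp⟩ := P.exists_ord
  obtain ⟨q, hq⟩ := Q.exists_ord
  obtain ⟨r, hr⟩ := R.exists_ord
  ext n
  rw [coeff_add, coeff_mul' P Q, coeff_mul' P R, ← finsum_add_distrib
    ((Finset.finite_toSet _).subset (support_mul P hp hq n))
    ((Finset.finite_toSet _).subset (support_mul P hp hr n)), coeff_mul']
  exact finsum_congr fun i => by rw [map_add, coeff_add, mul_add]

theorem add_mul_aux (P Q R : Psi A) : (P + Q) * R = P * R + Q * R := by
  obtain ⟨p, hp⟩ := P.exists_ord
  obtain ⟨q, hq⟩ := Q.exists_ord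
  obtain ⟨r, hr⟩ := R.exists_ord
  ext n
  rw [coeff_add, coeff_mul' P R, coeff_mul' Q R, ← finsum_add_distrib
    ((Finset.finite_toSet _).subset (support_mul P hp hr n))
    ((Finset.finite_toSet _).subset (support_mul Q hq hr n)), coeff_mul']
  exact finsum_congr fun i => by rw [coeff_add, add_mul]

theorem dmul_one_mul (Q R : Psi A) : dmul 1 (Q * R) = dmul 1 Q * R := by
  obtain ⟨q, hq⟩ := Q.exists_ord
  obtain ⟨r, hr⟩ := R.exists_ord
  have hq1 : (dmul 1 Q).Ord (q + 1) := ord_dmul hq 1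
  ext n
  rw [coeff_dmul_one, coeff_mul hq hr n (lo := n - r - 1) (hi := q + 1) (by omega) (by omega),
    coeff_mul hq hr (n - 1) (lo := n - 1 - r) (hi := q) le_rfl le_rfl,
    coeff_mul hq1 hr n (lo := n - r - 1) (hi := q + 1) (by omega) le_rfl, map_sum]
  have h1 : ∑ i ∈ Finset.Icc (n - 1 - r) q, Q.coeff i * (dmul i R).coeff (n - 1)
      = ∑ i ∈ Finset.Icc (n - r - 1) (q + 1), Q.coeff i * (dmul i R).coeff (n - 1) := by
    refine Finset.sum_subset (Finset.Icc_subset_Icc (by omega) (by omega)) fun i hi hi' => ?_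
    simp only [Finset.mem_Icc] at hi hi'
    rw [hq i (by omega), zero_mul]
  -- Reindexing `i ↦ i + 1`. The shifted coefficients are packaged as an operator, so that both
  -- sides are the same finitely supported sum over `ℤ` and the end terms need no separate
  -- treatment.
  have h2 : ∑ i ∈ Finset.Icc (n - r - 1) (q + 1), Q.coeff i * (dmul (i + 1) R).coeff n
      = ∑ i ∈ Finset.Icc (n - r - 1) (q + 1), Q.coeff (i - 1) * (dmul i R).coeff n := by
    have hz : ∀ i, q + 1 < i → Q.coeff (i - 1) = 0 := fun i hi => hq (i - 1) (by omega)
    have hz' : (mk (fun i => Q.coeff (i - 1)) (q + 1) hz).Ord (q + 1) := hz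
    have e1 := coeff_mul' (mk (fun i => Q.coeff (i - 1)) (q + 1) hz) R n
    have e2 := coeff_mul hz' hr n (lo := n - r - 1) (hi := q + 1) (by omega) le_rfl
    simp only [coeff_mk] at e1 e2
    rw [← e2, e1, ← finsum_comp_equiv (Equiv.addRight (1 : ℤ))]
    simp only [Equiv.coe_addRight, add_sub_cancel_right]
    refine (finsum_eq_sum_of_support_subset _ fun i hi => ?_).symm
    by_contra h
    simp only [Finset.coe_Icc, Set.mem_Icc, not_and_or, not_le] at h
    rcases h with h | h
    · exact hi (by simp [ord_dmul hr (i + 1) n (by omega)])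
    · exact hi (by simp [hq i (by omega)])
  rw [h1, ← Finset.sum_add_distrib]
  simp only [coeff_dmul_one, add_mul]
  rw [Finset.sum_add_distrib (g := fun i => Q.coeff (i - 1) * (dmul i R).coeff n), ← h2,
    ← Finset.sum_add_distrib]
  refine Finset.sum_congr rfl fun i _ => ?_
  rw [dmul_succ, coeff_dmul_one]
  simp only [Derivation.leibniz, smul_eq_mul]
  ring

/-- The core of associativity. The case `i = 1` is the Leibniz rule; positive `i` follow by
iteration and negative `i` by cancelling `∂`. -/
theorem dmul_mul (i : ℤ) (Q R : Psi A) : dmul i (Q * R) = dmul i Q * R := by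
  induction i with
  | zero => simp [dmul_zero]
  | succ i ih => rw [dmul_succ, ih, dmul_one_mul, ← dmul_succ]
  | pred i ih =>
    apply dmul_one_injective
    rw [dmul_one_mul, ← dmul_succ, ← dmul_succ]
    simpa using ih

/-- Right multiplication. -/
def mulRightHom (R : Psi A) : Psi A →+ Psi A where
  toFun P := P * R
  map_zero' := by
    ext n
    exact finsum_eq_zero_of_forall_eq_zero fun i => by simp
  map_add' P Q := add_mul_aux P Q R

theorem mul_assoc_aux (P Q R : Psi A) : P * Q * R = P * (Q * R) := by
  obtain ⟨q, hq⟩ := Q.exists_ord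
  obtain ⟨r, hr⟩ := R.exists_ord
  refine eq_of_mon (φ := (mulRightHom R).comp (mulRightHom Q)) (ψ := mulRightHom (Q * R)) (q + r)
    (fun P m hP => by rw [← add_assoc]; exact (hP.mul hq).mul hr)
    (fun P m hP => hP.mul (hq.mul hr)) (fun a i => ?_) P
  change mon a i * Q * R = mon a i * (Q * R)
  ext n
  rw [mon_mul, dmul_mul, coeff_mul', coeff_mul', ← AddMonoidHom.coe_mulLeft,
    AddMonoidHom.map_finsum _
      ((Finset.finite_toSet _).subset (support_mul _ (ord_dmul hq i) hr n))]
  exact finsum_congr fun k => by rw [mon_mul, AddMonoidHom.coe_mulLeft, mul_assoc]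

theorem one_mul_aux (P : Psi A) : 1 * P = P := by
  ext n
  rw [one_def, mon_mul, dmul_zero, one_mul]

theorem iterD_coeff_one {l : ℕ} (hl : l ≠ 0) (n : ℤ) : iterD l ((1 : Psi A).coeff n) = 0 := by
  obtain ⟨l, rfl⟩ := Nat.exists_eq_succ_of_ne_zero hl
  induction l with
  | zero => rw [iterD_one, one_def, coeff_mon]; split_ifs <;> simp
  | succ l ih => rw [iterD_succ, ih (by omega), map_zero]

theorem mul_one_aux (P : Psi A) : P * 1 = P := by
  refine eq_of_mon (φ := mulRightHom 1) (ψ := AddMonoidHom.id _) 0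
    (fun P m hP => hP.mul (ord_mon 1 0)) (fun P m hP => by simpa using hP) (fun a i => ?_) P
  change mon a i * 1 = mon a i
  ext n
  rw [mon_mul, coeff_dmul', finsum_eq_single _ 0 fun l hl => by rw [iterD_coeff_one hl, smul_zero]]
  simp [iterD_zero, one_def, coeff_mon, sub_eq_zero]

theorem mul_zero_aux (P : Psi A) : P * 0 = 0 := by
  have := mul_add_aux P 0 0
  rw [add_zero] at this
  simpa using this.symm

instance : Ring (Psi A) :=
  { (inferInstance : AddCommGroup (Psi A)) with
    left_distrib := mul_add_aux
    right_distrib := add_mul_aux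
    zero_mul := fun P => (mulRightHom P).map_zero
    mul_zero := mul_zero_aux
    mul_assoc := mul_assoc_aux
    one_mul := one_mul_aux
    mul_one := mul_one_aux }

/-! ### Functions, powers of `∂`, orders -/

/-- Multiplication by `a ∈ A` as an operator. -/
def C : A →+* Psi A where
  toFun a := mon a 0
  map_one' := rfl
  map_zero' := by ext n; simp [coeff_mon]
  map_add' a b := by ext n; simp only [coeff_mon, coeff_add]; split_ifs <;> simp
  map_mul' a b := by
    ext n
    rw [mon_mul, dmul_zero, coeff_mon, coeff_mon]; split_ifs <;> simp

theorem coeff_C_mul (a : A) (P : Psi A) (n : ℤ) : (C a * P).coeff n = a * P.coeff n := by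
  change (mon a 0 * P).coeff n = _
  rw [mon_mul, dmul_zero]

theorem dp_mul (i : ℤ) (P : Psi A) : dp i * P = dmul i P := by
  ext n
  rw [dp, mon_mul, one_mul]

theorem C_mul_dp (a : A) (i : ℤ) : C a * dp i = mon a i := by
  ext n
  rw [coeff_C_mul, dp, coeff_mon, coeff_mon]; split_ifs <;> simp

theorem coeff_C (a : A) (n : ℤ) : (C a).coeff n = if n = 0 then a else 0 := rfl

theorem ord_C (a : A) : (C a).Ord 0 := ord_mon a 0

theorem dp_one_mul_dp (j : ℤ) : dp 1 * dp j = (dp (j + 1) : Psi A) := by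
  ext n
  rw [dp_mul, coeff_dmul_one]
  simp only [coeff_dp]
  split_ifs <;> first | omega | simp

theorem dp_mul_dp (i j : ℤ) : dp i * dp j = (dp (i + j) : Psi A) := by
  induction i with
  | zero => rw [dp_zero, one_mul, zero_add]
  | succ i ih =>
    rw [dp_mul, dmul_succ, ← dp_mul, ← dp_mul, ih, dp_one_mul_dp]
    congr 1; ring
  | pred i ih =>
    apply dmul_one_injective
    rw [dp_mul, ← dmul_succ, ← dp_mul, ← dp_mul, dp_one_mul_dp, sub_add_cancel, ih]
    congr 1; ring

theorem mon_mul_dp (a : A) (i j : ℤ) : mon a i * dp j = mon a (i + j) := by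
  rw [← C_mul_dp, mul_assoc, dp_mul_dp, C_mul_dp]

/-- Shift of the coefficients. -/
def shift (j : ℤ) : Psi A →+ Psi A where
  toFun P := ⟨fun n => P.coeff (n - j), by
    obtain ⟨m, hm⟩ := P.exists_ord
    exact ⟨m + j, fun n hn => hm _ (by omega)⟩⟩
  map_zero' := rfl
  map_add' _ _ := rfl

theorem coeff_mul_dp (P : Psi A) (j n : ℤ) : (P * dp j).coeff n = P.coeff (n - j) := by
  have : mulRightHom (dp j) P = shift j P :=
    eq_of_mon (φ := mulRightHom (dp j)) (ψ := shift j) j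
      (fun P m hP => hP.mul (ord_dp j)) (fun P m hP n hn => hP _ (by omega)) (fun a i => by
        change mon a i * dp j = _
        rw [mon_mul_dp]
        ext n
        change (if n = i + j then a else 0) = if n - j = i then a else 0
        split_ifs <;> first | omega | rfl) P
  exact congrArg (fun Q => Q.coeff n) this

theorem coeff_dp_one_mul (P : Psi A) (n : ℤ) :
    (dp 1 * P).coeff n = (P.coeff n)′ + P.coeff (n - 1) := by
  rw [dp_mul, coeff_dmul_one]

theorem dp_one_mul_C (a : A) : dp 1 * C a = C a * dp 1 + C a′ := by
  ext n
  rw [coeff_dp_one_mul, coeff_add, coeff_mul_dp]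
  simp only [coeff_C]
  split_ifs <;> simp_all

theorem coeff_mul_top {P Q : Psi A} {p q : ℤ} (hP : P.Ord p) (hQ : Q.Ord q) :
    (P * Q).coeff (p + q) = P.coeff p * Q.coeff q := by
  rw [coeff_mul hP hQ (p + q) (lo := p) (hi := p) (by omega) le_rfl, Finset.Icc_self,
    Finset.sum_singleton, coeff_dmul hQ p (p + q) (K := 1) (by push_cast; omega),
    Finset.sum_range_one]
  simp [iterD_zero]

theorem IsDiff.mul {P Q : Psi A} (hP : P.IsDiff) (hQ : Q.IsDiff) : (P * Q).IsDiff := by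
  have key : ∀ i : ℕ, (dmul (i : ℤ) Q).IsDiff := by
    intro i
    induction i with
    | zero => simpa [dmul_zero] using hQ
    | succ i ih =>
      intro n hn
      rw [Nat.cast_succ, dmul_succ, coeff_dmul_one, ih n hn, ih (n - 1) (by omega)]
      simp
  intro n hn
  rw [coeff_mul']
  refine finsum_eq_zero_of_forall_eq_zero fun i => ?_
  rcases lt_or_ge i 0 with h | h
  · rw [hP i h, zero_mul]
  · lift i to ℕ using h
    rw [key i n hn, mul_zero]

theorem isDiff_C (a : A) : (C a).IsDiff := fun i hi => if_neg (by omega)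

theorem IsDiff.pow {P : Psi A} (hP : P.IsDiff) (k : ℕ) : (P ^ k).IsDiff := by
  induction k with
  | zero => rw [pow_zero]; exact isDiff_dp le_rfl
  | succ k ih => rw [pow_succ]; exact ih.mul hP

/-! ### The formal adjoint -/

theorem support_adj {v : Psi A} {m : ℤ} (hv : v.Ord m) (n : ℤ) :
    (Function.support fun l : ℕ => (((n + l).negOnePow : ℤ) * Ring.choose (n + l) l) •
      iterD l (v.coeff (n + l))) ⊆ Finset.range (m - n + 1).toNat := by
  intro l hl
  by_contra h
  simp only [Finset.coe_range, Set.mem_Iio, not_lt] at h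
  exact hl (by simp [hv (n + l) (by omega)])

/-- The formal adjoint `(∑ r_i ∂^i)^* = ∑ (-∂)^i r_i`. -/
def adj : Psi A →+ Psi A where
  toFun v := ⟨fun n => ∑ᶠ l : ℕ, (((n + l).negOnePow : ℤ) * Ring.choose (n + l) l) •
      iterD l (v.coeff (n + l)), by
    obtain ⟨m, hm⟩ := v.exists_ord
    refine ⟨m, fun n hn => finsum_eq_zero_of_forall_eq_zero fun l => ?_⟩
    rw [hm _ (by omega)]
    simp⟩
  map_zero' := by
    ext n
    exact finsum_eq_zero_of_forall_eq_zero fun l => by simp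
  map_add' v w := by
    ext n
    obtain ⟨m, hm⟩ := v.exists_ord
    obtain ⟨m', hm'⟩ := w.exists_ord
    refine Eq.trans (finsum_congr fun l => ?_)
      (finsum_add_distrib ((Finset.finite_toSet _).subset (support_adj hm n))
      ((Finset.finite_toSet _).subset (support_adj hm' n)))
    rw [coeff_add, map_add, smul_add]

theorem coeff_adj (v : Psi A) (n : ℤ) :
    (adj v).coeff n = ∑ᶠ l : ℕ, (((n + l).negOnePow : ℤ) * Ring.choose (n + l) l) •
      iterD l (v.coeff (n + l)) := rfl

theorem Ord.adj {v : Psi A} {m : ℤ} (hv : v.Ord m) : (adj v).Ord m := fun n hn =>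
  finsum_eq_zero_of_forall_eq_zero fun l => by rw [hv _ (by omega)]; simp

theorem adj_mon (a : A) (i : ℤ) : adj (mon a i) = (i.negOnePow : ℤ) • (dp i * C a) := by
  ext n
  have h1 : ((i.negOnePow : ℤ) • (dp i * C a)).coeff n = (i.negOnePow : ℤ) • (dp i * C a).coeff n :=
    map_zsmul (coeffHom n) _ _
  rw [h1, dp_mul, coeff_dmul', coeff_adj]
  rcases lt_or_ge i n with h | h
  · rw [finsum_eq_zero_of_forall_eq_zero, finsum_eq_zero_of_forall_eq_zero, smul_zero]
    · intro l; rw [coeff_C, if_neg (by omega)]; simp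
    · intro l; rw [coeff_mon, if_neg (by omega)]; simp
  · obtain ⟨l, rfl⟩ : ∃ l : ℕ, i = n + l := ⟨(i - n).toNat, by omega⟩
    rw [finsum_eq_single _ l, finsum_eq_single _ l, coeff_mon, coeff_C, if_pos rfl,
      if_pos (by omega), smul_smul]
    · intro k hk; rw [coeff_C, if_neg (by omega)]; simp
    · intro k hk; rw [coeff_mon, if_neg (by omega)]; simp

theorem adj_one : adj (1 : Psi A) = 1 := by
  rw [one_def, adj_mon, map_one, dp_zero, mul_one, Int.negOnePow_zero]; exact one_smul _ _

theorem adj_C_mul (a : A) (P : Psi A) : adj (C a * P) = adj P * C a := by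
  refine eq_of_mon (φ := adj.comp (AddMonoidHom.mulLeft (C a)))
    (ψ := (AddMonoidHom.mulRight (C a)).comp adj) 0
    (fun P m hP => by simpa using ((ord_C a).mul hP).adj)
    (fun P m hP => hP.adj.mul (ord_C a)) (fun b i => ?_) P
  change adj (C a * mon b i) = adj (mon b i) * C a
  rw [← C_mul_dp, ← mul_assoc, ← map_mul, C_mul_dp, C_mul_dp, adj_mon, adj_mon, smul_mul_assoc,
    mul_assoc, ← map_mul, mul_comm a b]

theorem adj_dp_one_mul (P : Psi A) : adj (dp 1 * P) = -(adj P * dp 1) := by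
  refine eq_of_mon (φ := adj.comp (AddMonoidHom.mulLeft (dp 1)))
    (ψ := -(AddMonoidHom.mulRight (dp 1)).comp adj) 1
    (fun P m hP => by rw [add_comm]; exact ((ord_dp 1).mul hP).adj)
    (fun P m hP n hn => by
      change (-(adj P * dp 1)).coeff n = 0
      rw [coeff_neg, hP.adj.mul (ord_dp 1) n hn, neg_zero]) (fun b i => ?_) P
  change adj (dp 1 * mon b i) = -(adj (mon b i) * dp 1)
  rw [← C_mul_dp, ← mul_assoc, dp_one_mul_C, add_mul, mul_assoc, dp_one_mul_dp, map_add, C_mul_dp,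
    C_mul_dp, C_mul_dp, adj_mon, adj_mon, adj_mon, smul_mul_assoc, mul_assoc, ← dp_one_mul_dp,
    mul_assoc, Int.negOnePow_succ]
  have h1 : C b * dp 1 = dp 1 * C b - C b′ := by rw [dp_one_mul_C]; abel
  have h2 : (dp 1 : Psi A) * (dp i * C b) = dp i * (dp 1 * C b) := by
    rw [← mul_assoc, ← mul_assoc, dp_mul_dp, dp_mul_dp, add_comm]
  rw [h1, h2, mul_sub, smul_sub, Units.val_neg, neg_smul]
  abel

theorem adj_dp_mul (i : ℤ) (P : Psi A) : adj (dp i * P) = (i.negOnePow : ℤ) • (adj P * dp i) := by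
  induction i with
  | zero => simp [dp_zero]
  | succ i ih =>
    rw [add_comm, ← dp_mul_dp, mul_assoc, adj_dp_one_mul, ih, add_comm 1, Int.negOnePow_succ,
      smul_mul_assoc, mul_assoc, dp_mul_dp, dp_mul_dp, add_comm 1, Units.val_neg, neg_smul]
  | pred i ih =>
    have h : ∀ Q R : Psi A, Q * dp 1 = R * dp 1 → Q = R := fun Q R h => by
      have := congrArg (· * dp (-1)) h
      simpa [mul_assoc, dp_mul_dp, dp_zero] using this
    apply h
    have e : (dp (-(i : ℤ)) : Psi A) = dp 1 * dp (-i - 1) := by rw [dp_mul_dp]; congr 1; ring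
    rw [e, mul_assoc, adj_dp_one_mul, neg_eq_iff_eq_neg] at ih
    rw [ih, smul_mul_assoc, mul_assoc, dp_one_mul_dp, dp_mul_dp, ← neg_smul,
      ← Units.val_neg, ← Int.negOnePow_succ, Int.negOnePow_add, Int.negOnePow_sub]

theorem adj_mul (Q P : Psi A) : adj (Q * P) = adj P * adj Q := by
  obtain ⟨p, hp⟩ := P.exists_ord
  refine eq_of_mon (φ := adj.comp (AddMonoidHom.mulRight P))
    (ψ := (AddMonoidHom.mulLeft (adj P)).comp adj) p
    (fun Q m hQ => (hQ.mul hp).adj)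
    (fun Q m hQ => by rw [add_comm]; exact hp.adj.mul hQ.adj) (fun b i => ?_) Q
  change adj (mon b i * P) = adj P * adj (mon b i)
  rw [← C_mul_dp, mul_assoc, adj_C_mul, adj_dp_mul, C_mul_dp, adj_mon, smul_mul_assoc,
    mul_smul_comm, mul_assoc]

theorem adj_adj (P : Psi A) : adj (adj P) = P := by
  refine eq_of_mon (φ := adj.comp adj) (ψ := AddMonoidHom.id _) 0
    (fun Q m hQ => by simpa using hQ.adj.adj) (fun Q m hQ => by simpa using hQ) (fun b i => ?_) P
  change adj (adj (mon b i)) = mon b i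
  have h1 : adj (C b) = C b := by simpa [adj_one] using adj_C_mul b 1
  rw [adj_mon, map_zsmul, adj_mul, h1, dp, adj_mon, map_one, mul_one, mul_smul_comm, smul_smul,
    C_mul_dp, ← Units.val_mul]
  simp

/-- Only `l = 0` contributes: for `l ≥ 1` the binomial coefficient `(l-1 choose l)` vanishes. -/
theorem coeff_neg_one_adj (P : Psi A) : (adj P).coeff (-1) = -P.coeff (-1) := by
  rw [coeff_adj, finsum_eq_single _ 0]
  · simp [iterD_zero]
  · intro l hl
    obtain ⟨l, rfl⟩ := Nat.exists_eq_succ_of_ne_zero hl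
    have : (-1 + ((l + 1 : ℕ) : ℤ)) = (l : ℕ) := by push_cast; ring
    rw [Nat.succ_eq_add_one, this, Ring.choose_natCast, Nat.choose_eq_zero_of_lt (by omega)]
    simp

end Psi
end

/-! ### Smooth functions as a differential ring; passage from `PsiDO` to `Psi`. -/

noncomputable section

open scoped Differential
open TopologicalSpace

/-- The algebra of smooth complex functions on an open subset of the line. -/
def smoothSubalgebra (O : Opens ℝ) : Subalgebra ℂ (O → ℂ) where
  carrier := {f | ∃ g : ℝ → ℂ, ContDiffOn ℝ ∞ g O ∧ ∀ x : O, f x = g x}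
  mul_mem' := by
    rintro f f' ⟨g, hg, h⟩ ⟨g', hg', h'⟩
    exact ⟨fun x => g x * g' x, hg.mul hg', fun x => by simp [h, h']⟩
  add_mem' := by
    rintro f f' ⟨g, hg, h⟩ ⟨g', hg', h'⟩
    exact ⟨fun x => g x + g' x, hg.add hg', fun x => by simp [h, h']⟩
  algebraMap_mem' c := ⟨fun _ => c, contDiffOn_const, fun x => rfl⟩

/-- Smooth complex functions on an open subset of the line. -/
def SmoothFn (O : Opens ℝ) : Type := smoothSubalgebra O

namespace SmoothFn

variable {O : Opens ℝ}

instance : CommRing (SmoothFn O) := inferInstanceAs (CommRing (smoothSubalgebra O))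

instance : Algebra ℂ (SmoothFn O) := inferInstanceAs (Algebra ℂ (smoothSubalgebra O))

/-- A smooth function on `O` defines an element of the algebra. -/
def ofSmooth (g : ℝ → ℂ) (hg : ContDiffOn ℝ ∞ g O) : SmoothFn O := ⟨fun x => g x, g, hg, fun _ => rfl⟩

open Classical in
/-- Extension by zero. -/
def toFun (f : SmoothFn O) (x : ℝ) : ℂ := if h : x ∈ O then f.1 ⟨x, h⟩ else 0

theorem toFun_of_mem (f : SmoothFn O) {x : ℝ} (h : x ∈ O) : f.toFun x = f.1 ⟨x, h⟩ := dif_pos h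

theorem contDiffOn_toFun (f : SmoothFn O) : ContDiffOn ℝ ∞ f.toFun O := by
  obtain ⟨g, hg, h⟩ := f.2
  exact hg.congr fun x hx => by rw [toFun_of_mem f hx, h]

theorem ofSmooth_toFun (g : ℝ → ℂ) (hg : ContDiffOn ℝ ∞ g O) {x : ℝ} (h : x ∈ O) :
    (ofSmooth g hg).toFun x = g x := toFun_of_mem _ h

theorem contDiffOn_deriv {g : ℝ → ℂ} (hg : ContDiffOn ℝ ∞ g O) :
    ContDiffOn ℝ ∞ (deriv g) O :=
  ((contDiffOn_infty_iff_deriv_of_isOpen O.isOpen).mp hg).2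

theorem differentiableAt {g : ℝ → ℂ} (hg : ContDiffOn ℝ ∞ g O) {x : ℝ} (hx : x ∈ O) :
    DifferentiableAt ℝ g x :=
  ((contDiffOn_infty_iff_deriv_of_isOpen O.isOpen).mp hg).1.differentiableAt
    (O.isOpen.mem_nhds hx)

theorem eventuallyEq {g h : ℝ → ℂ} (e : Set.EqOn g h O) {x : ℝ} (hx : x ∈ O) :
    g =ᶠ[nhds x] h := Filter.eventuallyEq_of_mem (O.isOpen.mem_nhds hx) e

/-- Evaluation at a point of `O`. -/
def ev (x : O) : SmoothFn O →+* ℂ := (Pi.evalRingHom (fun _ : O => ℂ) x).comp (smoothSubalgebra O).val.toRingHom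

theorem ext_ev {f g : SmoothFn O} (h : ∀ x, ev x f = ev x g) : f = g :=
  Subtype.ext (funext h)

@[simp] theorem ev_ofSmooth (x : O) (g : ℝ → ℂ) (hg : ContDiffOn ℝ ∞ g O) : ev x (ofSmooth g hg) = g x := rfl

theorem toFun_eq_ev (f : SmoothFn O) {x : ℝ} (h : x ∈ O) : f.toFun x = ev ⟨x, h⟩ f := dif_pos h

/-- Differentiation of smooth functions. -/
def derivation (O : Opens ℝ) : Derivation ℤ (SmoothFn O) (SmoothFn O) :=
  Derivation.mk'
    (AddMonoidHom.toIntLinearMap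
      { toFun := fun f => ofSmooth (deriv f.toFun) (contDiffOn_deriv f.contDiffOn_toFun)
        map_zero' := ext_ev fun x => by
          have : (0 : SmoothFn O).toFun =ᶠ[nhds x.1] fun _ => 0 :=
            eventuallyEq (fun z hz => by rw [toFun_eq_ev _ hz, map_zero]) x.2
          rw [ev_ofSmooth, this.deriv_eq]; simp
        map_add' := fun f g => ext_ev fun x => by
          have : (f + g).toFun =ᶠ[nhds x.1] f.toFun + g.toFun :=
            eventuallyEq (fun z hz => by
              rw [Pi.add_apply, toFun_eq_ev _ hz, toFun_eq_ev _ hz, toFun_eq_ev _ hz, map_add]) x.2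
          rw [map_add, ev_ofSmooth, ev_ofSmooth, ev_ofSmooth, this.deriv_eq, deriv_add
            (differentiableAt f.contDiffOn_toFun x.2) (differentiableAt g.contDiffOn_toFun x.2)] })
    fun f g => ext_ev fun x => by
      have : (f * g).toFun =ᶠ[nhds x.1] f.toFun * g.toFun :=
        eventuallyEq (fun z hz => by
          rw [Pi.mul_apply, toFun_eq_ev _ hz, toFun_eq_ev _ hz, toFun_eq_ev _ hz, map_mul]) x.2
      simp only [AddMonoidHom.coe_toIntLinearMap, AddMonoidHom.coe_mk, ZeroHom.coe_mk, ev_ofSmooth,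
        smul_eq_mul, map_add, map_mul]
      rw [this.deriv_eq, deriv_mul
        (differentiableAt f.contDiffOn_toFun x.2) (differentiableAt g.contDiffOn_toFun x.2),
        toFun_eq_ev f x.2, toFun_eq_ev g x.2]
      ring

instance : Differential (SmoothFn O) := ⟨derivation O⟩

theorem deriv_def (f : SmoothFn O) :
    f′ = ofSmooth (deriv f.toFun) (contDiffOn_deriv f.contDiffOn_toFun) := rfl

theorem ev_deriv_ofSmooth (g : ℝ → ℂ) (hg : ContDiffOn ℝ ∞ g O) (x : O) :
    ev x (ofSmooth g hg)′ = deriv g x := by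
  rw [deriv_def, ev_ofSmooth]
  exact (eventuallyEq (fun z hz => ofSmooth_toFun g hg hz) x.2).deriv_eq

theorem contDiffOn_iteratedDeriv {g : ℝ → ℂ} (hg : ContDiffOn ℝ ∞ g O) (l : ℕ) :
    ContDiffOn ℝ ∞ (iteratedDeriv l g) O := by
  induction l with
  | zero => simpa using hg
  | succ l ih => rw [iteratedDeriv_succ]; exact contDiffOn_deriv ih

theorem iterD_ofSmooth (g : ℝ → ℂ) (hg : ContDiffOn ℝ ∞ g O) (l : ℕ) :
    Psi.iterD l (ofSmooth g hg) = ofSmooth (iteratedDeriv l g) (contDiffOn_iteratedDeriv hg l) := by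
  induction l with
  | zero => exact ext_ev fun x => by simp [Psi.iterD_zero]
  | succ l ih =>
    rw [Psi.iterD_succ, ih]
    exact ext_ev fun x => by rw [ev_deriv_ofSmooth, ev_ofSmooth, iteratedDeriv_succ]

theorem hasDerivAt_toFun (f : SmoothFn O) {x : ℝ} (hx : x ∈ O) :
    HasDerivAt f.toFun ((f′ : SmoothFn O).toFun x) x := by
  rw [toFun_eq_ev _ hx, deriv_def, ev_ofSmooth]
  exact (differentiableAt f.contDiffOn_toFun hx).hasDerivAt

theorem deriv_algebraMap (c : ℂ) : (algebraMap ℂ (SmoothFn O) c)′ = 0 := by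
  have : algebraMap ℂ (SmoothFn O) c = ofSmooth (fun _ => c) contDiffOn_const := rfl
  rw [this]
  exact ext_ev fun x => by rw [ev_deriv_ofSmooth]; simp

theorem ev_algebraMap (x : O) (c : ℂ) : ev x (algebraMap ℂ (SmoothFn O) c) = c := rfl

end SmoothFn

namespace PsiDO

variable {O : Opens ℝ}

open SmoothFn

/-- The operator on the open set `O` given by a pseudo-differential operator with coefficients
smooth on `O`. -/
def toPsi (P : PsiDO) (hP : P.SmoothOn O) : Psi (SmoothFn O) :=
  ⟨fun i => ofSmooth (P.coeff i) (hP i), by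
    obtain ⟨m, hm⟩ := P.bdd
    exact ⟨m, fun i hi => ext_ev fun x => by simp [hm i hi]⟩⟩

theorem coeff_toPsi (P : PsiDO) (hP : P.SmoothOn O) (i : ℤ) :
    (P.toPsi hP).coeff i = ofSmooth (P.coeff i) (hP i) := rfl

theorem ev_coeff_toPsi (P : PsiDO) (hP : P.SmoothOn O) (i : ℤ) (x : O) :
    ev x ((P.toPsi hP).coeff i) = P.coeff i x := rfl

theorem coeff_mul_def (P Q : PsiDO) (n : ℤ) (x : ℝ) : (P * Q).coeff n x = ∑ᶠ i : ℤ, ∑ᶠ l : ℕ,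
    ((Ring.choose i l : ℤ) : ℂ) * P.coeff i x * iteratedDeriv l (Q.coeff (n - i + l)) x := rfl

/-- Boundedness of orders makes both nested sums finitely supported, so evaluation at a point passes
through them. -/
theorem coeff_mul_eq_ev {P Q : PsiDO} (hP : P.SmoothOn O) (hQ : Q.SmoothOn O) (n : ℤ) (x : O) :
    (P * Q).coeff n x = ev x ((P.toPsi hP * Q.toPsi hQ).coeff n) := by
  obtain ⟨p, hp⟩ := (P.toPsi hP).exists_ord
  obtain ⟨q, hq⟩ := (Q.toPsi hQ).exists_ord
  rw [coeff_mul_def, Psi.coeff_mul', map_finsum _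
    ((Finset.finite_toSet _).subset (Psi.support_mul _ hp hq n))]
  refine finsum_congr fun i => ?_
  have hfin := (Finset.finite_toSet _).subset (Psi.support_dmul hq (Ring.choose i) n i)
  rw [map_mul, Psi.coeff_dmul', ev_coeff_toPsi, map_finsum _ hfin, mul_finsum' _ _
    (hfin.subset fun l hl h => hl (by simp only [h, map_zero]))]
  refine finsum_congr fun l => ?_
  rw [coeff_toPsi, iterD_ofSmooth, map_zsmul, ev_ofSmooth, zsmul_eq_mul]
  ring

theorem SmoothOn.mul {P Q : PsiDO} (hP : P.SmoothOn O) (hQ : Q.SmoothOn O) :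
    (P * Q).SmoothOn O := fun n =>
  ((P.toPsi hP * Q.toPsi hQ).coeff n).contDiffOn_toFun.congr fun x hx => by
    rw [toFun_eq_ev _ hx]; exact coeff_mul_eq_ev hP hQ n ⟨x, hx⟩

theorem toPsi_mul {P Q : PsiDO} (hP : P.SmoothOn O) (hQ : Q.SmoothOn O) :
    (P * Q).toPsi (hP.mul hQ) = P.toPsi hP * Q.toPsi hQ :=
  Psi.ext fun n => ext_ev fun x => coeff_mul_eq_ev hP hQ n x

theorem coeff_adjoint_eq_ev {P : PsiDO} (hP : P.SmoothOn O) (n : ℤ) (x : O) :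
    P.adjoint.coeff n x = ev x ((Psi.adj (P.toPsi hP)).coeff n) := by
  obtain ⟨p, hp⟩ := (P.toPsi hP).exists_ord
  rw [Psi.coeff_adj, map_finsum _ ((Finset.finite_toSet _).subset (Psi.support_adj hp n))]
  refine finsum_congr fun l => ?_
  rw [coeff_toPsi, iterD_ofSmooth, map_zsmul, ev_ofSmooth, zsmul_eq_mul]
  push_cast
  ring

theorem SmoothOn.adjoint {P : PsiDO} (hP : P.SmoothOn O) : P.adjoint.SmoothOn O := fun n =>
  ((Psi.adj (P.toPsi hP)).coeff n).contDiffOn_toFun.congr fun x hx => by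
    rw [toFun_eq_ev _ hx]; exact coeff_adjoint_eq_ev hP n ⟨x, hx⟩

theorem toPsi_adjoint {P : PsiDO} (hP : P.SmoothOn O) :
    P.adjoint.toPsi hP.adjoint = Psi.adj (P.toPsi hP) :=
  Psi.ext fun n => ext_ev fun x => coeff_adjoint_eq_ev hP n x

theorem toPsi_congr {P Q : PsiDO} (hP : P.SmoothOn O) (hQ : Q.SmoothOn O) {I : Set ℝ}
    (hI : (O : Set ℝ) ⊆ I) (h : EqOn I P Q) : P.toPsi hP = Q.toPsi hQ :=
  Psi.ext fun n => ext_ev fun x => h n (hI x.2)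

theorem smoothOn_dpow (m : ℤ) : (dpow m).SmoothOn O := fun i => by
  change ContDiffOn ℝ ∞ (if i = m then (1 : ℝ → ℂ) else 0) (O : Set ℝ)
  split_ifs
  · exact contDiffOn_const
  · exact contDiffOn_const

theorem toPsi_dpow (m : ℤ) : (dpow m).toPsi (smoothOn_dpow (O := O) m) = Psi.dp m :=
  Psi.ext fun n => ext_ev fun x => by
    rw [ev_coeff_toPsi, Psi.coeff_dp]
    change (if n = m then (1 : ℝ → ℂ) else 0) x = _
    split_ifs <;> simp

theorem smoothOn_one : (1 : PsiDO).SmoothOn O := smoothOn_dpow 0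

theorem toPsi_one : (1 : PsiDO).toPsi (smoothOn_one (O := O)) = 1 := toPsi_dpow 0

theorem smoothOn_ofFun {f : ℝ → ℂ} (hf : ContDiffOn ℝ ∞ f O) : (ofFun f).SmoothOn O := fun i => by
  change ContDiffOn ℝ ∞ (if i = 0 then f else 0) (O : Set ℝ)
  split_ifs
  · exact hf
  · exact contDiffOn_const

theorem toPsi_ofFun {f : ℝ → ℂ} (hf : ContDiffOn ℝ ∞ f O) :
    (ofFun f).toPsi (smoothOn_ofFun hf) = Psi.C (ofSmooth f hf) :=
  Psi.ext fun n => ext_ev fun x => by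
    rw [ev_coeff_toPsi, Psi.coeff_C]
    change (if n = 0 then f else 0) x = _
    split_ifs <;> simp

theorem SmoothOn.pow {P : PsiDO} (hP : P.SmoothOn O) (k : ℕ) : (P ^ k).SmoothOn O := by
  induction k with
  | zero => exact smoothOn_one
  | succ k ih => exact ih.mul hP

theorem toPsi_pow {P : PsiDO} (hP : P.SmoothOn O) (k : ℕ) :
    (P ^ k).toPsi (hP.pow k) = P.toPsi hP ^ k := by
  induction k with
  | zero => rw [pow_zero]; exact toPsi_one
  | succ k ih => rw [pow_succ, ← ih]; exact toPsi_mul (hP.pow k) hP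

end PsiDO
end

/-! ### The resolvent operator and the bilinear identity. -/

noncomputable section

open scoped Differential
open TopologicalSpace

namespace Psi

variable {A : Type*} [CommRing A] [Differential A]

theorem coeff_adj_top {P : Psi A} {m : ℤ} (hP : P.Ord m) :
    (adj P).coeff m = (m.negOnePow : ℤ) • P.coeff m := by
  rw [coeff_adj, finsum_eq_single _ 0]
  · simp [iterD_zero]
  · intro l hl
    rw [hP _ (by omega)]
    simp

/-- A leading coefficient of `Q` in positive order would survive in `Q * P`, since `P` is monic of
order zero. -/
theorem ord_zero_of_mul_eq_one {P Q : Psi A} (hP : P.Ord 0) (hP0 : P.coeff 0 = 1)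
    (h : Q * P = 1) : Q.Ord 0 := by
  have key : ∀ k : ℕ, Q.Ord k → Q.Ord 0 := by
    intro k
    induction k with
    | zero => exact id
    | succ k ih =>
      intro hQ
      apply ih
      intro i hi
      rcases eq_or_lt_of_le (Int.add_one_le_iff.mpr hi) with h1 | h1
      · have := coeff_mul_top hQ hP
        rw [h, hP0, mul_one, add_zero, one_def, coeff_mon, if_neg (by omega)] at this
        rw [← h1]
        exact_mod_cast this.symm
      · exact hQ i (by push_cast; omega)
  obtain ⟨m, hm⟩ := Q.exists_ord
  exact key m.toNat (hm.mono (by omega))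

/-- Operators all of whose coefficients are constants. -/
def IsConst (P : Psi A) : Prop := ∀ n, (P.coeff n)′ = 0

theorem IsConst.coeff_dmul {P : Psi A} (hP : P.IsConst) (i n : ℤ) :
    (dmul i P).coeff n = P.coeff (n - i) := by
  rw [coeff_dmul', finsum_eq_single _ 0]
  · simp [iterD_zero]
  · intro l hl
    obtain ⟨l, rfl⟩ := Nat.exists_eq_succ_of_ne_zero hl
    have : ∀ n, iterD (l + 1) (P.coeff n) = 0 := by
      intro n
      induction l with
      | zero => rw [iterD_one, hP]
      | succ l ih => rw [iterD_succ, ih (by omega), map_zero]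
    rw [Nat.succ_eq_add_one, this, smul_zero]

theorem IsConst.dp_mul_comm {P : Psi A} (hP : P.IsConst) (i : ℤ) : dp i * P = P * dp i := by
  ext n
  rw [dp_mul, hP.coeff_dmul, coeff_mul_dp]

/-- The adjoint changes the sign of residues, and `∂^a P^* = (-1)^a (P ∂^a)^*`. Summed against
coefficients, this is the formal version of `Res_z (P e^{xz}) (Q e^{-xz}) = res (P Q^*)`. -/
theorem coeff_neg_one_dmul_adj (a : ℤ) (P : Psi A) :
    (dmul a (adj P)).coeff (-1) = -((a.negOnePow : ℤ) • P.coeff (-1 - a)) := by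
  have h1 : adj (P * dp a) = (a.negOnePow : ℤ) • (dp a * adj P) := by
    rw [adj_mul, dp, adj_mon, map_one, mul_one, smul_mul_assoc]
    rfl
  have h2 : dp a * adj P = (a.negOnePow : ℤ) • adj (P * dp a) := by
    rw [h1, smul_smul, ← Units.val_mul]
    simp
  rw [← dp_mul, h2]
  have h3 := map_zsmul (coeffHom (A := A) (-1)) (a.negOnePow : ℤ) (adj (P * dp a))
  simp only [coeffHom_apply] at h3
  rw [h3, coeff_neg_one_adj, coeff_mul_dp, smul_neg]

theorem conj_pow {S T L D : Psi A} (hTS : T * S = 1) (hL : L = S * D * T) (m : ℕ) :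
    L ^ m * S = S * D ^ m := by
  induction m with
  | zero => simp
  | succ m ih =>
    have : L * S = S * D := by rw [hL, mul_assoc, hTS, mul_one]
    rw [pow_succ, mul_assoc, this, ← mul_assoc, ih, mul_assoc, ← pow_succ]

theorem dp_pow (i : ℤ) (m : ℕ) : (dp i : Psi A) ^ m = dp (i * m) := by
  induction m with
  | zero => simp [dp_zero]
  | succ m ih => rw [pow_succ, ih, dp_mul_dp]; congr 1; push_cast; ring

end Psi

open SmoothFn

theorem smoothOn_laxOp {O : Opens ℝ} {I : Set ℝ} (hO : (O : Set ℝ) ⊆ I) {N : ℕ} {u : ℕ → ℝ → ℂ}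
    (hu : ∀ i, i + 2 ≤ N → ContDiffOn ℝ ∞ (u i) I) : (laxOp N u).SmoothOn O := fun i => by
  change ContDiffOn ℝ ∞ (if i = N then (1 : ℝ → ℂ) else if 0 ≤ i ∧ i + 2 ≤ N then u i.toNat else 0)
    (O : Set ℝ)
  split_ifs
  · exact contDiffOn_const
  · exact (hu _ (by omega)).mono hO
  · exact contDiffOn_const

/-- The operator `𝓛` on the open set `O`. -/
def laxPsi {O : Opens ℝ} {I : Set ℝ} (hO : (O : Set ℝ) ⊆ I) {N : ℕ} {u : ℕ → ℝ → ℂ}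
    (hu : ∀ i, i + 2 ≤ N → ContDiffOn ℝ ∞ (u i) I) : Psi (SmoothFn O) :=
  (laxOp N u).toPsi (smoothOn_laxOp hO hu)

theorem isDiff_laxPsi {O : Opens ℝ} {I : Set ℝ} (hO : (O : Set ℝ) ⊆ I) {N : ℕ} {u : ℕ → ℝ → ℂ}
    (hu : ∀ i, i + 2 ≤ N → ContDiffOn ℝ ∞ (u i) I) : (laxPsi hO hu).IsDiff := fun i hi =>
  ext_ev fun x => by
    change (if i = N then (1 : ℝ → ℂ) else if 0 ≤ i ∧ i + 2 ≤ N then u i.toNat else 0) x = 0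
    rw [if_neg (by omega), if_neg (by omega)]
    rfl

/-- The operator `∑ ψ*_k(y) ∂^{-k}` with constant coefficients. -/
def adjWaveConst (O : Opens ℝ) (T : PsiDO) (y : ℝ) : Psi (SmoothFn O) :=
  Psi.mk (fun n => if n ≤ 0 then
    algebraMap ℂ (SmoothFn O) ((n.negOnePow : ℤ) * T.coeff n y) else 0) 0
    fun i hi => if_neg (by omega)

theorem ord_adjWaveConst (O : Opens ℝ) (T : PsiDO) (y : ℝ) : (adjWaveConst O T y).Ord 0 :=
  fun i hi => if_neg (by omega)

theorem isConst_adjWaveConst (O : Opens ℝ) (T : PsiDO) (y : ℝ) : (adjWaveConst O T y).IsConst := by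
  intro n
  rw [adjWaveConst, Psi.coeff_mk]
  split_ifs
  · exact deriv_algebraMap _
  · exact map_zero _

theorem ev_coeff_adjWaveConst {O : Opens ℝ} (T : PsiDO) (y : ℝ) {n : ℤ} (hn : n ≤ 0) (x : O) :
    ev x ((adjWaveConst O T y).coeff n) = (n.negOnePow : ℤ) * T.coeff n y := by
  rw [adjWaveConst, Psi.coeff_mk, if_pos hn, ev_algebraMap]

theorem PsiDO.SmoothOn.mono {O : Opens ℝ} {I : Set ℝ} (hO : (O : Set ℝ) ⊆ I) {P : PsiDO}
    (hP : P.SmoothOn I) : P.SmoothOn O := fun i => (hP i).mono hO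

theorem ev_coeff_mul_adjWaveConst {O : Opens ℝ} {P : Psi (SmoothFn O)} {p : ℤ} (hP : P.Ord p)
    (T : PsiDO) (y : ℝ) (n : ℤ) (x : O) : ev x ((P * adjWaveConst O T y).coeff n) =
      ∑ i ∈ Finset.Icc n p, ev x (P.coeff i) * (((n - i).negOnePow : ℤ) * T.coeff (n - i) y) := by
  rw [Psi.coeff_mul hP (ord_adjWaveConst O T y) n (lo := n) (by omega) le_rfl, map_sum]
  refine Finset.sum_congr rfl fun i hi => ?_
  rw [map_mul, (isConst_adjWaveConst O T y).coeff_dmul, ev_coeff_adjWaveConst]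
  simp only [Finset.mem_Icc] at hi
  omega

/-- The operator `W_y = ∑ ω_n(x,y) ∂_x^{-n}` intertwines `𝓛` and `∂^N`, and its kernel is flat on
the diagonal. -/
theorem exists_resolvent_op {I : Set ℝ} (hI : IsOpen I) {N : ℕ} {u : ℕ → ℝ → ℂ}
    (hu : ∀ i, i + 2 ≤ N → ContDiffOn ℝ ∞ (u i) I) {w : ℕ → ℝ → ℝ → ℂ}
    (hw : IsResolventCoeffs I N u w) {y : ℝ} (hy : y ∈ I) {O : Opens ℝ} (hO : (O : Set ℝ) ⊆ I) :
    ∃ W : Psi (SmoothFn O), W.Ord 0 ∧ W.coeff 0 = 1 ∧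
      (∀ (n : ℕ) (x : O), ev x (W.coeff (-n)) = w n x y) ∧
      laxPsi hO hu * W = W * Psi.dp N ∧
      ∀ hyO : y ∈ O, ∀ i m : ℕ, ev ⟨y, hyO⟩ ((Psi.dp i * W).coeff (-1 - N * m)) = 0 := by
  obtain ⟨S, T, ⟨hS, hS1, hS0, Sinv, ⟨hSi, hSSi, hSiS⟩, hL⟩, ⟨hT, hST, hTS⟩, hww⟩ := hw
  have facts : ∀ (O : Opens ℝ) (hO : (O : Set ℝ) ⊆ I),
      ∃ σ σi τ : Psi (SmoothFn O), σ.Ord 0 ∧ σi.Ord 0 ∧ τ.Ord 0 ∧ σ.coeff 0 = 1 ∧ τ.coeff 0 = 1 ∧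
      σ * σi = 1 ∧ σi * σ = 1 ∧ laxPsi hO hu = σ * Psi.dp N * σi ∧ σi = Psi.adj τ ∧
      (∀ i x, ev x (σ.coeff i) = S.coeff i x) ∧ (∀ i x, ev x (τ.coeff i) = T.coeff i x) := by
    intro O hO
    have hS' := PsiDO.SmoothOn.mono hO hS
    have hSi' := PsiDO.SmoothOn.mono hO hSi
    have hT' := PsiDO.SmoothOn.mono hO hT
    have h1 : S.toPsi hS' * Sinv.toPsi hSi' = 1 := by
      rw [← PsiDO.toPsi_mul, ← PsiDO.toPsi_one]; exact PsiDO.toPsi_congr _ _ hO hSSi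
    have h2 : Sinv.toPsi hSi' * S.toPsi hS' = 1 := by
      rw [← PsiDO.toPsi_mul, ← PsiDO.toPsi_one]; exact PsiDO.toPsi_congr _ _ hO hSiS
    have h3 : Psi.adj (S.toPsi hS') * T.toPsi hT' = 1 := by
      rw [← PsiDO.toPsi_adjoint, ← PsiDO.toPsi_mul, ← PsiDO.toPsi_one]
      exact PsiDO.toPsi_congr _ _ hO hST
    have ho : (S.toPsi hS').Ord 0 := fun i hi => ext_ev fun x => hS1 i hi x (hO x.2)
    have h0 : (S.toPsi hS').coeff 0 = 1 := ext_ev fun x => hS0 x (hO x.2)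
    have hoi := Psi.ord_zero_of_mul_eq_one ho h0 h2
    have h0i : (Sinv.toPsi hSi').coeff 0 = 1 := by
      have := Psi.coeff_mul_top ho hoi
      rw [h1, h0, one_mul] at this
      rw [← this]; rfl
    have h4 : T.toPsi hT' = Psi.adj (Sinv.toPsi hSi') := by
      have h5 : Psi.adj (Sinv.toPsi hSi') * Psi.adj (S.toPsi hS') = 1 := by
        rw [← Psi.adj_mul, h1, Psi.adj_one]
      calc T.toPsi hT' = Psi.adj (Sinv.toPsi hSi') * Psi.adj (S.toPsi hS') * T.toPsi hT' := by
            rw [h5, one_mul]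
        _ = _ := by rw [mul_assoc, h3, mul_one]
    refine ⟨S.toPsi hS', Sinv.toPsi hSi', T.toPsi hT', ho, hoi, ?_, h0, ?_, h1, h2, ?_, ?_,
      fun _ _ => rfl, fun _ _ => rfl⟩
    · rw [h4]; exact hoi.adj
    · rw [h4, Psi.coeff_adj_top hoi, h0i]; simp
    · rw [← PsiDO.toPsi_dpow, ← PsiDO.toPsi_mul, ← PsiDO.toPsi_mul]
      exact PsiDO.toPsi_congr _ _ hO hL
    · rw [h4, Psi.adj_adj]
  obtain ⟨σ, σi, τ, hσ, hσi, hτ, hσ0, hτ0, h1, h2, hℓ, hadj, hσS, hτT⟩ := facts O hO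
  -- The point `y` need not lie in `O`, so the value is read off on all of `I`.
  have hT0 : T.coeff 0 y = 1 := by
    obtain ⟨-, -, τ', -, -, -, -, h, -, -, -, -, -, h'⟩ := facts ⟨I, hI⟩ subset_rfl
    rw [← h' 0 ⟨y, hy⟩, h, map_one]
  have hc := isConst_adjWaveConst O T y
  refine ⟨σ * adjWaveConst O T y, hσ.mul (ord_adjWaveConst O T y), ?_, ?_, ?_, ?_⟩
  · have := Psi.coeff_mul_top hσ (ord_adjWaveConst O T y)
    rw [hσ0, one_mul, add_zero] at this
    rw [this]
    exact ext_ev fun x => by rw [ev_coeff_adjWaveConst _ _ le_rfl, hT0]; simp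
  · intro n x
    rw [ev_coeff_mul_adjWaveConst hσ, hww n x (hO x.2) y hy]
    refine (Finset.sum_bij (fun (k : ℕ) _ => -(k : ℤ)) ?_ ?_ ?_ ?_).symm
    · intro k hk; simp only [Finset.mem_range, Finset.mem_Icc] at hk ⊢; omega
    · intro k _ l _ h; omega
    · intro i hi
      simp only [Finset.mem_Icc] at hi
      exact ⟨i.natAbs, by simp only [Finset.mem_range]; omega, by omega⟩
    · intro k hk
      simp only [Finset.mem_range] at hk
      have e : -(n : ℤ) - -(k : ℤ) = -((n - k : ℕ) : ℤ) := by omega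
      rw [hσS, waveCoeff, adjWaveCoeff, e, Int.negOnePow_neg, Int.coe_negOnePow_natCast]
      push_cast
      ring
  · rw [hℓ, mul_assoc, ← mul_assoc σi, h2, one_mul, mul_assoc, mul_assoc, hc.dp_mul_comm]
  · intro hyO i m
    have hP : (Psi.dp i * σ * Psi.dp (N * m)).Ord (i + N * m) := by
      have := ((Psi.ord_dp (A := SmoothFn O) i).mul hσ).mul (Psi.ord_dp (A := SmoothFn O) (N * m))
      rwa [add_zero] at this
    -- The right factor has constant coefficients and commutes with `∂^{Nm}`; this turns the
    -- coefficient of `∂^{-1-Nm}` into a residue.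
    have e1 : (Psi.dp i * (σ * adjWaveConst O T y)).coeff (-1 - N * m)
        = (Psi.dp i * σ * Psi.dp (N * m) * adjWaveConst O T y).coeff (-1) := by
      rw [mul_assoc _ (Psi.dp _), hc.dp_mul_comm, ← mul_assoc, ← mul_assoc, Psi.coeff_mul_dp]
    -- With the true inverse of `S` in place of the frozen factor, the product collapses to the
    -- differential operator `∂^i 𝓛^m`, whose residue is zero.
    have e2 : Psi.dp i * σ * Psi.dp (N * m) * σi = Psi.dp i * laxPsi hO hu ^ m := by
      have := Psi.conj_pow h2 hℓ m
      rw [Psi.dp_pow] at this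
      rw [mul_assoc _ σ, ← this, mul_assoc, mul_assoc, h1, mul_one]
    have e3 : (Psi.dp i * σ * Psi.dp (N * m) * σi).coeff (-1) = 0 := by
      rw [e2]
      exact (Psi.isDiff_dp (by omega)).mul ((isDiff_laxPsi hO hu).pow m) _ (by omega)
    rw [e1, ev_coeff_mul_adjWaveConst hP]
    rw [Psi.coeff_mul hP hσi (-1) (lo := -1) (by omega) le_rfl] at e3
    have e4 := congrArg (ev ⟨y, hyO⟩) e3
    rw [map_sum, map_zero] at e4
    rw [← e4]
    -- At `x = y` the frozen coefficients of `T` are those of `τ`, and the two residues agree term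
    -- by term.
    refine Finset.sum_congr rfl fun a ha => ?_
    rw [hadj, Psi.coeff_neg_one_dmul_adj, map_mul, map_neg, map_zsmul, hτT, zsmul_eq_mul,
      Int.negOnePow_sub]
    simp
end

noncomputable section

open scoped Differential
open TopologicalSpace

/-! ### Flatness on the diagonal -/

theorem isLittleO_of_iteratedDeriv_eq_zero {f : ℝ → ℂ} {I : Set ℝ} (hI : IsOpen I) {y : ℝ}
    (hy : y ∈ I) (hf : ContDiffOn ℝ ∞ f I) {R : ℕ} (h : ∀ i ≤ R, iteratedDeriv i f y = 0) :
    f =o[nhds y] fun x => (x - y) ^ R := by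
  obtain ⟨ε, hε, hball⟩ := Metric.isOpen_iff.mp hI y hy
  have hb : y ∈ Metric.ball y ε := Metric.mem_ball_self hε
  have key := taylor_isLittleO (n := R) (convex_ball y ε) hb
    ((hf.mono hball).of_le (by exact_mod_cast le_top))
  rw [Metric.isOpen_ball.nhdsWithin_eq hb] at key
  refine key.congr_left fun x => ?_
  rw [taylor_within_apply, Finset.sum_eq_zero, sub_zero]
  intro i hi
  rw [iteratedDerivWithin_of_isOpen Metric.isOpen_ball hb,
    h i (Nat.lt_succ_iff.mp (Finset.mem_range.mp hi)), smul_zero]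

theorem contDiff_sub_pow_div (y : ℝ) (p : ℕ) :
    ContDiff ℝ ∞ fun x : ℝ => (((x - y : ℝ) : ℂ)) ^ p / (p.factorial : ℂ) := by
  have : ContDiff ℝ ∞ fun x : ℝ => ((x - y : ℝ) : ℂ) :=
    Complex.ofRealCLM.contDiff.comp (contDiff_id.sub contDiff_const)
  exact (this.pow p).div_const _

/-- The divided powers are dual to the derivatives at `y`; Leibniz' rule then gives derivatives of
`∑ f_p (x-y)^p / p!` as binomial convolutions. -/
theorem iteratedDeriv_sub_pow_div (y : ℝ) (r p : ℕ) :
    iteratedDeriv r (fun x : ℝ => ((x - y : ℝ) : ℂ) ^ p / (p.factorial : ℂ)) y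
      = if r = p then 1 else 0 := by
  induction r generalizing p with
  | zero => cases p <;> simp
  | succ r ih =>
    rw [iteratedDeriv_succ']
    cases p with
    | zero => simp
    | succ p =>
      have : deriv (fun x : ℝ => ((x - y : ℝ) : ℂ) ^ (p + 1) / ((p + 1).factorial : ℂ))
          = fun x : ℝ => ((x - y : ℝ) : ℂ) ^ p / (p.factorial : ℂ) := by
        funext x
        have h1 : HasDerivAt (fun x : ℝ => ((x - y : ℝ) : ℂ)) 1 x := by
          simpa using ((hasDerivAt_id x).sub_const y).ofReal_comp
        have h2 := ((h1.pow (p + 1)).div_const ((p + 1).factorial : ℂ)).deriv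
        refine h2.trans ?_
        have : (p.factorial : ℂ) ≠ 0 := Nat.cast_ne_zero.mpr p.factorial_ne_zero
        have : (p + 1 : ℂ) ≠ 0 := by exact_mod_cast p.succ_ne_zero
        rw [Nat.factorial_succ]
        push_cast
        field_simp
      rw [this, ih]
      simp

/-- The expansion `∑ f_p (x-y)^p / p!` of functions whose binomial convolutions of derivatives at
`y` vanish is flat at `y`. -/
theorem isLittleO_sum_pow_div {I : Set ℝ} (hI : IsOpen I) {y : ℝ} (hy : y ∈ I) {f : ℕ → ℝ → ℂ}
    (hf : ∀ p, ContDiffOn ℝ ∞ (f p) I) (R : ℕ)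
    (h : ∀ i ≤ R, ∑ q ∈ Finset.range (i + 1), (i.choose q : ℂ) * iteratedDeriv q (f (i - q)) y = 0) :
    (fun x : ℝ => ∑ p ∈ Finset.range (R + 1),
      f p x * (((x - y : ℝ) : ℂ) ^ p / (p.factorial : ℂ))) =o[nhds y] fun x => (x - y) ^ R := by
  refine isLittleO_of_iteratedDeriv_eq_zero hI hy
    (ContDiffOn.sum fun p _ => (hf p).mul (contDiff_sub_pow_div y p).contDiffOn) fun i hi => ?_
  have hat : ∀ p, ContDiffAt ℝ i (f p) y := fun p =>
    ((hf p).contDiffAt (hI.mem_nhds hy)).of_le (by exact_mod_cast le_top)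
  have hat' : ∀ p : ℕ, ContDiffAt ℝ i
      (fun x : ℝ => ((x - y : ℝ) : ℂ) ^ p / (p.factorial : ℂ)) y := fun p =>
    (contDiff_sub_pow_div y p).contDiffAt.of_le (by exact_mod_cast le_top)
  rw [iteratedDeriv_fun_sum fun p _ => (hat p).mul (hat' p)]
  simp only [iteratedDeriv_fun_mul (hat _) (hat' _), iteratedDeriv_sub_pow_div]
  rw [Finset.sum_comm]
  refine Eq.trans (Finset.sum_congr rfl fun q hq => ?_) (h i hi)
  simp only [mul_ite, mul_one, mul_zero]
  rw [Finset.sum_ite_eq, if_pos (by simp only [Finset.mem_range] at hq ⊢; omega)]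

-- The Leibniz expansion of the vanishing coefficient of `∂^{-1-Nm}` in `∂^i W` at the diagonal.
-- This is the hypothesis under which the divided-power sums of `ω_{Nm+1+p}` are flat.
open SmoothFn in
theorem resolvent_flat {I : Set ℝ} (hI : IsOpen I) {N : ℕ} {u : ℕ → ℝ → ℂ}
    (hu : ∀ i, i + 2 ≤ N → ContDiffOn ℝ ∞ (u i) I) {w : ℕ → ℝ → ℝ → ℂ}
    (hw : IsResolventCoeffs I N u w) {y : ℝ} (hy : y ∈ I) :
    (∀ n, ContDiffOn ℝ ∞ (fun x => w n x y) I) ∧ ∀ i m : ℕ, ∑ q ∈ Finset.range (i + 1),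
      (i.choose q : ℂ) * iteratedDeriv q (fun x => w (N * m + 1 + (i - q)) x y) y = 0 := by
  obtain ⟨W, hW, -, hWw, -, hflat⟩ := exists_resolvent_op hI hu hw hy (O := ⟨I, hI⟩) subset_rfl
  have hsm : ∀ n, ContDiffOn ℝ ∞ (fun x => w n x y) I := fun n =>
    (W.coeff (-n)).contDiffOn_toFun.congr fun x hx => by
      rw [toFun_eq_ev _ hx]; exact (hWw n ⟨x, hx⟩).symm
  have hco : ∀ n : ℕ, W.coeff (-n) = ofSmooth (fun x => w n x y) (hsm n) := fun n =>
    ext_ev fun x => hWw n x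
  refine ⟨hsm, fun i m => ?_⟩
  have h := hflat hy i m
  rw [Psi.dp_mul, Psi.coeff_dmul hW i _ (K := N * m + i + 2) (by push_cast; ring_nf; omega),
    map_sum] at h
  rw [← h]
  refine Eq.trans (Finset.sum_congr rfl fun q hq => ?_)
    (Finset.sum_subset (Finset.range_subset_range.mpr (by omega)) fun q hq hq' => ?_)
  · simp only [Finset.mem_range] at hq
    have e : (-1 - (N : ℤ) * m - i + q) = -((N * m + 1 + (i - q) : ℕ) : ℤ) := by
      push_cast [Nat.cast_sub (Nat.lt_succ_iff.mp hq)]; ring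
    rw [e, hco, iterD_ofSmooth, map_zsmul, ev_ofSmooth, Ring.choose_natCast, zsmul_eq_mul]
    simp
  · simp only [Finset.mem_range, not_lt] at hq'
    rw [Ring.choose_natCast, Nat.choose_eq_zero_of_lt (by omega)]
    simp

/-! ### Residues of powers of `(x-y)⁻¹ ∂^{N-1}` -/

namespace Psi

variable {A : Type*} [CommRing A] [Differential A]

theorem C_mul_comm_of_deriv_eq_zero {a : A} (ha : a′ = 0) (P : Psi A) : C a * P = P * C a := by
  refine eq_of_mon (φ := AddMonoidHom.mulLeft (C a)) (ψ := AddMonoidHom.mulRight (C a)) 0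
    (fun P m hP => by rw [add_comm]; exact (ord_C a).mul hP)
    (fun P m hP => hP.mul (ord_C a)) (fun b i => ?_) P
  have hc : (C a).IsConst := fun n => by
    rw [coeff_C]; split_ifs
    · exact ha
    · exact map_zero _
  change C a * mon b i = mon b i * C a
  rw [← C_mul_dp, mul_assoc, hc.dp_mul_comm, ← mul_assoc, ← mul_assoc, ← map_mul, ← map_mul,
    mul_comm]

/-- For `m ≥ 0` the product is a differential operator, and for `m < -1` its order is too low.
Residues are thus immediate once all functions stand to the right of the powers of `∂`. -/
theorem coeff_neg_one_dp_mul_C (m : ℤ) (a : A) :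
    (dp m * C a).coeff (-1) = if m = -1 then a else 0 := by
  rw [dp_mul, coeff_dmul']
  split_ifs with h
  · subst h
    rw [finsum_eq_single _ 0]
    · simp [coeff_C, iterD_zero]
    · intro l hl; rw [coeff_C, if_neg (by omega)]; simp
  · refine finsum_eq_zero_of_forall_eq_zero fun l => ?_
    rw [coeff_C]
    split_ifs with h'
    · have : m = ((l - 1 : ℕ) : ℤ) := by omega
      rw [this, Ring.choose_natCast, Nat.choose_eq_zero_of_lt (by omega)]
      simp
    · simp

end Psi

namespace SmoothFn

variable {O : Opens ℝ}

theorem hasDerivAt_sub_zpow {y x : ℝ} (hx : x ≠ y) (n : ℤ) :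
    HasDerivAt (fun x : ℝ => ((x : ℂ) - y) ^ n) (n * ((x : ℂ) - y) ^ (n - 1)) x := by
  have h0 : (x : ℂ) - y ≠ 0 := sub_ne_zero.mpr (by exact_mod_cast hx)
  have h1 : HasDerivAt (fun x : ℝ => (x : ℂ) - y) 1 x := by
    simpa using (hasDerivAt_id x).ofReal_comp.sub_const (y : ℂ)
  have h2 := (hasDerivAt_zpow n _ (Or.inl h0)).comp x h1
  rw [mul_one] at h2
  exact h2

theorem contDiffOn_sub_zpow {y : ℝ} (hy : y ∉ O) (n : ℤ) :
    ContDiffOn ℝ ∞ (fun x : ℝ => ((x : ℂ) - y) ^ n) O := by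
  have hne : ∀ x ∈ O, (x : ℂ) - y ≠ 0 := fun x hx =>
    sub_ne_zero.mpr (by rintro h; exact hy (by rwa [← Complex.ofReal_inj.mp h]))
  have h1 : ContDiff ℝ ∞ fun x : ℝ => (x : ℂ) - y :=
    Complex.ofRealCLM.contDiff.sub contDiff_const
  cases n with
  | ofNat n => simpa using (h1.pow n).contDiffOn
  | negSucc n =>
    simp only [zpow_negSucc]
    exact (h1.pow (n + 1)).contDiffOn.inv fun x hx => pow_ne_zero _ (hne x hx)

/-- The function `(x - y)^n`, `n ∈ ℤ`, away from `y`. -/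
def spow {y : ℝ} (hy : y ∉ O) (n : ℤ) : SmoothFn O := ofSmooth _ (contDiffOn_sub_zpow hy n)

variable {y : ℝ} (hy : y ∉ O)

theorem ev_spow (n : ℤ) (x : O) : ev x (spow hy n) = ((x : ℂ) - y) ^ n := rfl

include hy in
theorem ne_of_mem (x : O) : (x : ℝ) ≠ y := fun h => hy (by rw [← h]; exact x.2)

include hy in
theorem sub_ne_zero_of_mem (x : O) : ((x : ℝ) : ℂ) - y ≠ 0 :=
  sub_ne_zero.mpr (by exact_mod_cast ne_of_mem hy x)

theorem spow_mul (m n : ℤ) : spow hy m * spow hy n = spow hy (m + n) := ext_ev fun x => by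
  rw [map_mul, ev_spow, ev_spow, ev_spow, zpow_add₀ (sub_ne_zero_of_mem hy x)]

theorem spow_zero : spow hy 0 = 1 := ext_ev fun x => by rw [ev_spow, zpow_zero, map_one]

theorem deriv_spow (n : ℤ) : (spow hy n)′ = algebraMap ℂ _ n * spow hy (n - 1) :=
  ext_ev fun x => by
    rw [spow, ev_deriv_ofSmooth, (hasDerivAt_sub_zpow (ne_of_mem hy x) n).deriv, map_mul, ev_spow,
      ev_algebraMap]

end SmoothFn

open SmoothFn Psi

/-- `∑_{l ≤ i} (-1)^l F(l) / (l! (i-l)!)`. -/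
def newtonCoeff (F : ℕ → ℂ) (i : ℕ) : ℂ :=
  ∑ l ∈ Finset.range (i + 1), (-1) ^ l * F l / (l.factorial * (i - l).factorial)

theorem newtonCoeff_one (i : ℕ) : newtonCoeff (fun _ => 1) i = if i = 0 then 1 else 0 := by
  have h : (i.factorial : ℂ) * newtonCoeff (fun _ => 1) i = if i = 0 then 1 else 0 := by
    have := Int.alternating_sum_range_choose (n := i)
    have h2 := congrArg (Int.cast (R := ℂ)) this
    push_cast at h2
    rw [← h2, newtonCoeff, Finset.mul_sum]
    refine Finset.sum_congr rfl fun l hl => ?_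
    rw [Nat.cast_choose ℂ (Nat.lt_succ_iff.mp (Finset.mem_range.mp hl))]
    ring
  split_ifs at h ⊢ with hi
  · subst hi; simpa using h
  · exact (mul_eq_zero.mp h).resolve_left (Nat.cast_ne_zero.mpr i.factorial_ne_zero)

theorem newtonCoeff_mul_zero (F : ℕ → ℂ) (d : ℂ) :
    newtonCoeff (fun l => (d - l) * F l) 0 = d * newtonCoeff F 0 := by
  simp [newtonCoeff]

/-- Write `d - l = (i + 1 - l) - (i + 1 - d)`; the first part cancels against `(i + 1 - l)!`. -/
theorem newtonCoeff_mul_succ (F : ℕ → ℂ) (d : ℂ) (i : ℕ) :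
    newtonCoeff (fun l => (d - l) * F l) (i + 1) =
      newtonCoeff F i - ((i + 1 : ℕ) - d) * newtonCoeff F (i + 1) := by
  simp only [newtonCoeff]
  rw [Finset.sum_range_succ, Finset.sum_range_succ _ (i + 1), mul_add, Finset.mul_sum,
    ← sub_sub, ← Finset.sum_sub_distrib, sub_eq_add_neg _ (_ * _)]
  congr 1
  · refine Finset.sum_congr rfl fun l hl => ?_
    have hl' : l ≤ i := Nat.lt_succ_iff.mp (Finset.mem_range.mp hl)
    have e : i + 1 - l = (i - l) + 1 := by omega
    have h1 : (l.factorial : ℂ) ≠ 0 := Nat.cast_ne_zero.mpr l.factorial_ne_zero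
    have h2 : ((i - l).factorial : ℂ) ≠ 0 := Nat.cast_ne_zero.mpr (i - l).factorial_ne_zero
    have h3 : ((i : ℂ) - l + 1) ≠ 0 := by
      have : ((i - l + 1 : ℕ) : ℂ) ≠ 0 := Nat.cast_ne_zero.mpr (by omega)
      push_cast [Nat.cast_sub hl'] at this
      exact this
    rw [e, Nat.factorial_succ]
    push_cast [Nat.cast_sub hl']
    field_simp
    ring
  · push_cast
    ring

section RightForm

variable {O : Opens ℝ} {y : ℝ} (hy : y ∉ O)

/-- The operator is `∑_{i < D} ∂^i γ_i (x-y)^{i-d}`, where `γ_i` are the Newton coefficients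
of `F`. -/
def RightForm (Y : Psi (SmoothFn O)) (F : ℕ → ℂ) (d : ℤ) (D : ℕ) : Prop :=
  Y = ∑ i ∈ Finset.range D, dp i * C (algebraMap ℂ _ (newtonCoeff F i) * spow hy (i - d)) ∧
    ∀ i, D ≤ i → newtonCoeff F i = 0

/-- Meaning of `F`, with `s = x - y`: the operator acts on powers by `Y s^{d-1-l} = F(l) s^{-1-l}`.
For `Y = ∑ ∂^i γ_i s^{i-d}` this reads `F(l) = ∑ (-1)^i γ_i l!/(l-i)!`, and binomial inversion gives
`γ_i = newtonCoeff F i`. The identity has `F = 1`. -/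
theorem rightForm_one : RightForm hy 1 (fun _ => 1) 0 1 := by
  refine ⟨?_, fun i hi => by rw [newtonCoeff_one, if_neg (by omega)]⟩
  rw [Finset.sum_range_one, newtonCoeff_one, if_pos rfl]
  simp [spow_zero, dp_zero]

variable {hy}

theorem RightForm.mul_inv {Y : Psi (SmoothFn O)} {F : ℕ → ℂ} {d : ℤ} {D : ℕ}
    (h : RightForm hy Y F d D) : RightForm hy (Y * C (spow hy (-1))) F (d + 1) D := by
  refine ⟨?_, h.2⟩
  rw [h.1, Finset.sum_mul]
  refine Finset.sum_congr rfl fun i _ => ?_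
  rw [mul_assoc, ← map_mul, mul_assoc, spow_mul]
  congr 4
  ring

/-- A further `∂` on the right acts first and sends `s^{d-l}` to `(d-l) s^{d-l-1}`, which accounts
for the new factor. -/
theorem RightForm.mul_dp_one {Y : Psi (SmoothFn O)} {F : ℕ → ℂ} {d : ℤ} {D : ℕ}
    (h : RightForm hy Y F d D) :
    RightForm hy (Y * dp 1) (fun l => (d - l) * F l) (d + 1) (D + 1) := by
  have hz : ∀ i, D ≤ i → newtonCoeff F i = 0 := h.2
  refine ⟨?_, fun i hi => ?_⟩
  · have hterm : ∀ i : ℕ, dp i * C (algebraMap ℂ _ (newtonCoeff F i) * spow hy (i - d)) * dp 1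
        = dp ((i + 1 : ℕ) : ℤ) * C (algebraMap ℂ _ (newtonCoeff F i) *
            spow hy ((i + 1 : ℕ) - (d + 1)))
          - dp i * C (algebraMap ℂ _ (((i : ℂ) - d) * newtonCoeff F i) *
            spow hy (i - (d + 1))) := by
      intro i
      have e : ((i + 1 : ℕ) : ℤ) - (d + 1) = i - d := by push_cast; ring
      have e' : ((i + 1 : ℕ) : ℤ) = i + 1 := by push_cast; ring
      have hd : (algebraMap ℂ (SmoothFn O) (newtonCoeff F i) * spow hy (i - d))′ =
          algebraMap ℂ _ (((i : ℂ) - d) * newtonCoeff F i) * spow hy (i - (d + 1)) := by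
        rw [Derivation.leibniz, SmoothFn.deriv_algebraMap, smul_zero, add_zero, deriv_spow, smul_eq_mul,
          map_mul, ← mul_assoc, mul_comm (algebraMap ℂ _ (newtonCoeff F i)), sub_sub]
        push_cast
        rfl
      rw [e, e', ← hd, ← dp_mul_dp, mul_assoc, mul_assoc, ← mul_sub, dp_one_mul_C,
        add_sub_cancel_right]
    rw [h.1, Finset.sum_mul, Finset.sum_congr rfl fun i _ => hterm i, Finset.sum_sub_distrib,
      Finset.sum_range_succ' _ D]
    have hlast : ∑ i ∈ Finset.range D, dp i * C (algebraMap ℂ (SmoothFn O)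
          (((i : ℂ) - d) * newtonCoeff F i) * spow hy (i - (d + 1)))
        = ∑ i ∈ Finset.range (D + 1), dp i * C (algebraMap ℂ (SmoothFn O)
          (((i : ℂ) - d) * newtonCoeff F i) * spow hy (i - (d + 1))) := by
      rw [Finset.sum_range_succ, hz D le_rfl]
      simp
    rw [hlast, Finset.sum_range_succ' _ D, ← sub_sub, ← Finset.sum_sub_distrib, sub_eq_add_neg]
    congr 1
    · refine Finset.sum_congr rfl fun i _ => ?_
      rw [newtonCoeff_mul_succ, ← mul_sub, ← map_sub, ← sub_mul, ← map_sub]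
    · rw [newtonCoeff_mul_zero, ← mul_neg, ← map_neg, ← neg_mul, ← map_neg]
      congr 4
      push_cast
      ring
  · obtain ⟨i, rfl⟩ : ∃ i', i = i' + 1 := ⟨i - 1, by omega⟩
    rw [newtonCoeff_mul_succ, hz i (by omega), hz (i + 1) (by omega)]
    ring

/-- The accumulated factors `d - l, …, d + m - 1 - l` have their zeros at the `l` with `d ≤ l < d +
m`. -/
theorem RightForm.mul_dp {Y : Psi (SmoothFn O)} {F : ℕ → ℂ} {d : ℕ} {D : ℕ}
    (h : RightForm hy Y F d D) (m : ℕ) : ∃ F', RightForm hy (Y * dp m) F' (d + m) (D + m) ∧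
      (∀ l, F l = 0 → F' l = 0) ∧ ∀ l, d ≤ l → l < d + m → F' l = 0 := by
  induction m with
  | zero => exact ⟨F, by simpa [dp_zero] using h, fun _ => id, fun l h1 h2 => by omega⟩
  | succ m ih =>
    obtain ⟨F', h1, h2, h3⟩ := ih
    refine ⟨fun l => (((d + m : ℤ) : ℂ) - l) * F' l, ?_, fun l hl => by simp [h2 l hl],
      fun l hl hl' => ?_⟩
    · have := h1.mul_dp_one
      rw [mul_assoc, dp_mul_dp] at this
      have e1 : ((m + 1 : ℕ) : ℤ) = m + 1 := Nat.cast_succ m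
      rw [e1, ← add_assoc, ← add_assoc]
      exact this
    · rcases Nat.lt_or_ge l (d + m) with hlt | hge
      · simp [h3 l hl hlt]
      · have : l = d + m := by omega
        subst this
        simp

variable (hy)

/-- Each factor `s⁻¹ ∂^{N-1}` lowers exponents by `N` and kills `s^0, …, s^{N-2}`. Among the powers
`s^{kN-1-l}` with `l < kN`, only those with exponent congruent to `-1` modulo `N` can survive, that
is, `N ∣ l`. -/
theorem rightForm_pow {N : ℕ} (hN : 2 ≤ N) (k : ℕ) : ∃ F : ℕ → ℂ,
    RightForm hy ((C (spow hy (-1)) * dp ((N : ℤ) - 1)) ^ k) F ((k * N : ℕ) : ℤ)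
      (1 + k * (N - 1)) ∧ ∀ l < k * N, ¬ N ∣ l → F l = 0 := by
  induction k with
  | zero => exact ⟨fun _ => 1, by simpa using rightForm_one hy, fun l hl => by omega⟩
  | succ k ih =>
    obtain ⟨F, hF, hF0⟩ := ih
    have h1 := hF.mul_inv
    rw [← Nat.cast_succ] at h1
    obtain ⟨F', h2, h3, h4⟩ := h1.mul_dp (N - 1)
    have hsm : (k + 1) * N = k * N + N := by ring
    refine ⟨F', ?_, fun l hl hl' => ?_⟩
    · rw [pow_succ, ← mul_assoc]
      have e1 : ((N - 1 : ℕ) : ℤ) = (N : ℤ) - 1 := by omega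
      have e2 : ((k * N + 1 : ℕ) : ℤ) + ((N : ℤ) - 1) = (((k + 1) * N : ℕ) : ℤ) := by
        push_cast; ring
      have e3 : 1 + k * (N - 1) + (N - 1) = 1 + (k + 1) * (N - 1) := by ring
      rwa [e1, e2, e3] at h2
    · rcases Nat.lt_or_ge l (k * N) with h | h
      · exact h3 l (hF0 l h hl')
      · rcases eq_or_lt_of_le h with h' | h'
        · exact absurd ⟨k, by rw [← h']; ring⟩ hl'
        · exact h4 l h' (by omega)

/-- Residues of `∂^{-n} ((x-y)⁻¹ ∂^{N-1})^k ∂^{-j-1}` as Newton coefficients. -/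
theorem exists_residue_formula {N : ℕ} (hN : 2 ≤ N) {k j : ℕ} (hk : 1 ≤ k) (hj : j + 2 ≤ N) :
    ∃ F : ℕ → ℂ, (∀ l < k * (N - 1) - j, ¬ N ∣ l → F l = 0) ∧
      (∀ n : ℕ, 1 ≤ n → n ≤ k * (N - 1) - j →
        (dp (-(n : ℤ)) * (C (spow hy (-1)) * dp ((N : ℤ) - 1)) ^ k * dp (-(j : ℤ) - 1)).coeff (-1)
          = algebraMap ℂ _ (newtonCoeff F (n - 1)) * spow hy (n - k * N + j)) ∧
      ((C (spow hy (-1)) * dp ((N : ℤ) - 1)) ^ k * dp (-(j : ℤ) - 1)).coeff (-1) = 0 := by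
  obtain ⟨k, rfl⟩ : ∃ k', k = k' + 1 := ⟨k - 1, by omega⟩
  obtain ⟨F, hF, hF0⟩ := rightForm_pow hy hN k
  have h1 := hF.mul_inv
  rw [← Nat.cast_succ] at h1
  obtain ⟨F', h2, h3, h4⟩ := h1.mul_dp (N - 2 - j)
  -- The last `∂^{N-1}` absorbs `∂^{-j-1}` and leaves the nonnegative power `∂^{N-2-j}`, so the
  -- right form still applies.
  have e1 : (C (spow hy (-1)) * dp ((N : ℤ) - 1)) ^ (k + 1) * dp (-(j : ℤ) - 1)
      = (C (spow hy (-1)) * dp ((N : ℤ) - 1)) ^ k * C (spow hy (-1)) * dp ((N - 2 - j : ℕ) : ℤ) := by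
    rw [pow_succ, mul_assoc, mul_assoc, dp_mul_dp, mul_assoc]
    congr 3
    omega
  have hkN : (k + 1) * (N - 1) = k * (N - 1) + (N - 1) := by ring
  have hkN' : k * (N - 1) ≤ k * N := Nat.mul_le_mul_left _ (by omega)
  refine ⟨F', fun l hl hl' => ?_, fun n hn hn' => ?_, ?_⟩
  · rcases Nat.lt_or_ge l (k * N) with h | h
    · exact h3 l (hF0 l h hl')
    · rcases eq_or_lt_of_le h with h' | h'
      · exact absurd ⟨k, by rw [← h']; ring⟩ hl'
      · exact h4 l h' (by omega)
  · rw [mul_assoc, e1, h2.1, Finset.mul_sum, coeff_sum]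
    -- Among the terms `∂^{i-n} γ_i s^{i-d}`, only `i = n - 1` has a residue.
    rw [Finset.sum_eq_single (n - 1)]
    · rw [← mul_assoc, dp_mul_dp, coeff_neg_one_dp_mul_C, if_pos (by omega)]
      congr 2
      push_cast [Nat.cast_sub hn, Nat.cast_sub (show j ≤ N - 2 by omega),
        Nat.cast_sub (show 2 ≤ N by omega)]
      ring
    · intro i _ hi
      rw [← mul_assoc, dp_mul_dp, coeff_neg_one_dp_mul_C, if_neg (by omega)]
    · intro h
      simp only [Finset.mem_range, not_lt] at h
      omega
  · rw [e1, h2.1, coeff_sum]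
    exact Finset.sum_eq_zero fun i _ => by
      rw [coeff_neg_one_dp_mul_C, if_neg (by omega)]

end RightForm
end

/-! ### Newton sums near the diagonal. -/

noncomputable section

open scoped Differential
open TopologicalSpace

/-- If the binomial convolutions of the derivatives of `f_n` along `N ℕ` vanish at `y`, then the
Newton sums `∑ γ_{n-1} f_n (x-y)^{n-Q}` tend to zero at `y`. -/
theorem tendsto_newton_sum {I : Set ℝ} (hI : IsOpen I) {y : ℝ} (hy : y ∈ I) {f : ℕ → ℝ → ℂ}
    (hf : ∀ n, ContDiffOn ℝ ∞ (f n) I) {N : ℕ}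
    (h : ∀ i m : ℕ, ∑ q ∈ Finset.range (i + 1),
      (i.choose q : ℂ) * iteratedDeriv q (f (N * m + 1 + (i - q))) y = 0)
    {Q : ℕ} {F : ℕ → ℂ} (hF : ∀ l < Q, ¬ N ∣ l → F l = 0) :
    Filter.Tendsto (fun x : ℝ => ∑ n ∈ Finset.Icc 1 Q,
      f n x * (newtonCoeff F (n - 1) * ((x : ℂ) - y) ^ ((n : ℤ) - Q)))
      (nhdsWithin y {y}ᶜ) (nhds 0) := by
  -- With `n - 1 = l + p`, expanding the Newton coefficients and summing over `l` outside leaves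
  -- divided-power sums in `p` of length `Q - l`. Each is divided by `(x-y)^{Q-l-1}`, exactly the
  -- order to which it is flat when `N ∣ l`; for the other `l` the factor `F l` vanishes.
  have key : ∀ l < Q, Filter.Tendsto (fun x : ℝ => (-1) ^ l * F l / (l.factorial : ℂ) *
      (((x : ℂ) - y) ^ (-((Q - l - 1 : ℕ) : ℤ)) * ∑ p ∈ Finset.range (Q - l - 1 + 1),
        f (l + 1 + p) x * (((x - y : ℝ) : ℂ) ^ p / (p.factorial : ℂ))))
      (nhdsWithin y {y}ᶜ) (nhds 0) := by
    intro l hl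
    by_cases hd : N ∣ l
    · obtain ⟨m, rfl⟩ := hd
      have h1 := isLittleO_sum_pow_div hI hy (f := fun p => f (N * m + 1 + p)) (fun p => hf _)
        (Q - N * m - 1) (fun i _ => h i m)
      have h2 := (h1.mono nhdsWithin_le_nhds (l := nhdsWithin y {y}ᶜ)).norm_left
      rw [← mul_zero ((-1) ^ (N * m) * F (N * m) / ((N * m).factorial : ℂ))]
      refine Filter.Tendsto.const_mul _ ?_
      rw [tendsto_zero_iff_norm_tendsto_zero]
      have h3 := h2.tendsto_div_nhds_zero
      rw [tendsto_zero_iff_norm_tendsto_zero] at h3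
      refine h3.congr fun x => ?_
      rw [norm_mul, norm_div, norm_norm, zpow_neg, norm_inv, zpow_natCast, norm_pow, norm_pow,
        ← Complex.ofReal_sub, Complex.norm_real, div_eq_inv_mul]
    · simp [hF l hl hd]
  have hsum := tendsto_finsetSum (Finset.range Q) fun l hl => key l (Finset.mem_range.mp hl)
  rw [Finset.sum_const_zero] at hsum
  refine hsum.congr' ?_
  filter_upwards [self_mem_nhdsWithin] with x hx
  have hs : (x : ℂ) - y ≠ 0 := sub_ne_zero.mpr (by exact_mod_cast hx)
  have e1 : ∑ n ∈ Finset.Icc 1 Q, f n x * (newtonCoeff F (n - 1) * ((x : ℂ) - y) ^ ((n : ℤ) - Q))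
      = ∑ i ∈ Finset.range Q, ∑ l ∈ Finset.range (i + 1), f (i + 1) x *
        ((-1) ^ l * F l / (l.factorial * (i - l).factorial) * ((x : ℂ) - y) ^ ((i : ℤ) + 1 - Q)) := by
    rw [← Finset.Ico_add_one_right_eq_Icc, Finset.sum_Ico_eq_sum_range, Nat.add_sub_cancel]
    refine Finset.sum_congr rfl fun i _ => ?_
    rw [Nat.add_sub_cancel_left, newtonCoeff, Finset.sum_mul, Finset.mul_sum, add_comm 1 i]
    push_cast
    rfl
  -- Interchange of summation over the triangle `l ≤ i < Q`.
  rw [e1, Finset.sum_comm' (t' := Finset.range Q) (s' := fun l => Finset.Ico l Q)]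
  · refine Finset.sum_congr rfl fun l hl => ?_
    have hl' := Finset.mem_range.mp hl
    rw [Finset.sum_Ico_eq_sum_range, Finset.mul_sum, Finset.mul_sum]
    refine Finset.sum_congr (by congr 1; omega) fun p hp => ?_
    have e2 : l + p - l = p := by omega
    have e3 : ((l + p : ℕ) : ℤ) + 1 - Q = -((Q - l - 1 : ℕ) : ℤ) + p := by omega
    rw [e2, e3, zpow_add₀ hs, zpow_natCast, Complex.ofReal_sub,
      show l + p + 1 = l + 1 + p by ring]
    field_simp
  · intro i l
    simp only [Finset.mem_range, Finset.mem_Ico]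
    omega
end

noncomputable section

open MeasureTheory Filter

/-! ### The Airy-type functions -/

section Airy

variable {N : ℕ} {κ : ℝ}

theorem IsHeatSign.sq_eq_one (hκ : IsHeatSign N κ) : κ * κ = 1 := by
  rcases Nat.even_or_odd N with h | h
  · rw [hκ.1 h, ← pow_add, ← two_mul, pow_mul]; simp
  · rcases hκ.2 h with h | h <;> simp [h]

/-- The point `c + i s` of the line of integration. -/
def airyPt (N : ℕ) (κ : ℝ) (s : ℝ) : ℂ := (airyLine N κ : ℂ) + Complex.I * s

theorem continuous_airyPt : Continuous (airyPt N κ) := by unfold airyPt; fun_prop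

theorem norm_airyPt_le (s : ℝ) : ‖airyPt N κ s‖ ≤ |airyLine N κ| + |s| := by
  refine (norm_add_le _ _).trans ?_
  simp

theorem hasDerivAt_airyPt (s : ℝ) : HasDerivAt (airyPt N κ) Complex.I s := by
  have := ((hasDerivAt_id s).ofReal_comp.const_mul Complex.I).const_add (airyLine N κ : ℂ)
  rw [Complex.ofReal_one, mul_one] at this
  exact this

/-- For even `N` the sign of `κ` gives `κ (is)^N = -s^N`. For odd `N` the term `κ (is)^N` is
imaginary, and the next one has real part `κ N (-1)^{(N-1)/2} c s^{N-1} = -N s^{N-1}`: the abscissa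
`c` is chosen to make this negative. -/
theorem re_airyPt_pow_le (hN : 2 ≤ N) (hκ : IsHeatSign N κ) :
    ∀ᶠ s in cocompact ℝ, ((κ : ℂ) * airyPt N κ s ^ N).re ≤ -s ^ 2 := by
  rcases Nat.even_or_odd N with h | h
  · have h1 : ∀ᶠ s : ℝ in cocompact ℝ, 1 ≤ |s| := by
      have := tendsto_norm_cocompact_atTop (E := ℝ)
      exact this.eventually_ge_atTop 1
    filter_upwards [h1] with s hs
    obtain ⟨n, hn⟩ := h
    have e : (κ : ℂ) * airyPt N κ s ^ N = ((-(s ^ N) : ℝ) : ℂ) := by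
      have h2 : N / 2 = n := by omega
      have hI : (Complex.I) ^ N = (-1) ^ n := by
        rw [hn, ← two_mul, pow_mul, Complex.I_sq]
      rw [airyPt, airyLine, if_pos ⟨n, hn⟩, hκ.1 ⟨n, hn⟩, h2, Complex.ofReal_zero, zero_add, mul_pow, hI]
      push_cast
      rw [pow_succ, ← mul_assoc]
      have : ((-1 : ℂ) ^ n) * (-1) ^ n = 1 := by rw [← mul_pow]; simp
      linear_combination (-(s : ℂ) ^ N) * this
    rw [e, Complex.ofReal_re, neg_le_neg_iff, ← sq_abs, ← Even.pow_abs ⟨n, hn⟩]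
    exact pow_le_pow_right₀ hs hN
  · obtain ⟨n, hn⟩ := h
    have hodd : Odd N := ⟨n, hn⟩
    have hκκ := hκ.sq_eq_one
    set c := airyLine N κ with hc
    have hcv : c = -κ * (-1) ^ n := by
      rw [hc, airyLine, if_neg (Nat.not_even_iff_odd.mpr hodd)]
      congr 2
      omega
    -- asymptotics of `κ (c + i s)^N / s^(N-1)` from the derivative of `ε ↦ (i + c ε)^N` at zero
    set f : ℝ → ℝ := fun ε => ((κ : ℂ) * ((c : ℂ) * ε + Complex.I) ^ N).re with hf
    have hIN : Complex.I ^ (N - 1) = (-1) ^ n := by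
      rw [show N - 1 = 2 * n by omega, pow_mul, Complex.I_sq]
    have hI2 : (-1 : ℝ) ^ n * (-1) ^ n = 1 := by rw [← mul_pow]; simp
    have hder : HasDerivAt f (-N) 0 := by
      have h1 : HasDerivAt (fun ε : ℝ => (c : ℂ) * ε + Complex.I) c 0 := by
        have := ((hasDerivAt_id (0 : ℝ)).ofReal_comp.const_mul (c : ℂ)).add_const Complex.I
        simpa using this
      have h2 := Complex.reCLM.hasFDerivAt.comp_hasDerivAt _ ((h1.pow N).const_mul (κ : ℂ))
      have h3 : (κ : ℂ) * (N * ((c : ℂ) * ((0 : ℝ) : ℂ) + Complex.I) ^ (N - 1) * c)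
          = ((κ * N * (-1) ^ n * c : ℝ) : ℂ) := by
        rw [Complex.ofReal_zero, mul_zero, zero_add, hIN]; push_cast; ring
      have h4 : κ * N * (-1) ^ n * c = -N := by
        rw [hcv]
        linear_combination -N * (κ * κ) * hI2 - N * hκκ
      rw [Complex.reCLM_apply, h3, Complex.ofReal_re, h4] at h2
      exact h2
    have hf0 : f 0 = 0 := by
      have : Complex.I ^ N = (-1) ^ n * Complex.I := by
        rw [← hIN, ← pow_succ]; congr 1; omega
      rw [hf]
      simp only [Complex.ofReal_zero, mul_zero, zero_add, this]
      have : ((κ : ℂ) * ((-1) ^ n * Complex.I)) = ((κ * (-1) ^ n : ℝ) : ℂ) * Complex.I := by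
        push_cast; ring
      rw [this, Complex.re_ofReal_mul, Complex.I_re, mul_zero]
    have hlim := hder.tendsto_slope_zero
    have hN3 : (3 : ℝ) ≤ N := by exact_mod_cast (show 3 ≤ N by omega)
    have hev : ∀ᶠ ε in nhdsWithin (0 : ℝ) {0}ᶜ, ε⁻¹ * f ε < -1 := by
      have := hlim.eventually_lt_const (show (-(N : ℝ)) < -1 by linarith)
      filter_upwards [this] with ε hε
      simpa [hf0] using hε
    have hinv := (tendsto_inv₀_cobounded' (α := ℝ)).eventually hev
    have h1 : ∀ᶠ s : ℝ in cocompact ℝ, 1 ≤ |s| :=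
      (tendsto_norm_cocompact_atTop (E := ℝ)).eventually_ge_atTop 1
    rw [Metric.cobounded_eq_cocompact] at hinv
    filter_upwards [hinv, h1] with s hs hs1
    have hs0 : s ≠ 0 := by rintro rfl; norm_num at hs1
    have e : ((κ : ℂ) * airyPt N κ s ^ N).re = s ^ (N - 1) * (s * f s⁻¹) := by
      have hs0' : (s : ℂ) ≠ 0 := by exact_mod_cast hs0
      have : (κ : ℂ) * airyPt N κ s ^ N = ((s ^ N : ℝ) : ℂ) *
          ((κ : ℂ) * ((c : ℂ) * ((s⁻¹ : ℝ) : ℂ) + Complex.I) ^ N) := by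
        have h3 : airyPt N κ s = s * ((c : ℂ) * ((s⁻¹ : ℝ) : ℂ) + Complex.I) := by
          rw [airyPt, ← hc]; push_cast; field_simp
        rw [h3, mul_pow]; push_cast; ring
      rw [this, Complex.re_ofReal_mul, ← mul_assoc, ← pow_succ]
      congr 2
      omega
    rw [inv_inv] at hs
    have h4 : s ^ 2 ≤ s ^ (N - 1) := by
      have he : Even (N - 1) := ⟨n, by omega⟩
      rw [← sq_abs, ← he.pow_abs]
      exact pow_le_pow_right₀ hs1 (by omega)
    rw [e]
    nlinarith [sq_nonneg s]

/-- A majorant uniform in `‖z‖ ≤ R` and with polynomial weight, as needed for differentiating under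
the integral to every order. -/
theorem integrable_airy_bound (hN : 2 ≤ N) (hκ : IsHeatSign N κ) (j : ℕ) (R : ℝ) (hR : 0 ≤ R) :
    Integrable fun s : ℝ => ‖airyPt N κ s‖ ^ j * Real.exp (R * ‖airyPt N κ s‖) *
      ‖Complex.exp ((κ : ℂ) * airyPt N κ s ^ N)‖ := by
  have hc := continuous_airyPt (N := N) (κ := κ)
  have hcont : Continuous fun s : ℝ => ‖airyPt N κ s‖ ^ j * Real.exp (R * ‖airyPt N κ s‖) *
      ‖Complex.exp ((κ : ℂ) * airyPt N κ s ^ N)‖ := by fun_prop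
  refine hcont.locallyIntegrable.integrable_of_isBigO_cocompact (g := fun s => Real.exp (-(1 / 2) * s ^ 2))
    ?_ ((integrable_exp_neg_mul_sq (by norm_num)).integrableAtFilter _)
  set c := |airyLine N κ|
  -- The constant comes from `(R+1)|s| ≤ (R+1)²/2 + s²/2`, which leaves half of the Gaussian decay.
  refine Asymptotics.IsBigO.of_bound
    (j.factorial * Real.exp ((R + 1) * c + (R + 1) ^ 2 / 2)) ?_
  filter_upwards [re_airyPt_pow_le hN hκ] with s hs
  have h0 : ‖airyPt N κ s‖ ≤ c + |s| := norm_airyPt_le s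
  have hn := norm_nonneg (airyPt N κ s)
  have h1 : ‖airyPt N κ s‖ ^ j ≤ j.factorial * Real.exp (c + |s|) := by
    have := Real.pow_div_factorial_le_exp (x := ‖airyPt N κ s‖) hn j
    rw [div_le_iff₀ (by positivity)] at this
    calc _ ≤ Real.exp ‖airyPt N κ s‖ * j.factorial := this
      _ ≤ Real.exp (c + |s|) * j.factorial := by gcongr
      _ = _ := by ring
  have h2 : Real.exp (R * ‖airyPt N κ s‖) ≤ Real.exp (R * (c + |s|)) := by gcongr
  have h3 : ‖Complex.exp ((κ : ℂ) * airyPt N κ s ^ N)‖ ≤ Real.exp (-s ^ 2) := by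
    rw [Complex.norm_exp]; gcongr
  rw [Real.norm_of_nonneg (by positivity), Real.norm_of_nonneg (by positivity)]
  calc _ ≤ (j.factorial * Real.exp (c + |s|)) * Real.exp (R * (c + |s|)) * Real.exp (-s ^ 2) := by
        gcongr
    _ = j.factorial * Real.exp ((c + |s|) + R * (c + |s|) + -s ^ 2) := by
        rw [Real.exp_add _ (-s ^ 2), Real.exp_add (c + |s|)]; ring
    _ ≤ j.factorial * Real.exp ((R + 1) * c + (R + 1) ^ 2 / 2 + -(1 / 2) * s ^ 2) := by
        refine mul_le_mul_of_nonneg_left (Real.exp_le_exp.mpr ?_) (by positivity)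
        nlinarith [sq_nonneg (|s| - (R + 1)), sq_abs s]
    _ = _ := by rw [Real.exp_add _ (-(1 / 2) * s ^ 2)]; ring

/-- The integrand of the `j`-th derivative of the Airy-type function. -/
def airyIntegrand (N : ℕ) (κ : ℝ) (j : ℕ) (z : ℂ) (s : ℝ) : ℂ :=
  airyPt N κ s ^ j * Complex.exp (z * airyPt N κ s + (κ : ℂ) * airyPt N κ s ^ N)

theorem continuous_airyIntegrand (j : ℕ) (z : ℂ) : Continuous (airyIntegrand N κ j z) := by
  have hc := continuous_airyPt (N := N) (κ := κ)
  unfold airyIntegrand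
  fun_prop

theorem norm_airyIntegrand_le (j : ℕ) {z : ℂ} {R : ℝ} (hz : ‖z‖ ≤ R) (s : ℝ) :
    ‖airyIntegrand N κ j z s‖ ≤ ‖airyPt N κ s‖ ^ j * Real.exp (R * ‖airyPt N κ s‖) *
      ‖Complex.exp ((κ : ℂ) * airyPt N κ s ^ N)‖ := by
  rw [airyIntegrand, Complex.exp_add, norm_mul, norm_mul, norm_pow, ← mul_assoc]
  gcongr
  refine (Complex.norm_exp_le_exp_norm _).trans ?_
  rw [norm_mul]
  gcongr

theorem integrable_airyIntegrand (hN : 2 ≤ N) (hκ : IsHeatSign N κ) (j : ℕ) (z : ℂ) :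
    Integrable (airyIntegrand N κ j z) :=
  (integrable_airy_bound hN hκ j ‖z‖ (norm_nonneg z)).mono'
    (continuous_airyIntegrand j z).aestronglyMeasurable
    (Eventually.of_forall fun s => norm_airyIntegrand_le j le_rfl s)

/-- The `j`-th derivative of the Airy-type function, on the complex plane. -/
def airyC (N : ℕ) (κ : ℝ) (j : ℕ) (z : ℂ) : ℂ :=
  (2 * (Real.pi : ℂ))⁻¹ * ∫ s : ℝ, airyIntegrand N κ j z s

theorem hasDerivAt_airyC (hN : 2 ≤ N) (hκ : IsHeatSign N κ) (j : ℕ) (z : ℂ) :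
    HasDerivAt (airyC N κ j) (airyC N κ (j + 1) z) z := by
  refine HasDerivAt.const_mul _ ?_
  refine (hasDerivAt_integral_of_dominated_loc_of_deriv_le (F' := airyIntegrand N κ (j + 1))
    (bound := fun s => ‖airyPt N κ s‖ ^ (j + 1) * Real.exp ((‖z‖ + 1) * ‖airyPt N κ s‖) *
      ‖Complex.exp ((κ : ℂ) * airyPt N κ s ^ N)‖)
    (Metric.ball_mem_nhds z one_pos)
    (Eventually.of_forall fun w => (continuous_airyIntegrand j w).aestronglyMeasurable)
    (integrable_airyIntegrand hN hκ j z) (continuous_airyIntegrand (j + 1) z).aestronglyMeasurable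
    (Eventually.of_forall fun s w hw => norm_airyIntegrand_le (j + 1) ?_ s)
    (integrable_airy_bound hN hκ (j + 1) _ (by positivity))
    (Eventually.of_forall fun s w _ => ?_)).2
  · have h1 := norm_le_norm_add_norm_sub' w z
    have h2 : ‖w - z‖ < 1 := by simpa [dist_eq_norm] using hw
    linarith
  · have h1 : HasDerivAt (fun w : ℂ => w * airyPt N κ s + (κ : ℂ) * airyPt N κ s ^ N)
        (airyPt N κ s) w := by
      simpa using ((hasDerivAt_id w).mul_const (airyPt N κ s)).add_const
        ((κ : ℂ) * airyPt N κ s ^ N)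
    have h2 := (h1.cexp).const_mul (airyPt N κ s ^ j)
    refine h2.congr_deriv ?_
    rw [airyIntegrand, pow_succ]
    ring

theorem airyN_eq (z : ℝ) : airyN N κ z = airyC N κ 0 z := by
  simp [airyN, airyC, airyIntegrand, airyPt]

theorem iteratedDeriv_airyN (hN : 2 ≤ N) (hκ : IsHeatSign N κ) (j : ℕ) :
    iteratedDeriv j (airyN N κ) = fun z : ℝ => airyC N κ j z := by
  induction j with
  | zero => funext z; rw [iteratedDeriv_zero, airyN_eq]
  | succ j ih =>
    rw [iteratedDeriv_succ, ih]
    funext z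
    exact ((hasDerivAt_airyC hN hκ j z).comp_ofReal).deriv

theorem hasDerivAt_iteratedDeriv_airyN (hN : 2 ≤ N) (hκ : IsHeatSign N κ) (j : ℕ) (z : ℝ) :
    HasDerivAt (iteratedDeriv j (airyN N κ)) (iteratedDeriv (j + 1) (airyN N κ) z) z := by
  rw [iteratedDeriv_airyN hN hκ, iteratedDeriv_airyN hN hκ]
  exact (hasDerivAt_airyC hN hκ j z).comp_ofReal

/-- The integral of the derivative of `e^{zξ + κ ξ^N}` along the line vanishes. -/
theorem airyC_ode (hN : 2 ≤ N) (hκ : IsHeatSign N κ) (z : ℂ) :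
    z * airyC N κ 0 z + κ * N * airyC N κ (N - 1) z = 0 := by
  have hd : ∀ s : ℝ, HasDerivAt (airyIntegrand N κ 0 z)
      (Complex.I * (z * airyIntegrand N κ 0 z s + κ * N * airyIntegrand N κ (N - 1) z s)) s := by
    intro s
    have h0 := hasDerivAt_airyPt (N := N) (κ := κ) s
    have h1 := ((h0.const_mul z).add ((h0.pow N).const_mul (κ : ℂ))).cexp
    have h2 : airyIntegrand N κ 0 z
        = fun s => Complex.exp (z * airyPt N κ s + (κ : ℂ) * airyPt N κ s ^ N) := by
      funext s; simp [airyIntegrand]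
    rw [h2]
    refine h1.congr_deriv ?_
    simp only [airyIntegrand, Pi.add_apply, Pi.pow_apply]
    ring
  have hi0 := integrable_airyIntegrand hN hκ 0 z
  have hi1 := integrable_airyIntegrand hN hκ (N - 1) z
  have := integral_eq_zero_of_hasDerivAt_of_integrable hd
    (((hi0.const_mul z).add (hi1.const_mul (κ * N : ℂ))).const_mul Complex.I) hi0
  rw [integral_const_mul, integral_add (hi0.const_mul z) (hi1.const_mul _), integral_const_mul,
    integral_const_mul] at this
  have h3 := (mul_eq_zero.mp this).resolve_left Complex.I_ne_zero
  rw [airyC, airyC]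
  linear_combination (2 * (Real.pi : ℂ))⁻¹ * h3

theorem airyN_ode (hN : 2 ≤ N) (hκ : IsHeatSign N κ) (j : ℕ) (z : ℝ) :
    z * iteratedDeriv j (airyN N κ) z + j * iteratedDeriv (j - 1) (airyN N κ) z
      + κ * N * iteratedDeriv (j + (N - 1)) (airyN N κ) z = 0 := by
  induction j generalizing z with
  | zero =>
    rw [iteratedDeriv_airyN hN hκ, iteratedDeriv_airyN hN hκ, zero_add]
    simpa using airyC_ode hN hκ z
  | succ j ih =>
    have hz : HasDerivAt (fun z : ℝ => (z : ℂ)) 1 z := Complex.ofRealCLM.hasDerivAt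
    have hd := hasDerivAt_iteratedDeriv_airyN hN hκ
    have h1 := ((hz.mul (hd j z)).add
      ((hd (j - 1) z).const_mul (j : ℂ))).add ((hd (j + (N - 1)) z).const_mul (κ * N : ℂ))
    have h2 : HasDerivAt (fun _ : ℝ => (0 : ℂ)) 0 z := hasDerivAt_const z 0
    have h3 := h1.unique (h2.congr_of_eventuallyEq (Eventually.of_forall fun z => ih z))
    have e : (j : ℂ) * iteratedDeriv (j - 1 + 1) (airyN N κ) z
        = j * iteratedDeriv j (airyN N κ) z := by
      cases j <;> simp
    rw [e] at h3
    rw [Nat.add_sub_cancel, show j + 1 + (N - 1) = j + (N - 1) + 1 by omega]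
    push_cast
    linear_combination h3

/-- By the identity theorem, local vanishing would be global. On the real line the function is, up
to scaling and a nonzero exponential factor, the Fourier transform of `s ↦ e^{κ (c+is)^N}`; Fourier
inversion would make this exponential zero. -/
theorem airyN_not_eventually_zero (hN : 2 ≤ N) (hκ : IsHeatSign N κ) (z₀ : ℝ) :
    ¬ ∀ᶠ z in nhds z₀, airyN N κ z = 0 := by
  intro h
  have han : AnalyticOnNhd ℂ (airyC N κ 0) Set.univ :=
    (Complex.analyticOnNhd_univ_iff_differentiable).mpr fun z =>
      (hasDerivAt_airyC hN hκ 0 z).differentiableAt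
  have hfreq : ∃ᶠ z in nhdsWithin (z₀ : ℂ) {(z₀ : ℂ)}ᶜ, airyC N κ 0 z = 0 := by
    have ht : Tendsto (fun z : ℝ => (z : ℂ)) (nhdsWithin z₀ {z₀}ᶜ)
        (nhdsWithin (z₀ : ℂ) {(z₀ : ℂ)}ᶜ) :=
      tendsto_nhdsWithin_of_tendsto_nhds_of_eventually_within _
        (Complex.continuous_ofReal.continuousAt.tendsto.mono_left nhdsWithin_le_nhds)
        (by filter_upwards [self_mem_nhdsWithin] with z hz; simpa using hz)
    refine ht.frequently (Eventually.frequently ?_)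
    filter_upwards [h.filter_mono nhdsWithin_le_nhds] with z hz
    rw [← airyN_eq, hz]
  have hzero := han.eqOn_zero_of_preconnected_of_frequently_eq_zero isPreconnected_univ
    (Set.mem_univ _) hfreq
  set g : ℝ → ℂ := fun s => Complex.exp ((κ : ℂ) * airyPt N κ s ^ N) with hg
  have hgint : Integrable g := by
    have := integrable_airyIntegrand hN hκ 0 0
    refine this.congr (Eventually.of_forall fun s => ?_)
    simp [airyIntegrand, hg]
  have hgcont : Continuous g := by
    have := continuous_airyPt (N := N) (κ := κ)
    fun_prop
  have hF : FourierTransform.fourier g = 0 := by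
    funext v
    rw [Real.fourier_eq', Pi.zero_apply]
    have h1 : airyC N κ 0 ((-2 * Real.pi * v : ℝ) : ℂ) = 0 := hzero (Set.mem_univ _)
    rw [airyC] at h1
    have hpi : (2 * (Real.pi : ℂ))⁻¹ ≠ 0 := by simp [Real.pi_ne_zero]
    have h2 := (mul_eq_zero.mp h1).resolve_left hpi
    have h3 : ∀ s, airyIntegrand N κ 0 ((-2 * Real.pi * v : ℝ) : ℂ) s =
        Complex.exp ((-2 * Real.pi * v : ℝ) * airyLine N κ) *
          (Complex.exp (((-2 * Real.pi * inner ℝ s v : ℝ) : ℂ) * Complex.I) • g s) := by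
      intro s
      rw [airyIntegrand, hg, smul_eq_mul, ← mul_assoc, ← Complex.exp_add, pow_zero, one_mul,
        ← Complex.exp_add, airyPt]
      congr 1
      simp only [RCLike.inner_apply, conj_trivial]
      push_cast
      ring
    simp only [h3] at h2
    rw [integral_const_mul] at h2
    exact (mul_eq_zero.mp h2).resolve_left (Complex.exp_ne_zero _)
  have hinv := hgcont.fourierInv_fourier_eq hgint (by rw [hF]; exact integrable_zero _ _ _)
  have h0 : g 0 = 0 := by
    rw [← hinv, hF]
    simp [Real.fourierInv_eq']
  exact Complex.exp_ne_zero _ h0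

end Airy
end

noncomputable section

open Filter Polynomial

/-! ### Linear independence of the functions `t^k E_j` -/

/-- Polynomials of pairwise distinct degrees are linearly independent. -/
theorem eq_zero_of_sum_smul_eq_zero_of_natDegree_injOn {ι : Type*} {s : Finset ι} {q : ι → ℂ[X]}
    (hq : ∀ i ∈ s, q i ≠ 0) (hinj : Set.InjOn (fun i => (q i).natDegree) s) {b : ι → ℂ}
    (h : ∑ i ∈ s, b i • q i = 0) : ∀ i ∈ s, b i = 0 := by
  by_contra! hne
  obtain ⟨i₀, hi₀, hb₀⟩ := hne
  obtain ⟨i, hi, hmax⟩ := Finset.exists_max_image (s.filter fun i => b i ≠ 0)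
    (fun i => (q i).natDegree) ⟨i₀, Finset.mem_filter.mpr ⟨hi₀, hb₀⟩⟩
  rw [Finset.mem_filter] at hi
  have hc := congrArg (fun p => coeff p (q i).natDegree) h
  simp only [finsetSum_coeff, coeff_smul, smul_eq_mul, coeff_zero] at hc
  rw [Finset.sum_eq_single_of_mem i hi.1] at hc
  · exact mul_ne_zero hi.2 (leadingCoeff_ne_zero.mpr (hq i hi.1)) hc
  · intro j hj hji
    by_cases hbj : b j = 0
    · rw [hbj, zero_mul]
    · have h1 := hmax j (Finset.mem_filter.mpr ⟨hj, hbj⟩)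
      have h2 : (q j).natDegree ≠ (q i).natDegree := fun e => hji (hinj hj hi.1 e)
      rw [coeff_eq_zero_of_natDegree_lt (lt_of_le_of_ne h1 h2), mul_zero]

/-! ### Polynomials in the derivative applied to a solution of the Airy equation. -/

section OperatorCalculus

variable {a : ℕ → ℝ → ℂ} {c : ℂ} {n : ℕ}

/-- `q(∂) a_0 = ∑ q_i a_i` for a chain of derivatives `a_i`. -/
def applyChain (a : ℕ → ℝ → ℂ) (z : ℝ) : ℂ[X] →ₗ[ℂ] ℂ :=
  (basisMonomials ℂ).constr ℂ fun i => a i z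

theorem applyChain_monomial (z : ℝ) (i : ℕ) (b : ℂ) :
    applyChain a z (monomial i b) = b * a i z := by
  have h1 : monomial i b = b • (basisMonomials ℂ i) := by
    rw [coe_basisMonomials, smul_monomial]; simp
  rw [h1, map_smul, applyChain, Module.Basis.constr_basis, smul_eq_mul]

theorem hasDerivAt_applyChain (hd : ∀ i z, HasDerivAt (a i) (a (i + 1) z) z) (q : ℂ[X]) (z : ℝ) :
    HasDerivAt (fun z => applyChain a z q) (applyChain a z (X * q)) z := by
  induction q using Polynomial.induction_on' with
  | add p q hp hq =>
    simp only [mul_add, map_add]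
    exact hp.add hq
  | monomial i b =>
    simp only [X_mul_monomial, applyChain_monomial]
    exact (hd i z).const_mul b

/-- The operator on polynomials corresponding to multiplication by `z` under the equation
`z a_0 + c a_n = 0`. -/
def mulVar (c : ℂ) (n : ℕ) : ℂ[X] →ₗ[ℂ] ℂ[X] :=
  -(LinearMap.mulLeft ℂ (C c * X ^ n)) - derivative

theorem mulVar_apply (q : ℂ[X]) : mulVar c n q = -(C c * X ^ n * q) - derivative q := rfl

theorem mul_applyChain
    (ho : ∀ i (z : ℝ), z * a i z + i * a (i - 1) z + c * a (i + n) z = 0) (q : ℂ[X]) (z : ℝ) :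
    z * applyChain a z q = applyChain a z (mulVar c n q) := by
  induction q using Polynomial.induction_on' with
  | add p q hp hq => rw [map_add, mul_add, hp, hq, map_add, map_add]
  | monomial i b =>
    rw [mulVar_apply, map_sub, map_neg, derivative_monomial, applyChain_monomial,
      applyChain_monomial]
    have : C c * X ^ n * monomial i b = monomial (i + n) (c * b) := by
      rw [mul_assoc, X_pow_mul_monomial, C_mul_monomial]
    rw [this, applyChain_monomial]
    linear_combination b * ho i z

theorem natDegree_mulVar (hc : c ≠ 0) {q : ℂ[X]} (hq : q ≠ 0) :
    (mulVar c n q).natDegree = q.natDegree + n ∧ mulVar c n q ≠ 0 := by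
  have hco : (mulVar c n q).coeff (q.natDegree + n) = -(c * q.leadingCoeff) := by
    rw [mulVar_apply, coeff_sub, coeff_neg, mul_assoc, coeff_C_mul, mul_comm (X ^ n),
      coeff_mul_X_pow, coeff_derivative,
      coeff_eq_zero_of_natDegree_lt (show q.natDegree < q.natDegree + n + 1 by omega)]
    simp
  have hne : (mulVar c n q).coeff (q.natDegree + n) ≠ 0 := by
    rw [hco]; exact neg_ne_zero.mpr (mul_ne_zero hc (leadingCoeff_ne_zero.mpr hq))
  refine ⟨natDegree_eq_of_le_of_coeff_ne_zero ?_ hne, fun h => hne (by rw [h, coeff_zero])⟩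
  rw [mulVar_apply]
  refine (natDegree_sub_le _ _).trans (max_le ?_ ?_)
  · rw [natDegree_neg, mul_assoc]
    refine (natDegree_C_mul_le _ _).trans (natDegree_mul_le.trans ?_)
    rw [natDegree_X_pow, add_comm]
  · exact (natDegree_derivative_le q).trans (by omega)

theorem natDegree_mulVar_pow (hc : c ≠ 0) (e j : ℕ) :
    (((mulVar c n) ^ e) (X ^ j)).natDegree = j + e * n ∧ ((mulVar c n) ^ e) (X ^ j) ≠ 0 := by
  induction e with
  | zero => simp
  | succ e ih =>
    rw [pow_succ', Module.End.mul_apply]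
    have := natDegree_mulVar (n := n) hc ih.2
    refine ⟨?_, this.2⟩
    rw [this.1, ih.1]; ring

theorem pow_mul_applyChain
    (ho : ∀ i (z : ℝ), z * a i z + i * a (i - 1) z + c * a (i + n) z = 0) (e j : ℕ) (z : ℝ) :
    (z : ℂ) ^ e * a j z = applyChain a z (((mulVar c n) ^ e) (X ^ j)) := by
  induction e with
  | zero => rw [pow_zero, pow_zero, Module.End.one_apply, ← monomial_one_right_eq_X_pow,
      applyChain_monomial]
  | succ e ih =>
    rw [pow_succ', pow_succ', Module.End.mul_apply, mul_assoc, ih, mul_applyChain ho]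

theorem applyChain_X_pow_mul_eq_zero (hd : ∀ i z, HasDerivAt (a i) (a (i + 1) z) z) {s : Set ℝ}
    (hs : IsOpen s) {q : ℂ[X]} (h : ∀ z ∈ s, applyChain a z q = 0) (m : ℕ) :
    ∀ z ∈ s, applyChain a z (X ^ m * q) = 0 := by
  induction m with
  | zero => simpa using h
  | succ m ih =>
    intro z hz
    have h1 := hasDerivAt_applyChain hd (X ^ m * q) z
    have h2 : (fun z => applyChain a z (X ^ m * q)) =ᶠ[nhds z] fun _ => 0 :=
      eventuallyEq_of_mem (hs.mem_nhds hz) ih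
    have h3 := h1.unique ((hasDerivAt_const z (0 : ℂ)).congr_of_eventuallyEq h2)
    rwa [pow_succ', mul_assoc]

/-- If `q(∂)` annihilates `a_0` on `s`, so does its commutator with `z`, which is `-q'(∂)`. In the
formula for `z q(∂) a_0` the remaining term is a derivative of `q(∂) a_0`. Induction on the degree
ends at a nonzero constant, excluded because `a_0` does not vanish identically. -/
theorem eq_zero_of_applyChain_eq_zero (hd : ∀ i z, HasDerivAt (a i) (a (i + 1) z) z)
    (ho : ∀ i (z : ℝ), z * a i z + i * a (i - 1) z + c * a (i + n) z = 0) {s : Set ℝ}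
    (hs : IsOpen s) (hne : ∃ z ∈ s, a 0 z ≠ 0) {q : ℂ[X]} (h : ∀ z ∈ s, applyChain a z q = 0) :
    q = 0 := by
  induction hdeg : q.natDegree generalizing q with
  | zero =>
    rw [natDegree_eq_zero] at hdeg
    obtain ⟨b, rfl⟩ := hdeg
    obtain ⟨z, hz, hz0⟩ := hne
    have := h z hz
    rw [← monomial_zero_left, applyChain_monomial] at this
    rw [(mul_eq_zero.mp this).resolve_right hz0, C_0]
  | succ d ih =>
    exfalso
    have hder : ∀ z ∈ s, applyChain a z (derivative q) = 0 := by
      intro z hz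
      have h1 := mul_applyChain ho q z
      rw [h z hz, mul_zero, mulVar_apply, map_sub, map_neg, mul_assoc, ← smul_eq_C_mul, map_smul,
        applyChain_X_pow_mul_eq_zero hd hs h n z hz] at h1
      simpa using h1.symm
    have hdd : (derivative q).natDegree = d := by
      rw [natDegree_derivative, hdeg, Nat.add_sub_cancel]
    have hd0 := ih hder hdd
    have := derivative_eq_zero.mp hd0
    omega

end OperatorCalculus

/-! ### The functions `E_j`: derivatives, recurrence, independence. -/

section Heat

variable {N : ℕ} {κ : ℝ}

theorem rpow_mul_div {t : ℝ} (ht : 0 < t) {p q r : ℝ} (h : p = q + r) :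
    ((t ^ p : ℝ) : ℂ) = ((t ^ q : ℝ) : ℂ) * ((t ^ r : ℝ) : ℂ) := by
  rw [h, Real.rpow_add ht]; push_cast; rfl

theorem hasDerivAt_airyHeat_left (hN : 2 ≤ N) (hκ : IsHeatSign N κ) (j : ℕ) (x y : ℝ) {t : ℝ}
    (ht : 0 < t) :
    HasDerivAt (fun x => airyHeat N κ j x y t) (airyHeat N κ (j + 1) x y t) x := by
  have h1 : HasDerivAt (fun x : ℝ => (x - y) / t ^ ((1 : ℝ) / N)) (1 / t ^ ((1 : ℝ) / N)) x :=
    ((hasDerivAt_id x).sub_const y).div_const _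
  have h2 := ((hasDerivAt_iteratedDeriv_airyN hN hκ j _).scomp x h1).const_mul
    ((t ^ (-((j : ℝ) + 1) / N) : ℝ) : ℂ)
  refine h2.congr_deriv ?_
  have hp : (-(((j + 1 : ℕ) : ℝ) + 1) / N) = -((j : ℝ) + 1) / N + -(1 / N) := by
    push_cast; ring
  rw [airyHeat, rpow_mul_div ht hp, Real.rpow_neg ht.le, Complex.real_smul]
  push_cast
  ring

/-- The differentiated Airy equation at `z = (x-y)/t^{1/N}`, with the powers of `t` collected. It
trades a factor `t` against `N - 1` derivatives. The truncated index `j - 1` is harmless at `j = 0`,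
where its coefficient is zero. -/
theorem airyHeat_recurrence (hN : 2 ≤ N) (hκ : IsHeatSign N κ) (j : ℕ) (x y : ℝ) {t : ℝ}
    (ht : 0 < t) : -(κ : ℂ) * N * (t * airyHeat N κ (j + (N - 1)) x y t) =
      ((x : ℂ) - y) * airyHeat N κ j x y t + j * airyHeat N κ (j - 1) x y t := by
  have hN0 : (N : ℝ) ≠ 0 := by positivity
  have ho := airyN_ode hN hκ j ((x - y) / t ^ ((1 : ℝ) / N))
  have hr : (t ^ ((1 : ℝ) / N)) ≠ 0 := (Real.rpow_pos_of_pos ht _).ne'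
  have h1 : ((t ^ (-((j : ℝ) + 1) / N) : ℝ) : ℂ)
      = ((t ^ (-(j : ℝ) / N) : ℝ) : ℂ) * ((t ^ ((1 : ℝ) / N) : ℝ) : ℂ)⁻¹ := by
    rw [rpow_mul_div ht (show -((j : ℝ) + 1) / N = -(j : ℝ) / N + -(1 / N) by ring),
      Real.rpow_neg ht.le]
    push_cast; rfl
  have h2 : (t : ℂ) * ((t ^ (-(((j + (N - 1) : ℕ) : ℝ) + 1) / N) : ℝ) : ℂ)
      = ((t ^ (-(j : ℝ) / N) : ℝ) : ℂ) := by
    have e : (-(((j + (N - 1) : ℕ) : ℝ) + 1) / N) = -1 + -(j : ℝ) / N := by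
      push_cast [Nat.cast_sub (show 1 ≤ N by omega)]; field_simp; ring
    rw [rpow_mul_div ht e, Real.rpow_neg_one]
    have : (t : ℂ) ≠ 0 := by exact_mod_cast ht.ne'
    push_cast; field_simp
  have h3 : (j : ℂ) * ((t ^ (-(((j - 1 : ℕ) : ℝ) + 1) / N) : ℝ) : ℂ)
      = j * ((t ^ (-(j : ℝ) / N) : ℝ) : ℂ) := by
    cases j with
    | zero => simp
    | succ j => push_cast; simp
  have hr' : ((t ^ ((1 : ℝ) / N) : ℝ) : ℂ) ≠ 0 := by exact_mod_cast hr
  simp only [airyHeat]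
  rw [h1, ← mul_assoc (t : ℂ), h2, ← mul_assoc (j : ℂ), h3]
  push_cast at ho
  linear_combination -((t ^ (-(j : ℝ) / N) : ℝ) : ℂ) * ho

/-- Homogeneity gives `-(Nt)⁻¹ ((x-y) E_{j+1} + (j+1) E_j)` for the time derivative; the recurrence
at index `j + 1` identifies it with `κ E_{j+N}`. -/
theorem hasDerivAt_airyHeat_time (hN : 2 ≤ N) (hκ : IsHeatSign N κ) (j : ℕ) (x y : ℝ) {t : ℝ}
    (ht : 0 < t) :
    HasDerivAt (fun t => airyHeat N κ j x y t) (κ * airyHeat N κ (j + N) x y t) t := by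
  have hN0 : (N : ℝ) ≠ 0 := by positivity
  have hN0' : (N : ℂ) ≠ 0 := by exact_mod_cast hN0
  have ht' : (t : ℂ) ≠ 0 := by exact_mod_cast ht.ne'
  have hκκ : (κ : ℂ) * κ = 1 := by exact_mod_cast hκ.sq_eq_one
  have h1 : HasDerivAt (fun t : ℝ => ((t ^ (-((j : ℝ) + 1) / N) : ℝ) : ℂ))
      (((-((j : ℝ) + 1) / N * t ^ (-((j : ℝ) + 1) / N - 1) : ℝ)) : ℂ) t :=
    (Real.hasDerivAt_rpow_const (Or.inl ht.ne')).ofReal_comp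
  have h2 : HasDerivAt (fun t : ℝ => (x - y) / t ^ ((1 : ℝ) / N))
      ((x - y) * (-(1 / N) * t ^ (-((1 : ℝ) / N) - 1))) t := by
    have := (Real.hasDerivAt_rpow_const (p := -((1 : ℝ) / N)) (Or.inl ht.ne')).const_mul (x - y)
    refine this.congr_of_eventuallyEq ?_
    filter_upwards [lt_mem_nhds ht] with τ hτ
    rw [Real.rpow_neg hτ.le, div_eq_mul_inv]
  have h3 := h1.mul ((hasDerivAt_iteratedDeriv_airyN hN hκ j _).scomp t h2)
  refine h3.congr_deriv ?_
  have hrec := airyHeat_recurrence hN hκ (j + 1) x y ht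
  rw [show j + 1 + (N - 1) = j + N by omega, Nat.add_sub_cancel] at hrec
  have hgoal : κ * airyHeat N κ (j + N) x y t =
      -((N : ℂ) * t)⁻¹ * (((x : ℂ) - y) * airyHeat N κ (j + 1) x y t
        + ((j + 1 : ℕ) : ℂ) * airyHeat N κ j x y t) := by
    rw [← hrec]; field_simp
  rw [hgoal]
  have e1 : ((t ^ (-((j : ℝ) + 1) / N - 1) : ℝ) : ℂ)
      = ((t ^ (-((j : ℝ) + 1) / N) : ℝ) : ℂ) * (t : ℂ)⁻¹ := by
    rw [rpow_mul_div ht (sub_eq_add_neg _ _), Real.rpow_neg_one]; push_cast; rfl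
  have e2 : ((t ^ (-((1 : ℝ) / N) - 1) : ℝ) : ℂ)
      = ((t ^ (-((1 : ℝ) / N)) : ℝ) : ℂ) * (t : ℂ)⁻¹ := by
    rw [rpow_mul_div ht (sub_eq_add_neg _ _), Real.rpow_neg_one]; push_cast; rfl
  have hp : (-(((j + 1 : ℕ) : ℝ) + 1) / N) = -((j : ℝ) + 1) / N + -(1 / N) := by
    push_cast; ring
  simp only [airyHeat, Complex.real_smul, Function.comp_apply]
  rw [rpow_mul_div ht hp]
  rw [Complex.ofReal_mul, e1, Complex.ofReal_mul (x - y), Complex.ofReal_mul, e2]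
  push_cast
  field_simp
  ring

/-- In the variable `z = (x-y)/t^{1/N}` a relation becomes one among the functions `z^e A^{(j)}`.
The Airy equation rewrites each as `q(∂) A` with `deg q = j + e (N-1)`, and these degrees are
pairwise distinct. -/
theorem linearIndependent_airyHeat (hN : 2 ≤ N) (hκ : IsHeatSign N κ) {x y : ℝ} (hxy : x ≠ y) :
    LinearIndependent ℂ fun (p : ℤ × Fin (N - 1)) (t : Set.Ioi (0 : ℝ)) =>
      ((t : ℝ) : ℂ) ^ p.1 * airyHeat N κ p.2 x y t := by
  have hN0 : (N : ℝ) ≠ 0 := by positivity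
  have hκκ : (κ : ℂ) * κ = 1 := by exact_mod_cast hκ.sq_eq_one
  have hσ : x - y ≠ 0 := sub_ne_zero.mpr hxy
  set σ := x - y with hσdef
  have hσ' : (σ : ℂ) ≠ 0 := by exact_mod_cast hσ
  set a : ℕ → ℝ → ℂ := fun j => iteratedDeriv j (airyN N κ) with ha
  have hc : (κ : ℂ) * N ≠ 0 := by
    refine mul_ne_zero (fun h => ?_) (by exact_mod_cast hN0)
    rw [h] at hκκ; simp at hκκ
  rw [linearIndependent_iff']
  intro s g hg
  -- A common power `z^B` makes all exponents `j + 1 - N k` nonnegative.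
  obtain ⟨B, hB⟩ : ∃ B : ℕ, ∀ p ∈ s, 0 ≤ (B : ℤ) + (p.2 : ℕ) + 1 - N * p.1 := by
    refine ⟨∑ p ∈ s, ((N : ℤ) * p.1).natAbs, fun p hp => ?_⟩
    have h1 : ((N : ℤ) * p.1).natAbs ≤ ∑ p ∈ s, ((N : ℤ) * p.1).natAbs :=
      Finset.single_le_sum (f := fun p : ℤ × Fin (N - 1) => ((N : ℤ) * p.1).natAbs)
        (fun _ _ => Nat.zero_le _) hp
    omega
  set e : ℤ × Fin (N - 1) → ℕ := fun p => ((B : ℤ) + (p.2 : ℕ) + 1 - N * p.1).toNat with he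
  have hez : ∀ p ∈ s, (e p : ℤ) = (B : ℤ) + (p.2 : ℕ) + 1 - N * p.1 := fun p hp =>
    Int.toNat_of_nonneg (hB p hp)
  have key : ∑ p ∈ s, (g p * (σ : ℂ)⁻¹ ^ e p) •
      (((mulVar (κ * N : ℂ) (N - 1)) ^ e p) (X ^ (p.2 : ℕ)) : ℂ[X]) = 0 := by
    refine eq_zero_of_applyChain_eq_zero (a := a) (c := (κ * N : ℂ)) (n := N - 1)
      (hasDerivAt_iteratedDeriv_airyN hN hκ) (fun i z => airyN_ode hN hκ i z)
      (s := {z | 0 < z / σ}) (isOpen_lt continuous_const (continuous_id.div_const σ)) ?_ ?_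
    · by_contra! hcon
      refine airyN_not_eventually_zero hN hκ σ ?_
      have hopen : IsOpen {z : ℝ | 0 < z / σ} :=
        isOpen_lt continuous_const (continuous_id.div_const σ)
      filter_upwards [hopen.mem_nhds (show (0 : ℝ) < σ / σ by rw [div_self hσ]; exact one_pos)]
        with z hz
      simpa [ha] using hcon z hz
    · intro z hz
      have hz' : 0 < z / σ := hz
      have hz0 : z ≠ 0 := by rintro rfl; simp at hz'
      have hρ : 0 < σ / z := by rw [← inv_div]; exact inv_pos.mpr hz'
      have hρ0 : (((σ / z : ℝ)) : ℂ) ≠ 0 := by exact_mod_cast hρ.ne'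
      -- The time with `t^{1/N} = σ/z`; positivity of `t^{1/N}` is why `z` ranges over the half-line
      -- on the side of `σ`.
      have ht : 0 < (σ / z) ^ N := pow_pos hρ N
      have hroot : ((σ / z) ^ N) ^ ((1 : ℝ) / N) = σ / z := by
        rw [← Real.rpow_natCast, ← Real.rpow_mul hρ.le, mul_one_div_cancel hN0, Real.rpow_one]
      have hg' := congrFun hg ⟨(σ / z) ^ N, ht⟩
      simp only [Finset.sum_apply, Pi.smul_apply, smul_eq_mul, Pi.zero_apply] at hg'
      rw [map_sum]
      have hmul := congrArg (fun w => (((σ / z : ℝ) : ℂ)) ^ (-(B : ℤ)) * w) hg'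
      simp only [mul_zero, Finset.mul_sum] at hmul
      rw [← hmul]
      refine Finset.sum_congr rfl fun p hp => ?_
      rw [map_smul, smul_eq_mul, ← pow_mul_applyChain (fun i z => airyN_ode hN hκ i z)]
      have hexp : (((σ / z) ^ N) ^ (-(((p.2 : ℕ) : ℝ) + 1) / N) : ℝ)
          = (σ / z) ^ (-(((p.2 : ℕ) : ℤ) + 1)) := by
        rw [← Real.rpow_natCast, ← Real.rpow_mul hρ.le, mul_div_cancel₀ _ hN0,
          ← Real.rpow_intCast]
        push_cast; rfl
      rw [airyHeat, hexp, hroot, ← hσdef, div_div_cancel₀ hσ]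
      have h5 : (σ : ℂ)⁻¹ ^ e p * (z : ℂ) ^ e p = ((σ / z : ℝ) : ℂ) ^ (-(e p : ℤ)) := by
        rw [← mul_pow, zpow_neg, zpow_natCast, ← inv_pow]
        congr 1
        push_cast
        rw [inv_div]; ring
      have h6 : ((σ / z : ℝ) : ℂ) ^ (-(e p : ℤ)) = ((σ / z : ℝ) : ℂ) ^ (-(B : ℤ)) *
          ((((σ / z) ^ N : ℝ) : ℂ) ^ p.1 * (((σ / z) ^ (-(((p.2 : ℕ) : ℤ) + 1)) : ℝ) : ℂ)) := by
        rw [hez p hp, Complex.ofReal_pow, ← zpow_natCast (((σ / z : ℝ)) : ℂ) N, ← zpow_mul,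
          Complex.ofReal_zpow, ← zpow_add₀ hρ0, ← zpow_add₀ hρ0]
        congr 1
        ring
      rw [mul_assoc, ← mul_assoc ((σ : ℂ)⁻¹ ^ e p), h5, h6]
      ring
  intro p hp
  have hfin := eq_zero_of_sum_smul_eq_zero_of_natDegree_injOn
    (fun p _ => (natDegree_mulVar_pow hc (e p) (p.2 : ℕ)).2) (fun p hp p' hp' h => ?_) key p hp
  · exact (mul_eq_zero.mp hfin).resolve_right (pow_ne_zero _ (inv_ne_zero hσ'))
  · simp only [(natDegree_mulVar_pow hc _ _).1] at h
    have hlt := p.2.2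
    have hlt' := p'.2.2
    -- The degree modulo `N - 1` recovers `j < N - 1`; the quotient then recovers `e` and hence `k`.
    have hj : (p.2 : ℕ) = p'.2 := by
      have := congrArg (· % (N - 1)) h
      simpa [Nat.add_mul_mod_self_right, Nat.mod_eq_of_lt hlt, Nat.mod_eq_of_lt hlt'] using this
    rw [hj] at h
    have hee : e p = e p' := Nat.eq_of_mul_eq_mul_right (by omega) (Nat.add_left_cancel h)
    have hk : (N : ℤ) * p.1 = N * p'.1 := by
      have h1 := hez p hp
      have h2 := hez p' hp'
      omega
    have hNz : (N : ℤ) ≠ 0 := by omega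
    exact Prod.ext (mul_left_cancel₀ hNz hk) (Fin.ext hj)

end Heat
end

noncomputable section

open scoped Differential
open TopologicalSpace SmoothFn Psi

/-! ### The operator corresponding to multiplication by time -/

namespace SmoothFn

variable {O : Opens ℝ}

theorem toFun_mul (f g : SmoothFn O) (x : ℝ) : (f * g).toFun x = f.toFun x * g.toFun x := by
  by_cases hx : x ∈ O
  · rw [toFun_eq_ev _ hx, toFun_eq_ev _ hx, toFun_eq_ev _ hx, map_mul]
  · simp [toFun, hx]

end SmoothFn

section TimeOp

variable {O : Opens ℝ} {y : ℝ} (hy : y ∉ O)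

/-- Multiplication by a constant. -/
def cst (c : ℂ) : Psi (SmoothFn O) := C (algebraMap ℂ (SmoothFn O) c)

theorem cst_mul_comm (c : ℂ) (P : Psi (SmoothFn O)) : cst c * P = P * cst c :=
  C_mul_comm_of_deriv_eq_zero (deriv_algebraMap c) P

theorem mul_cst_mul (c : ℂ) (P Q : Psi (SmoothFn O)) : P * (cst c * Q) = cst c * (P * Q) := by
  rw [← mul_assoc, ← cst_mul_comm, mul_assoc]

theorem cst_mul (c d : ℂ) : cst (O := O) c * cst d = cst (c * d) := by
  simp [cst, map_mul]

theorem cst_one : cst (O := O) 1 = 1 := by simp [cst]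

theorem ev_coeff_cst_mul (c : ℂ) (P : Psi (SmoothFn O)) (n : ℤ) (x : O) :
    ev x ((cst c * P).coeff n) = c * ev x (P.coeff n) := by
  rw [cst, coeff_C_mul, map_mul, ev_algebraMap]

theorem dp_mul_s (i : ℕ) : dp i * C (spow hy 1) =
    C (spow hy 1) * dp i + cst i * dp ((i : ℤ) - 1) := by
  induction i with
  | zero => simp [dp_zero, cst]
  | succ i ih =>
    have h1 : dp 1 * C (spow hy 1) = C (spow hy 1) * dp 1 + 1 := by
      rw [dp_one_mul_C, deriv_spow]
      simp [spow_zero]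
    have e : (dp ((i + 1 : ℕ) : ℤ) : Psi (SmoothFn O)) = dp 1 * dp i := by
      rw [dp_mul_dp]; congr 1; push_cast; ring
    have e2 : (dp (((i + 1 : ℕ) : ℤ) - 1) : Psi (SmoothFn O)) = dp i := by
      congr 1; push_cast; ring
    have e3 : dp 1 * (cst i * dp ((i : ℤ) - 1)) = cst (O := O) i * dp i := by
      rw [← mul_assoc, ← cst_mul_comm, mul_assoc, dp_mul_dp]; congr 2; ring
    have e4 : cst (O := O) ((i + 1 : ℕ) : ℂ) = cst i + 1 := by simp [cst]
    rw [e2, e4, e, mul_assoc, ih, mul_add, ← mul_assoc, h1, e3, add_mul, add_mul, one_mul,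
      mul_assoc]
    abel

variable {N : ℕ} {κ : ℝ}

theorem heatConst_ne_zero (hN : 2 ≤ N) (hκ : IsHeatSign N κ) : -(κ : ℂ) * N ≠ 0 := by
  have hκκ : (κ : ℂ) * κ = 1 := by exact_mod_cast hκ.sq_eq_one
  refine mul_ne_zero (neg_ne_zero.mpr fun h => ?_) (by norm_cast; omega)
  rw [h] at hκκ; simp at hκκ

/-- The operator by which multiplication by `t` acts on the right; its inverse is
`-κ N (x-y)⁻¹ ∂^{N-1}`. -/
def timeOp (hN : 2 ≤ N) (hκ : IsHeatSign N κ) : (Psi (SmoothFn O))ˣ where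
  val := cst (-(κ : ℂ) * N)⁻¹ * (dp (1 - (N : ℤ)) * C (spow hy 1))
  inv := cst (-(κ : ℂ) * N) * (C (spow hy (-1)) * dp ((N : ℤ) - 1))
  val_inv := by
    have h := heatConst_ne_zero hN hκ
    rw [mul_assoc, ← mul_assoc _ (cst (-(κ : ℂ) * N)), ← cst_mul_comm, mul_assoc, ← mul_assoc,
      cst_mul, inv_mul_cancel₀ h, cst_one, one_mul, mul_assoc, ← mul_assoc (C _), ← map_mul,
      spow_mul, add_neg_cancel, spow_zero, map_one, one_mul, dp_mul_dp]
    simp [dp_zero]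
  inv_val := by
    have h := heatConst_ne_zero hN hκ
    rw [mul_assoc, ← mul_assoc _ (cst (-(κ : ℂ) * N)⁻¹), ← cst_mul_comm, mul_assoc, ← mul_assoc,
      cst_mul, mul_inv_cancel₀ h, cst_one, one_mul, mul_assoc, ← mul_assoc (dp _), dp_mul_dp]
    simp [dp_zero, ← map_mul, spow_mul, spow_zero]

/-- The integral powers of the time operator. -/
def timePow (hN : 2 ≤ N) (hκ : IsHeatSign N κ) (k : ℤ) : Psi (SmoothFn O) :=
  ((timeOp hy hN hκ ^ k : (Psi (SmoothFn O))ˣ) : Psi (SmoothFn O))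

variable (hN : 2 ≤ N) (hκ : IsHeatSign N κ)

theorem timePow_zero : timePow hy hN hκ 0 = 1 := by simp [timePow]

theorem timePow_mul (k l : ℤ) :
    timePow hy hN hκ k * timePow hy hN hκ l = timePow hy hN hκ (k + l) := by
  rw [timePow, timePow, timePow, zpow_add, Units.val_mul]

theorem timePow_one : timePow hy hN hκ 1 =
    cst (-(κ : ℂ) * N)⁻¹ * (dp (1 - (N : ℤ)) * C (spow hy 1)) := by
  rw [timePow, zpow_one]; rfl

theorem timePow_neg_one : timePow hy hN hκ (-1) =
    cst (-(κ : ℂ) * N) * (C (spow hy (-1)) * dp ((N : ℤ) - 1)) := by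
  rw [timePow, zpow_neg, zpow_one]; rfl

theorem timePow_neg_nat (k : ℕ) : timePow hy hN hκ (-k) =
    cst ((-(κ : ℂ) * N) ^ k) * (C (spow hy (-1)) * dp ((N : ℤ) - 1)) ^ k := by
  induction k with
  | zero => simp [timePow_zero, cst_one]
  | succ k ih =>
    have e : (-((k + 1 : ℕ) : ℤ)) = -k + -1 := by push_cast; ring
    rw [e, ← timePow_mul, ih, timePow_neg_one, pow_succ _ k, pow_succ _ k,
      ← cst_mul ((-(κ : ℂ) * N) ^ k), mul_assoc, mul_assoc,
      ← mul_assoc _ (cst (-(κ : ℂ) * N)), ← cst_mul_comm, mul_assoc]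

/-- The operator counterpart of `airyHeat_recurrence`; the two identities together make the
correspondence of functions and operators consistent. -/
theorem dp_mul_timePow (i : ℕ) (k : ℤ) :
    cst (-(κ : ℂ) * N) * (dp ((i + (N - 1) : ℕ) : ℤ) * timePow hy hN hκ k) =
      C (spow hy 1) * (dp i * timePow hy hN hκ (k - 1))
        + cst i * (dp ((i : ℤ) - 1) * timePow hy hN hκ (k - 1)) := by
  have h1 : C (spow hy 1) * timePow hy hN hκ (-1) = cst (-(κ : ℂ) * N) * dp ((N : ℤ) - 1) := by
    rw [timePow_neg_one, ← mul_assoc, ← cst_mul_comm, mul_assoc, ← mul_assoc (C _), ← map_mul,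
      spow_mul]
    simp [spow_zero]
  have h2 : timePow hy hN hκ (k - 1) = timePow hy hN hκ (-1) * timePow hy hN hκ k := by
    rw [timePow_mul]; congr 1; ring
  have e : (dp ((i + (N - 1) : ℕ) : ℤ) : Psi (SmoothFn O)) = dp i * dp ((N : ℤ) - 1) := by
    rw [dp_mul_dp]; congr 1; omega
  rw [← mul_assoc, ← mul_assoc (C _), ← mul_assoc (cst (i : ℂ)), ← add_mul, ← dp_mul_s, h2,
    ← mul_assoc _ (timePow hy hN hκ (-1)), mul_assoc (dp _), h1, e, ← mul_assoc, ← mul_assoc,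
    cst_mul_comm _ (dp (i : ℤ))]

/-- The operator `κ ∂^N`, which acts on the right as the time derivative. -/
def timeDeriv (O : Opens ℝ) (N : ℕ) (κ : ℝ) : Psi (SmoothFn O) := cst (κ : ℂ) * dp N

/-- The canonical commutation relation of `∂_t` and `t`, in reversed order because both act from the
right. It comes from `[∂^N, s] = N ∂^{N-1}`. -/
theorem timeOp_mul_timeDeriv : timePow hy hN hκ 1 * timeDeriv O N κ =
    timeDeriv O N κ * timePow hy hN hκ 1 + 1 := by
  have hκκ : (κ : ℂ) * κ = 1 := by exact_mod_cast hκ.sq_eq_one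
  have hne := heatConst_ne_zero hN hκ
  have hN0 : (N : ℂ) ≠ 0 := by norm_cast; omega
  have hκ0 : (κ : ℂ) ≠ 0 := fun h => by rw [h] at hκκ; simp at hκκ
  have h1 : C (spow hy 1) * dp (N : ℤ) = dp N * C (spow hy 1) - cst N * dp ((N : ℤ) - 1) := by
    rw [dp_mul_s]; abel
  have h2 : dp (1 - (N : ℤ)) * C (spow hy 1) * dp (N : ℤ) =
      dp N * (dp (1 - (N : ℤ)) * C (spow hy 1)) - cst N := by
    rw [mul_assoc, h1, mul_sub, ← mul_assoc, dp_mul_dp, ← mul_assoc (dp _) (dp _), dp_mul_dp,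
      ← mul_assoc, ← cst_mul_comm, mul_assoc, dp_mul_dp, add_comm (1 - (N : ℤ))]
    simp [dp_zero]
  rw [timePow_one, timeDeriv]
  calc cst (-(κ : ℂ) * N)⁻¹ * (dp (1 - (N : ℤ)) * C (spow hy 1)) * (cst (κ : ℂ) * dp N)
      = cst (-(κ : ℂ) * N)⁻¹ * (cst (κ : ℂ) * (dp (1 - (N : ℤ)) * C (spow hy 1) * dp N)) := by
        rw [mul_assoc, ← mul_assoc _ (cst (κ : ℂ)), ← cst_mul_comm, mul_assoc]
    _ = cst (-(κ : ℂ) * N)⁻¹ * (cst (κ : ℂ) * (dp N * (dp (1 - (N : ℤ)) * C (spow hy 1))))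
        - cst ((-(κ : ℂ) * N)⁻¹ * (κ * N)) := by
        rw [h2, mul_sub, mul_sub, cst_mul, cst_mul]
    _ = cst (κ : ℂ) * (dp N * (cst (-(κ : ℂ) * N)⁻¹ * (dp (1 - (N : ℤ)) * C (spow hy 1)))) + 1 := by
        have e : (-(κ : ℂ) * N)⁻¹ * (κ * N) = -1 := by field_simp
        have e' : cst (O := O) (-1) = -1 := by simp [cst]
        have hc : ∀ Q : Psi (SmoothFn O), cst (κ : ℂ) * (dp N * (cst (-(κ : ℂ) * N)⁻¹ * Q)) =
            cst (-(κ : ℂ) * N)⁻¹ * (cst (κ : ℂ) * (dp N * Q)) := fun Q => by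
          rw [← mul_assoc (dp (N : ℤ)), ← cst_mul_comm _ (dp (N : ℤ)), mul_assoc, ← mul_assoc,
            cst_mul, mul_comm, ← cst_mul, mul_assoc]
        rw [e, e', sub_neg_eq_add, hc]
    _ = _ := by rw [mul_assoc]

theorem timePow_mul_timeDeriv (k : ℤ) : timePow hy hN hκ k * timeDeriv O N κ =
    timeDeriv O N κ * timePow hy hN hκ k + cst k * timePow hy hN hκ (k - 1) := by
  have h1 := timeOp_mul_timeDeriv hy hN hκ
  have hs : ∀ k, timePow hy hN hκ (k + 1) * timeDeriv O N κ =
      timePow hy hN hκ k * timeDeriv O N κ * timePow hy hN hκ 1 + timePow hy hN hκ k := by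
    intro k
    rw [← timePow_mul, mul_assoc, h1, mul_add, mul_one, mul_assoc]
  induction k with
  | zero => simp [timePow_zero, cst]
  | succ k ih =>
    have e : cst (O := O) (((k : ℤ) + 1 : ℤ) : ℂ) = cst ((k : ℤ) : ℂ) + 1 := by simp [cst]
    rw [hs, ih, add_mul, mul_assoc, timePow_mul, mul_assoc, timePow_mul, sub_add_cancel,
      add_sub_cancel_right, e, add_mul, one_mul, add_assoc]
  | pred k ih =>
    have h := hs (-(k : ℤ) - 1)
    rw [sub_add_cancel, ih] at h
    have h2 : timePow hy hN hκ (-(k : ℤ) - 1) * timeDeriv O N κ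
        = (timePow hy hN hκ (-(k : ℤ) - 1) * timeDeriv O N κ * timePow hy hN hκ 1) *
          timePow hy hN hκ (-1) := by
      rw [mul_assoc _ (timePow hy hN hκ 1), timePow_mul]; simp [timePow_zero]
    have e : cst (O := O) ((-(k : ℤ) - 1 : ℤ) : ℂ) = cst ((-(k : ℤ) : ℤ) : ℂ) - 1 := by simp [cst]
    rw [h2, eq_sub_iff_add_eq.mpr h.symm, sub_mul, add_mul, mul_assoc, timePow_mul, mul_assoc,
      timePow_mul, e, sub_mul, one_mul, ← sub_eq_add_neg, ← sub_eq_add_neg]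
    abel

theorem ord_cst (c : ℂ) : (cst (O := O) c).Ord 0 := ord_C _

theorem ord_timePow_nat (k : ℕ) : (timePow hy hN hκ k).Ord (-(k * ((N : ℤ) - 1))) := by
  induction k with
  | zero =>
    have h0 : (1 : Psi (SmoothFn O)).Ord 0 := ord_dp 0
    simpa [timePow_zero] using h0
  | succ k ih =>
    have e : ((k + 1 : ℕ) : ℤ) = k + 1 := by push_cast; ring
    rw [e, ← timePow_mul, timePow_one]
    refine (ih.mul ((ord_cst _).mul ((ord_dp _).mul (ord_C _)))).mono (le_of_eq ?_)
    ring

end TimeOp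

/-! ### Operators and functions -/

section Realization

variable {O : Opens ℝ} {y : ℝ} (hy : y ∉ O) {N : ℕ} {κ : ℝ} (hN : 2 ≤ N) (hκ : IsHeatSign N κ)

/-- `v` is the function obtained from the operator `P` by replacing `f ∂^j Z^k`, `Z` being the time
operator, by `f t^k E_j`. -/
inductive IsRealized : (ℝ → ℝ → ℂ) → Psi (SmoothFn O) → Prop
  | basic (f : SmoothFn O) (k : ℤ) (j : ℕ) : IsRealized
      (fun x t => f.toFun x * ((t : ℂ) ^ k * airyHeat N κ j x y t))
      (C f * (dp j * timePow hy hN hκ k))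
  | add {v w : ℝ → ℝ → ℂ} {P Q : Psi (SmoothFn O)} : IsRealized v P → IsRealized w Q →
      IsRealized (fun x t => v x t + w x t) (P + Q)

variable {hy hN hκ}

theorem IsRealized.mul_left {v : ℝ → ℝ → ℂ} {P : Psi (SmoothFn O)} (h : IsRealized hy hN hκ v P)
    (a : SmoothFn O) : IsRealized hy hN hκ (fun x t => a.toFun x * v x t) (C a * P) := by
  induction h with
  | basic f k j =>
    have := IsRealized.basic (hy := hy) (hN := hN) (hκ := hκ) (a * f) k j
    simp only [toFun_mul, map_mul] at this
    simpa only [mul_assoc] using this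
  | add _ _ h1 h2 => simpa only [mul_add] using h1.add h2

theorem IsRealized.zero : IsRealized hy hN hκ (fun _ _ => 0) 0 := by
  have := IsRealized.basic (hy := hy) (hN := hN) (hκ := hκ) 0 0 0
  have h0 : ∀ x, (0 : SmoothFn O).toFun x = 0 := fun x => by
    by_cases hx : x ∈ O
    · rw [toFun_eq_ev _ hx, map_zero]
    · simp [toFun, hx]
  simpa only [h0, zero_mul, map_zero] using this

theorem IsRealized.sum {ι : Type*} (s : Finset ι) {v : ι → ℝ → ℝ → ℂ} {P : ι → Psi (SmoothFn O)}
    (h : ∀ i ∈ s, IsRealized hy hN hκ (v i) (P i)) :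
    IsRealized hy hN hκ (fun x t => ∑ i ∈ s, v i x t) (∑ i ∈ s, P i) := by
  classical
  induction s using Finset.induction_on with
  | empty => simpa using IsRealized.zero
  | insert i s hi ih =>
    simp only [Finset.sum_insert hi]
    exact (h i (Finset.mem_insert_self i s)).add
      (ih fun j hj => h j (Finset.mem_insert_of_mem hj))

theorem IsRealized.deriv_left {v : ℝ → ℝ → ℂ} {P : Psi (SmoothFn O)}
    (h : IsRealized hy hN hκ v P) : ∃ v', IsRealized hy hN hκ v' (dp 1 * P) ∧
      ∀ x ∈ O, ∀ t, 0 < t → HasDerivAt (fun x => v x t) (v' x t) x := by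
  induction h with
  | basic f k j =>
    refine ⟨_, ?_, fun x hx t ht => (hasDerivAt_toFun f hx).mul
      ((hasDerivAt_airyHeat_left hN hκ j x y ht).const_mul ((t : ℂ) ^ k))⟩
    have h1 := (IsRealized.basic (hy := hy) (hN := hN) (hκ := hκ) (f′) k j).add
      (IsRealized.basic (hy := hy) (hN := hN) (hκ := hκ) f k (j + 1))
    convert h1 using 1
    have e : (dp ((j + 1 : ℕ) : ℤ) : Psi (SmoothFn O)) = dp 1 * dp j := by
      rw [dp_mul_dp]; congr 1; push_cast; ring
    rw [← mul_assoc, dp_one_mul_C, e, add_mul, mul_assoc, ← mul_assoc (dp 1), add_comm]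
  | add _ _ h1 h2 =>
    obtain ⟨v', hv, hv'⟩ := h1
    obtain ⟨w', hw, hw'⟩ := h2
    exact ⟨_, by rw [mul_add]; exact hv.add hw, fun x hx t ht => (hv' x hx t ht).add (hw' x hx t ht)⟩

/-- The product rule for `t^k E_j` matches `Z^k κ ∂^N = κ ∂^N Z^k + k Z^{k-1}`. -/
theorem IsRealized.deriv_time {v : ℝ → ℝ → ℂ} {P : Psi (SmoothFn O)}
    (h : IsRealized hy hN hκ v P) : ∃ v', IsRealized hy hN hκ v' (P * timeDeriv O N κ) ∧
      ∀ x, ∀ t, 0 < t → HasDerivAt (fun t => v x t) (v' x t) t := by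
  induction h with
  | basic f k j =>
    have h1 := ((IsRealized.basic (hy := hy) (hN := hN) (hκ := hκ) f (k - 1) j).mul_left
      (algebraMap ℂ _ (k : ℂ))).add
      ((IsRealized.basic (hy := hy) (hN := hN) (hκ := hκ) f k (j + N)).mul_left
        (algebraMap ℂ _ (κ : ℂ)))
    refine ⟨fun x t => f.toFun x * (k * (t : ℂ) ^ (k - 1) * airyHeat N κ j x y t +
      (t : ℂ) ^ k * (κ * airyHeat N κ (j + N) x y t)), ?_, fun x t ht => ?_⟩
    rotate_left
    · have ht' : (t : ℂ) ≠ 0 := by exact_mod_cast ht.ne'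
      have h2 : HasDerivAt (fun t : ℝ => (t : ℂ) ^ k) (k * (t : ℂ) ^ (k - 1)) t :=
        (hasDerivAt_zpow k (t : ℂ) (Or.inl ht')).comp_ofReal
      exact (h2.mul (hasDerivAt_airyHeat_time hN hκ j x y ht)).const_mul (f.toFun x)
    · convert h1 using 1
      · funext x t
        by_cases hx : x ∈ O
        · rw [toFun_eq_ev _ hx, toFun_eq_ev _ hx, toFun_eq_ev _ hx, ev_algebraMap, ev_algebraMap]
          ring
        · simp [toFun, hx]
      · change C f * (dp j * timePow hy hN hκ k) * timeDeriv O N κ =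
          cst (k : ℂ) * (C f * (dp j * timePow hy hN hκ (k - 1))) +
            cst (κ : ℂ) * (C f * (dp ((j + N : ℕ) : ℤ) * timePow hy hN hκ k))
        have e : (dp ((j + N : ℕ) : ℤ) : Psi (SmoothFn O)) = dp j * dp N := by
          rw [dp_mul_dp]; congr 1
        rw [mul_assoc, mul_assoc, timePow_mul_timeDeriv, timeDeriv, mul_add, mul_add, e, add_comm,
          mul_cst_mul, mul_cst_mul, mul_assoc (cst (κ : ℂ)), mul_cst_mul, mul_cst_mul, mul_assoc (dp _)]
  | add _ _ h1 h2 =>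
    obtain ⟨v', hv, hv'⟩ := h1
    obtain ⟨w', hw, hw'⟩ := h2
    exact ⟨_, by rw [add_mul]; exact hv.add hw, fun x t ht => (hv' x t ht).add (hw' x t ht)⟩

theorem IsRealized.iteratedDeriv_left {v : ℝ → ℝ → ℂ} {P : Psi (SmoothFn O)}
    (h : IsRealized hy hN hκ v P) (i : ℕ) : ∃ v', IsRealized hy hN hκ v' (dp i * P) ∧
      ∀ x ∈ O, ∀ t, 0 < t → iteratedDeriv i (fun x => v x t) x = v' x t := by
  induction i with
  | zero => exact ⟨v, by simpa [dp_zero] using h, fun x _ t _ => by rw [iteratedDeriv_zero]⟩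
  | succ i ih =>
    obtain ⟨v', hv, hv'⟩ := ih
    obtain ⟨v'', hw, hw'⟩ := hv.deriv_left
    refine ⟨v'', ?_, fun x hx t ht => ?_⟩
    · rw [← mul_assoc, dp_mul_dp] at hw
      convert hw using 3
      push_cast; ring
    · rw [iteratedDeriv_succ]
      exact (Filter.EventuallyEq.deriv_eq (eventuallyEq (fun z hz => hv' z hz t ht) hx)).trans
        (hw' x hx t ht).deriv

theorem laxPsi_eq (hN : 2 ≤ N) {I : Set ℝ} (hO : (O : Set ℝ) ⊆ I) {u : ℕ → ℝ → ℂ}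
    (hu : ∀ i, i + 2 ≤ N → ContDiffOn ℝ ∞ (u i) I) (a : ℕ → SmoothFn O)
    (ha : ∀ i, i + 2 ≤ N → ∀ x : O, ev x (a i) = u i x) :
    laxPsi hO hu = dp N + ∑ i ∈ Finset.range (N - 1), C (a i) * dp i := by
  ext n
  refine ext_ev fun x => ?_
  rw [coeff_add, coeff_sum, map_add, map_sum]
  simp only [coeff_C_mul, coeff_dp, mul_ite, mul_one, mul_zero]
  change (if n = N then (1 : ℝ → ℂ) else if 0 ≤ n ∧ n + 2 ≤ N then u n.toNat else 0) x.1 = _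
  split_ifs with h1 h2
  · rw [Finset.sum_eq_zero, add_zero, map_one]
    · rfl
    · intro i hi
      rw [Finset.mem_range] at hi
      rw [if_neg (by omega), map_zero]
  · rw [map_zero, zero_add, Finset.sum_eq_single n.toNat]
    · rw [if_pos (by omega), ha _ (by omega)]
    · intro i _ hi; rw [if_neg (by omega), map_zero]
    · intro hi; rw [Finset.mem_range] at hi; omega
  · rw [map_zero, zero_add, Finset.sum_eq_zero]
    · rfl
    · intro i hi
      rw [Finset.mem_range] at hi
      rw [if_neg (by omega), map_zero]

theorem IsRealized.lax {v : ℝ → ℝ → ℂ} {P : Psi (SmoothFn O)} (h : IsRealized hy hN hκ v P)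
    {I : Set ℝ} (hO : (O : Set ℝ) ⊆ I) {u : ℕ → ℝ → ℂ}
    (hu : ∀ i, i + 2 ≤ N → ContDiffOn ℝ ∞ (u i) I) :
    ∃ v', IsRealized hy hN hκ v' (laxPsi hO hu * P) ∧
      ∀ x ∈ O, ∀ t, 0 < t → laxApply N u (fun x => v x t) x = v' x t := by
  have hex : ∀ i, ∃ a : SmoothFn O, i + 2 ≤ N → ∀ x : O, ev x a = u i x := by
    intro i
    by_cases hi : i + 2 ≤ N
    · exact ⟨ofSmooth (u i) ((hu i hi).mono hO), fun _ x => rfl⟩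
    · exact ⟨0, fun h => absurd h hi⟩
  choose a ha using hex
  choose V hV hV' using h.iteratedDeriv_left
  refine ⟨fun x t => V N x t + ∑ i ∈ Finset.range (N - 1), (a i).toFun x * V i x t, ?_,
    fun x hx t ht => ?_⟩
  rotate_left
  · rw [laxApply, hV' N x hx t ht, Finset.sum_congr rfl fun i hi => ?_]
    rw [Finset.mem_range] at hi
    rw [hV' i x hx t ht, ← ha i (by omega) ⟨x, hx⟩, ← toFun_eq_ev]
  · rw [laxPsi_eq hN hO hu a ha, add_mul, Finset.sum_mul]
    refine (hV N).add (IsRealized.sum _ fun i _ => ?_)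
    rw [mul_assoc]
    exact (hV i).mul_left (a i)

variable (hy hN hκ)

/-- The pairs of a function of `t` and a symbol at the point `x` spanned by `t^k E_j` and the
symbol of `∂^j Z^k`, `j ≤ N - 2`. -/
def realSpan (x : O) : Submodule ℂ ((Set.Ioi (0 : ℝ) → ℂ) × (ℤ → ℂ)) :=
  Submodule.span ℂ (Set.range fun p : ℤ × Fin (N - 1) =>
    ((fun t : Set.Ioi (0 : ℝ) => ((t : ℝ) : ℂ) ^ p.1 * airyHeat N κ p.2 x y t),
      (fun n : ℤ => ev x ((dp (p.2 : ℕ) * timePow hy hN hκ p.1).coeff n))))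

/-- Indices `j ≥ N - 1` are lowered by the recurrence, which the function and the symbol satisfy
simultaneously. -/
theorem mem_realSpan_basic (x : O) (j : ℕ) (k : ℤ) :
    (((fun t : Set.Ioi (0 : ℝ) => ((t : ℝ) : ℂ) ^ k * airyHeat N κ j x y t),
      (fun n : ℤ => ev x ((dp j * timePow hy hN hκ k).coeff n))) :
        (Set.Ioi (0 : ℝ) → ℂ) × (ℤ → ℂ)) ∈ realSpan hy hN hκ x := by
  induction j using Nat.strong_induction_on generalizing k with
  | _ j ih =>
    rcases Nat.lt_or_ge j (N - 1) with hj | hj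
    · exact Submodule.subset_span ⟨(k, ⟨j, hj⟩), rfl⟩
    · obtain ⟨i, rfl⟩ : ∃ i, j = i + (N - 1) := ⟨j - (N - 1), by omega⟩
      have hne := heatConst_ne_zero hN hκ
      have hmem : ((-(κ : ℂ) * N)⁻¹) • ((((x : ℝ) : ℂ) - y) •
          (((fun t : Set.Ioi (0 : ℝ) => ((t : ℝ) : ℂ) ^ (k - 1) * airyHeat N κ i x y t),
            (fun n : ℤ => ev x ((dp i * timePow hy hN hκ (k - 1)).coeff n))) :
              (Set.Ioi (0 : ℝ) → ℂ) × (ℤ → ℂ)) + (i : ℂ) •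
          (((fun t : Set.Ioi (0 : ℝ) => ((t : ℝ) : ℂ) ^ (k - 1) * airyHeat N κ (i - 1) x y t),
            (fun n : ℤ => ev x ((dp ((i - 1 : ℕ) : ℤ) * timePow hy hN hκ (k - 1)).coeff n))) :
              (Set.Ioi (0 : ℝ) → ℂ) × (ℤ → ℂ))) ∈ realSpan hy hN hκ x :=
        Submodule.smul_mem _ _ (Submodule.add_mem _ (Submodule.smul_mem _ _ (ih i (by omega) _))
          (Submodule.smul_mem _ _ (ih (i - 1) (by omega) _)))
      convert hmem using 1
      refine Prod.ext (funext fun t => ?_) (funext fun n => ?_)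
      · simp only [Prod.smul_fst, Prod.fst_add, Pi.smul_apply, Pi.add_apply, smul_eq_mul]
        have ht : (((t : ℝ) : ℂ)) ≠ 0 := by exact_mod_cast (ne_of_gt t.2)
        have hr := airyHeat_recurrence hN hκ i x y t.2
        rw [eq_inv_mul_iff_mul_eq₀ hne]
        rw [zpow_sub_one₀ ht]
        have hr' : -(κ : ℂ) * N * airyHeat N κ (i + (N - 1)) x y t = ((t : ℝ) : ℂ)⁻¹ *
            ((((x : ℝ) : ℂ) - y) * airyHeat N κ i x y t + i * airyHeat N κ (i - 1) x y t) := by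
          rw [← hr]; field_simp
        linear_combination ((t : ℝ) : ℂ) ^ k * hr'
      · simp only [Prod.smul_snd, Prod.snd_add, Pi.smul_apply, Pi.add_apply, smul_eq_mul]
        rw [eq_inv_mul_iff_mul_eq₀ hne, ← ev_coeff_cst_mul, dp_mul_timePow, coeff_add, map_add,
          coeff_C_mul, map_mul, ev_spow, zpow_one, ev_coeff_cst_mul]
        congr 1
        cases i with
        | zero => simp
        | succ i => rw [Nat.add_sub_cancel, Nat.cast_succ, Nat.cast_succ, add_sub_cancel_right]

variable {hy hN hκ}

theorem IsRealized.mem_realSpan {v : ℝ → ℝ → ℂ} {P : Psi (SmoothFn O)}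
    (h : IsRealized hy hN hκ v P) (x : O) :
    (((fun t : Set.Ioi (0 : ℝ) => v x t), (fun n : ℤ => ev x (P.coeff n))) :
      (Set.Ioi (0 : ℝ) → ℂ) × (ℤ → ℂ)) ∈ realSpan hy hN hκ x := by
  induction h with
  | basic f k j =>
    have := Submodule.smul_mem _ (ev x f) (mem_realSpan_basic hy hN hκ x j k)
    convert this using 1
    refine Prod.ext (funext fun t => ?_) (funext fun n => ?_)
    · simp [toFun_eq_ev f x.2]
    · simp [coeff_C_mul]
  | add _ _ h1 h2 =>
    convert Submodule.add_mem _ h1 h2 using 1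
    refine Prod.ext rfl (funext fun n => ?_)
    simp

/-- By linear independence of the first components, the span is the graph of a linear map. A
realized function therefore determines the symbol of its operator at `x`. -/
theorem eq_zero_of_mem_realSpan {x : O} {p : ℤ → ℂ}
    (h : ((0, p) : (Set.Ioi (0 : ℝ) → ℂ) × (ℤ → ℂ)) ∈ realSpan hy hN hκ x) : p = 0 := by
  rw [realSpan, Finsupp.mem_span_range_iff_exists_finsupp] at h
  obtain ⟨c, hc⟩ := h
  have hli := linearIndependent_airyHeat hN hκ (ne_of_mem hy x)
  rw [linearIndependent_iff] at hli
  have h1 := congrArg Prod.fst hc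
  rw [Finsupp.sum, Prod.fst_sum] at h1
  have hc0 : c = 0 := hli c (by rw [Finsupp.linearCombination_apply, Finsupp.sum]; exact h1)
  have h2 := congrArg Prod.snd hc
  rw [hc0, Finsupp.sum_zero_index] at h2
  exact h2.symm

/-- A realized function that is a combination of `t^k E_j` with `k ≥ M` only comes from an operator
of small order. -/
theorem IsRealized.coeff_eq_zero {v : ℝ → ℝ → ℂ} {P : Psi (SmoothFn O)}
    (h : IsRealized hy hN hκ v P) {x : O} {M m : ℕ} {r : ℕ → ℕ → ℂ}
    (hv : ∀ t : ℝ, 0 < t → v x t = ∑ k ∈ Finset.Ico M m, ∑ j ∈ Finset.range (N - 1),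
      r k j * (t : ℂ) ^ k * airyHeat N κ j x y t) {n : ℤ}
    (hn : (N : ℤ) - 2 - M * ((N : ℤ) - 1) < n) : ev x (P.coeff n) = 0 := by
  have h1 := h.mem_realSpan x
  have h2 : ∑ k ∈ Finset.Ico M m, ∑ j ∈ Finset.range (N - 1), r k j •
      (((fun t : Set.Ioi (0 : ℝ) => ((t : ℝ) : ℂ) ^ (k : ℤ) * airyHeat N κ j x y t),
      (fun n : ℤ => ev x ((dp j * timePow hy hN hκ k).coeff n))) :
        (Set.Ioi (0 : ℝ) → ℂ) × (ℤ → ℂ)) ∈ realSpan hy hN hκ x :=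
    Submodule.sum_mem _ fun k _ => Submodule.sum_mem _ fun j _ =>
      Submodule.smul_mem _ _ (mem_realSpan_basic hy hN hκ x j k)
  have h3 := Submodule.sub_mem _ h1 h2
  have h4 : (fun t : Set.Ioi (0 : ℝ) => v x t) - (∑ k ∈ Finset.Ico M m,
      ∑ j ∈ Finset.range (N - 1), r k j •
      (((fun t : Set.Ioi (0 : ℝ) => ((t : ℝ) : ℂ) ^ (k : ℤ) * airyHeat N κ j x y t),
      (fun n : ℤ => ev x ((dp j * timePow hy hN hκ k).coeff n))) :
        (Set.Ioi (0 : ℝ) → ℂ) × (ℤ → ℂ))).1 = 0 := by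
    funext t
    simp only [Prod.fst_sum, Prod.smul_fst, Pi.sub_apply, Finset.sum_apply, Pi.smul_apply,
      smul_eq_mul, Pi.zero_apply, zpow_natCast]
    rw [hv t t.2, sub_eq_zero]
    simp only [mul_assoc]
  have h5 := eq_zero_of_mem_realSpan (p := _) (by rw [← h4]; exact h3)
  have h6 := congrFun h5 n
  simp only [Prod.snd_sum, Prod.smul_snd, Pi.sub_apply, Finset.sum_apply, Pi.smul_apply,
    smul_eq_mul, Pi.zero_apply] at h6
  rw [sub_eq_zero] at h6
  refine h6.trans (Finset.sum_eq_zero fun k hk => Finset.sum_eq_zero fun j hj => ?_)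
  rw [Finset.mem_Ico] at hk
  rw [Finset.mem_range] at hj
  -- For `j ≤ N - 2` and `k ≥ M` the operator `∂^j Z^k` has order at most `N - 2 - M (N - 1)`.
  rw [((ord_dp _).mul (ord_timePow_nat hy hN hκ k)) n ?_, map_zero, mul_zero]
  have : (M : ℤ) * ((N : ℤ) - 1) ≤ k * ((N : ℤ) - 1) :=
    mul_le_mul_of_nonneg_right (by exact_mod_cast hk.1) (by omega)
  omega

end Realization
end

noncomputable section

open scoped Differential
open TopologicalSpace SmoothFn Psi

/-! ### Comparison of the two expansions -/

namespace Psi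

variable {A : Type*} [CommRing A] [Differential A]

theorem coeff_commutator_dp {P : Psi A} {p : ℤ} (hP : P.Ord p) (m : ℕ) :
    (dp m * P - P * dp m).coeff (p + m - 1) = (m : ℤ) • (P.coeff p)′ := by
  rw [coeff_sub, dp_mul, coeff_dmul hP m (p + m - 1) (K := 2) (by push_cast; omega), coeff_mul_dp,
    Finset.sum_range_succ, Finset.sum_range_one, iterD_zero, iterD_one, Ring.choose_zero_right,
    Ring.choose_one_right, one_smul]
  have e1 : p + (m : ℤ) - 1 - m + ((0 : ℕ) : ℤ) = p + m - 1 - m := by simp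
  have e2 : p + (m : ℤ) - 1 - m + ((1 : ℕ) : ℤ) = p := by push_cast; ring
  rw [e1, e2, add_sub_cancel_left]

theorem Ord.pow {P : Psi A} {p : ℤ} (hP : P.Ord p) (k : ℕ) : (P ^ k).Ord (k * p) := by
  induction k with
  | zero =>
    have h0 : (1 : Psi A).Ord 0 := ord_dp 0
    simpa using h0
  | succ k ih =>
    rw [pow_succ]
    exact (ih.mul hP).mono (le_of_eq (by push_cast; ring))

theorem coeff_pow_top {P : Psi A} {p : ℤ} (hP : P.Ord p) (k : ℕ) :
    (P ^ k).coeff (k * p) = P.coeff p ^ k := by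
  induction k with
  | zero => simp only [pow_zero, Nat.cast_zero, zero_mul]; rfl
  | succ k ih =>
    have e : ((k + 1 : ℕ) : ℤ) * p = k * p + p := by push_cast; ring
    rw [pow_succ, e, coeff_mul_top (hP.pow k) hP, ih, pow_succ]

end Psi

namespace SmoothFn

variable {O : Opens ℝ}

theorem eq_algebraMap_of_deriv_eq_zero (hO : IsPreconnected (O : Set ℝ)) (f : SmoothFn O)
    (hf : (f′ : SmoothFn O) = 0) : ∃ c : ℂ, f = algebraMap ℂ _ c := by
  have hd : ∀ x ∈ O, HasDerivAt f.toFun 0 x := fun x hx => by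
    have h := hasDerivAt_toFun f hx
    rwa [hf, toFun_eq_ev _ hx, map_zero] at h
  rcases (O : Set ℝ).eq_empty_or_nonempty with h | ⟨x₀, hx₀⟩
  · exact ⟨0, ext_ev fun x => absurd x.2 (by
      change x.1 ∉ (O : Set ℝ)
      rw [h]; exact Set.notMem_empty _)⟩
  · refine ⟨f.toFun x₀, ext_ev fun x => ?_⟩
    rw [ev_algebraMap, ← toFun_eq_ev f x.2]
    refine O.isOpen.is_const_of_deriv_eq_zero hO
      (fun z hz => (hd z hz).differentiableAt.differentiableWithinAt)
      (fun z hz => (hd z hz).deriv) x.2 hx₀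

end SmoothFn

section Comparison

variable {O : Opens ℝ} {y : ℝ} (hy : y ∉ O) {N : ℕ} {κ : ℝ} (hN : 2 ≤ N) (hκ : IsHeatSign N κ)

theorem ord_timePow_neg (k : ℕ) : (timePow hy hN hκ (-k)).Ord (k * ((N : ℤ) - 1)) := by
  rw [timePow_neg_nat]
  exact ((ord_cst _).mul (((ord_C _).mul (ord_dp _)).pow k)).mono (le_of_eq (by ring))

theorem ev_coeff_timePow_neg_top (k : ℕ) (x : O) :
    ev x ((timePow hy hN hκ (-k)).coeff (k * ((N : ℤ) - 1))) =
      (-(κ : ℂ) * N) ^ k * (((x : ℝ) : ℂ) - y) ^ (-(k : ℤ)) := by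
  have h : (C (spow hy (-1)) * dp ((N : ℤ) - 1)).Ord ((N : ℤ) - 1) :=
    ((ord_C _).mul (ord_dp _)).mono (by omega)
  rw [timePow_neg_nat, ev_coeff_cst_mul, coeff_pow_top h, coeff_C_mul, coeff_dp, if_pos rfl,
    mul_one, map_pow, ev_spow, zpow_neg_one, inv_pow, zpow_neg, zpow_natCast]

/-- For `l > 0` the order is negative. For `l < 0` the operator is a differential operator times
`∂^{N-1}` on the right, so it has no terms of order below `N - 1`. This duality lets `Z^{-k}`
extract single coefficients of an expansion in `∂^i Z^l`. -/
theorem coeff_dp_mul_timePow {i j : ℕ} (hi : i + 2 ≤ N) (hj : j + 2 ≤ N) (l : ℤ) :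
    (dp i * timePow hy hN hκ l).coeff j = if l = 0 ∧ i = j then 1 else 0 := by
  rcases lt_trichotomy l 0 with hl | rfl | hl
  · rw [if_neg (by omega)]
    obtain ⟨l, rfl⟩ : ∃ m : ℕ, l = -((m + 1 : ℕ) : ℤ) := ⟨(-l - 1).toNat, by omega⟩
    have hX : (C (spow hy (-1)) * dp ((N : ℤ) - 1)).IsDiff :=
      (isDiff_C _).mul (isDiff_dp (by omega))
    have e : dp i * timePow hy hN hκ (-((l + 1 : ℕ) : ℤ)) =
        dp i * (cst ((-(κ : ℂ) * N) ^ (l + 1)) *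
          ((C (spow hy (-1)) * dp ((N : ℤ) - 1)) ^ l * C (spow hy (-1)))) * dp ((N : ℤ) - 1) := by
      rw [timePow_neg_nat, pow_succ (C _ * _)]
      simp only [mul_assoc]
    rw [e, coeff_mul_dp]
    exact (isDiff_dp (by omega)).mul ((isDiff_C _).mul ((hX.pow l).mul (isDiff_C _))) _ (by omega)
  · rw [timePow_zero, mul_one, coeff_dp]
    simp [eq_comm]
  · rw [if_neg (by omega)]
    obtain ⟨l, rfl⟩ : ∃ m : ℕ, l = (m : ℤ) := ⟨l.toNat, by omega⟩
    refine ((ord_dp _).mul (ord_timePow_nat hy hN hκ l)) j ?_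
    have : 1 * ((N : ℤ) - 1) ≤ l * ((N : ℤ) - 1) :=
      mul_le_mul_of_nonneg_right (by omega) (by omega)
    omega

/-- The operator realizing the heat expansion with coefficients `h k j`, truncated after `t^M`. -/
def heatOp (h : ℕ → ℕ → SmoothFn O) (M : ℕ) : Psi (SmoothFn O) :=
  1 + ∑ j ∈ Finset.range (N - 1), ∑ k ∈ Finset.Icc 1 M, C (h k j) * (dp j * timePow hy hN hκ k)

theorem coeff_heatOp_mul_timePow (h : ℕ → ℕ → SmoothFn O) {M k j : ℕ} (hk : 1 ≤ k) (hkM : k ≤ M)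
    (hj : j + 2 ≤ N) : (heatOp hy hN hκ h M * timePow hy hN hκ (-k)).coeff j = h k j := by
  have h1 : (timePow hy hN hκ (-k)).coeff j = 0 := by
    have := coeff_dp_mul_timePow hy hN hκ (i := 0) (by omega) hj (-k)
    rwa [Nat.cast_zero, dp_zero, one_mul, if_neg (by omega)] at this
  rw [heatOp, add_mul, one_mul, coeff_add, h1, zero_add, Finset.sum_mul, coeff_sum,
    Finset.sum_eq_single_of_mem j (Finset.mem_range.mpr (by omega)), Finset.sum_mul, coeff_sum,
    Finset.sum_eq_single_of_mem k (Finset.mem_Icc.mpr ⟨hk, hkM⟩)]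
  · rw [mul_assoc, coeff_C_mul, mul_assoc, timePow_mul, coeff_dp_mul_timePow hy hN hκ hj hj,
      if_pos (by omega), mul_one]
  · intro l _ hl
    rw [mul_assoc, coeff_C_mul, mul_assoc, timePow_mul, coeff_dp_mul_timePow hy hN hκ hj hj,
      if_neg (by omega), mul_zero]
  · intro i hi hij
    rw [Finset.mem_range] at hi
    rw [Finset.sum_mul, coeff_sum]
    refine Finset.sum_eq_zero fun l _ => ?_
    rw [mul_assoc, coeff_C_mul, mul_assoc, timePow_mul,
      coeff_dp_mul_timePow hy hN hκ (by omega) hj, if_neg (by omega), mul_zero]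

theorem ord_heatOp_sub_one (h : ℕ → ℕ → SmoothFn O) (M : ℕ) :
    (heatOp hy hN hκ h M - 1).Ord (-1) := by
  rw [heatOp, add_sub_cancel_left]
  refine Ord.sum fun j hj => Ord.sum fun k hk => ?_
  rw [Finset.mem_range] at hj
  rw [Finset.mem_Icc] at hk
  refine ((ord_C _).mul ((ord_dp _).mul (ord_timePow_nat hy hN hκ k))).mono ?_
  have : 1 * ((N : ℤ) - 1) ≤ k * ((N : ℤ) - 1) :=
    mul_le_mul_of_nonneg_right (by omega) (by omega)
  omega

theorem exists_isRealized_heatOp (h : ℕ → ℕ → SmoothFn O) (M : ℕ) {H : ℕ → ℕ → ℝ → ℝ → ℂ}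
    (hH : ∀ k j, 1 ≤ k → j + 2 ≤ N → ∀ x : O, ev x (h k j) = H k j x y) :
    ∃ v, IsRealized hy hN hκ v (heatOp hy hN hκ h M) ∧
      ∀ x ∈ O, ∀ t, v x t = heatTrunc N κ H M x y t := by
  have h1 := (IsRealized.basic (hy := hy) (hN := hN) (hκ := hκ) 1 0 0).add
    (IsRealized.sum (Finset.range (N - 1)) fun j _ => IsRealized.sum (Finset.Icc 1 M) fun k _ =>
      IsRealized.basic (hy := hy) (hN := hN) (hκ := hκ) (h k j) k j)
  rw [Nat.cast_zero, dp_zero, timePow_zero, map_one, one_mul, one_mul] at h1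
  refine ⟨_, h1, fun x hx t => ?_⟩
  rw [heatTrunc, toFun_eq_ev _ hx, map_one, one_mul, zpow_zero, one_mul]
  congr 1
  refine Finset.sum_congr rfl fun j hj => ?_
  rw [Finset.mul_sum]
  refine Finset.sum_congr rfl fun k hk => ?_
  rw [Finset.mem_range] at hj
  rw [Finset.mem_Icc] at hk
  rw [toFun_eq_ev _ hx, hH k j hk.1 (by omega), zpow_natCast]
  ring

/-- The heat operator applied to the truncated expansion is realized by `-κ (𝓛 V - V ∂^N)`, and by
hypothesis it involves only `t^k E_j` with `k ≥ M`. -/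
theorem ord_lax_heatOp {I : Set ℝ} (hO : (O : Set ℝ) ⊆ I) {u : ℕ → ℝ → ℂ}
    (hu : ∀ i, i + 2 ≤ N → ContDiffOn ℝ ∞ (u i) I) {U : Set (ℝ × ℝ)}
    (hOU : ∀ s ∈ O, (s, y) ∈ U) {H : ℕ → ℕ → ℝ → ℝ → ℂ} (hH : IsFormalHeatSolution U N κ u H)
    (h : ℕ → ℕ → SmoothFn O) (M : ℕ)
    (hhH : ∀ k j, 1 ≤ k → j + 2 ≤ N → ∀ x : O, ev x (h k j) = H k j x y) :
    (laxPsi hO hu * heatOp hy hN hκ h M - heatOp hy hN hκ h M * dp N).Ord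
      ((N : ℤ) - 2 - M * ((N : ℤ) - 1)) := by
  intro n hn
  refine ext_ev fun x => ?_
  rw [map_zero]
  obtain ⟨v, hv, hvH⟩ := exists_isRealized_heatOp hy hN hκ h M hhH
  obtain ⟨vt, hvt, hvt'⟩ := hv.deriv_time
  obtain ⟨vl, hvl, hvl'⟩ := hv.lax hO hu
  obtain ⟨m, r, hr⟩ := hH M
  have hκκ : (κ : ℂ) * κ = 1 := by exact_mod_cast hκ.sq_eq_one
  have hκ0 : -(κ : ℂ) ≠ 0 := neg_ne_zero.mpr fun h0 => by rw [h0] at hκκ; simp at hκκ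
  have hreal := hvt.add (hvl.mul_left (algebraMap ℂ _ (-(κ : ℂ))))
  have hz := hreal.coeff_eq_zero (x := x) (M := M) (m := m) (r := fun k j => r k j x y)
    (fun t ht => by
      rw [← hr x y (hOU x x.2) t ht, toFun_eq_ev _ x.2, ev_algebraMap, ← (hvt' x t ht).deriv,
        ← hvl' x x.2 t ht]
      have e1 : (fun τ => heatTrunc N κ H M x y τ) = fun τ => v x τ :=
        funext fun τ => (hvH x x.2 τ).symm
      have e2 : ∀ i, iteratedDeriv i (fun s => heatTrunc N κ H M s y t) x =
          iteratedDeriv i (fun s => v s t) x := fun i =>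
        Filter.EventuallyEq.iteratedDeriv_eq i
          (eventuallyEq (fun s hs => (hvH s hs t).symm) x.2)
      rw [e1, laxApply, laxApply]
      simp only [e2]
      ring) hn
  have e : heatOp hy hN hκ h M * timeDeriv O N κ +
      C (algebraMap ℂ _ (-(κ : ℂ))) * (laxPsi hO hu * heatOp hy hN hκ h M) =
      cst (-(κ : ℂ)) * (laxPsi hO hu * heatOp hy hN hκ h M - heatOp hy hN hκ h M * dp N) := by
    rw [timeDeriv, mul_cst_mul, mul_sub]
    simp only [cst, map_neg]
    noncomm_ring
  rw [e, ev_coeff_cst_mul] at hz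
  exact (mul_eq_zero.mp hz).resolve_left hκ0

/-- Since `𝓛` has no term of order `N - 1`, its lower part contributes nothing in order `p + N - 1`,
and `[∂^N, P]` decides. -/
theorem coeff_lax_commutator {I : Set ℝ} (hO : (O : Set ℝ) ⊆ I) {u : ℕ → ℝ → ℂ}
    (hu : ∀ i, i + 2 ≤ N → ContDiffOn ℝ ∞ (u i) I) {P : Psi (SmoothFn O)} {p : ℤ} (hP : P.Ord p) :
    (laxPsi hO hu * P - P * dp N).coeff (p + N - 1) = (N : ℤ) • (P.coeff p)′ := by
  have hR : (laxPsi hO hu - dp N).Ord ((N : ℤ) - 2) := fun i hi => ext_ev fun x => by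
    rw [coeff_sub, map_sub, map_zero, coeff_dp]
    change (if i = N then (1 : ℝ → ℂ) else if 0 ≤ i ∧ i + 2 ≤ N then u i.toNat else 0) x.1 - _ = 0
    split_ifs with h1 h2
    · simp
    · omega
    · simp
  have e : laxPsi hO hu * P - P * dp N =
      (dp N * P - P * dp N) + (laxPsi hO hu - dp N) * P := by rw [sub_mul]; abel
  rw [e, coeff_add, coeff_commutator_dp hP, (hR.mul hP) _ (by omega), add_zero]

/-- Right multiplication by `∂^{-j-1}` turns the coefficient of `∂^j` into a residue. Expanding `W`
in powers of `∂` then gives the sum of the theorem. -/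
theorem coeff_mul_timePow_neg {W : Psi (SmoothFn O)} (hW : W.Ord 0) {k j : ℕ} (hk : 1 ≤ k)
    (hj : j + 2 ≤ N) (x : O) : ev x ((W * timePow hy hN hκ (-k)).coeff j) =
      (-(κ : ℂ) * N) ^ k * ∑ n ∈ Finset.Icc 1 (k * (N - 1) - j), ev x (W.coeff (-(n : ℤ))) *
        ev x ((dp (-(n : ℤ)) * (C (spow hy (-1)) * dp ((N : ℤ) - 1)) ^ k *
          dp (-(j : ℤ) - 1)).coeff (-1)) := by
  have hQ : ((k * (N - 1) - j : ℕ) : ℤ) = k * ((N : ℤ) - 1) - j := by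
    have : 1 * (N - 1) ≤ k * (N - 1) := Nat.mul_le_mul_right _ hk
    rw [Nat.cast_sub (by omega), Nat.cast_mul, Nat.cast_sub (by omega), Nat.cast_one]
  set Q := k * (N - 1) - j with hQdef
  set X := (C (spow hy (-1)) * dp ((N : ℤ) - 1)) ^ k with hX
  have hXord : X.Ord (k * ((N : ℤ) - 1)) :=
    (((ord_C _).mul (ord_dp _)).pow k).mono (le_of_eq (by ring))
  -- Terms `∂^{-n}` with `n > Q` are discarded: the total order then falls below `-1`.
  have htr : (W - ∑ n ∈ Finset.range (Q + 1), C (W.coeff (-(n : ℤ))) * dp (-(n : ℤ))).Ord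
      (-(Q : ℤ) - 1) := by
    have h1 := exists_trunc W hW (-(Q : ℤ) - 1)
    have e : ∑ i ∈ Finset.Ioc (-(Q : ℤ) - 1) 0, mon (W.coeff i) i =
        ∑ n ∈ Finset.range (Q + 1), C (W.coeff (-(n : ℤ))) * dp (-(n : ℤ)) := by
      refine Finset.sum_nbij' (fun i => (-i).toNat) (fun n => -(n : ℤ)) ?_ ?_ ?_ ?_ ?_
      · intro i hi
        rw [Finset.mem_Ioc] at hi
        rw [Finset.mem_range]; omega
      · intro n hn
        rw [Finset.mem_range] at hn
        rw [Finset.mem_Ioc]; omega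
      · intro i hi
        rw [Finset.mem_Ioc] at hi
        omega
      · intro n _
        omega
      · intro i hi
        rw [Finset.mem_Ioc] at hi
        have e2 : (-(((-i).toNat : ℕ) : ℤ)) = i := by omega
        rw [e2, C_mul_dp]
    rwa [e] at h1
  have h0 := ((htr.mul hXord).mul (ord_dp (-(j : ℤ) - 1))) (-1) (by rw [hQ]; omega)
  rw [sub_mul, sub_mul, coeff_sub, sub_eq_zero] at h0
  have e3 : (W * timePow hy hN hκ (-k)).coeff j =
      (cst ((-(κ : ℂ) * N) ^ k) * (W * X * dp (-(j : ℤ) - 1))).coeff (-1) := by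
    rw [timePow_neg_nat, mul_cst_mul, ← mul_assoc (cst _) (W * X), coeff_mul_dp]
    congr 1
    ring
  obtain ⟨F, -, -, hF⟩ := exists_residue_formula hy hN hk hj
  rw [e3, ev_coeff_cst_mul, h0, Finset.sum_mul, Finset.sum_mul, coeff_sum, map_sum,
    Finset.sum_range_succ', ← Finset.Ico_add_one_right_eq_Icc, Finset.sum_Ico_eq_sum_range,
    Nat.add_sub_cancel]
  congr 1
  -- The term `n = 0` has no residue, so the sum starts at `n = 1`.
  rw [mul_assoc (C _ * _), mul_assoc (C _), coeff_C_mul, Nat.cast_zero, neg_zero, dp_zero, one_mul,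
    hF, mul_zero, map_zero, add_zero]
  refine Finset.sum_congr rfl fun n _ => ?_
  rw [mul_assoc (C _ * _), mul_assoc (C _), coeff_C_mul, map_mul, add_comm n 1, ← mul_assoc]

end Comparison
end

noncomputable section

open scoped Differential
open TopologicalSpace SmoothFn Psi

/-! ### Behaviour on the diagonal and conclusion -/

theorem tendsto_sub_pow_mul {f : ℝ → ℂ} {y : ℝ} (hf : ContinuousAt f y) {k : ℕ} (hk : 1 ≤ k) :
    Filter.Tendsto (fun x : ℝ => ((x : ℂ) - y) ^ k * f x) (nhds y) (nhds 0) := by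
  have h : ContinuousAt (fun x : ℝ => ((x : ℂ) - y) ^ k * f x) y :=
    ContinuousAt.mul (by fun_prop) hf
  have h' := h.tendsto
  rwa [sub_self, zero_pow (by omega), zero_mul] at h'

section Uniqueness

variable {O : Opens ℝ} {y : ℝ} (hy : y ∉ O) {N : ℕ} {κ : ℝ} (hN : 2 ≤ N) (hκ : IsHeatSign N κ)
  {I : Set ℝ} {u : ℕ → ℝ → ℂ} {w : ℕ → ℝ → ℝ → ℂ} {W : Psi (SmoothFn O)}

/-- The factor `(x-y)^k` changes the exponents `n - kN + j` of the residue formula into `n - Q` with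
`Q = k (N-1) - j`, the normalization of `tendsto_newton_sum`. -/
theorem tendsto_resolvent_coeff (hI : IsOpen I) (hyI : y ∈ I)
    (hu : ∀ i, i + 2 ≤ N → ContDiffOn ℝ ∞ (u i) I) (hw : IsResolventCoeffs I N u w)
    (hW : W.Ord 0) (hWw : ∀ (n : ℕ) (x : O), ev x (W.coeff (-n)) = w n x y) {k j : ℕ} (hk : 1 ≤ k)
    (hj : j + 2 ≤ N) : Filter.Tendsto
      (fun x : ℝ => ((x : ℂ) - y) ^ k * ((W * timePow hy hN hκ (-k)).coeff j).toFun x)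
      (nhdsWithin y O) (nhds 0) := by
  obtain ⟨hsm, hflat⟩ := resolvent_flat hI hu hw hyI
  obtain ⟨F, hF, hres, -⟩ := exists_residue_formula hy hN hk hj
  have hQ : ((k * (N - 1) - j : ℕ) : ℤ) = k * ((N : ℤ) - 1) - j := by
    have : 1 * (N - 1) ≤ k * (N - 1) := Nat.mul_le_mul_right _ hk
    rw [Nat.cast_sub (by omega), Nat.cast_mul, Nat.cast_sub (by omega), Nat.cast_one]
  have h1 := (tendsto_newton_sum hI hyI hsm hflat hF).const_mul ((-(κ : ℂ) * N) ^ k)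
  rw [mul_zero] at h1
  have hsub : (O : Set ℝ) ⊆ {y}ᶜ := fun x hx => ne_of_mem hy ⟨x, hx⟩
  refine (h1.mono_left (nhdsWithin_mono y hsub)).congr' ?_
  filter_upwards [self_mem_nhdsWithin] with x hx
  have hne := sub_ne_zero_of_mem hy ⟨x, hx⟩
  rw [toFun_eq_ev _ hx, coeff_mul_timePow_neg hy hN hκ hW hk hj, mul_left_comm]
  congr 1
  rw [Finset.mul_sum]
  refine Finset.sum_congr rfl fun n hn => ?_
  rw [Finset.mem_Icc] at hn
  rw [hres n hn.1 hn.2, map_mul, ev_algebraMap, ev_spow, hWw,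
    show (n : ℤ) - (k * (N - 1) - j : ℕ) = k + (n - k * N + j) by rw [hQ]; ring,
    zpow_add₀ hne, zpow_natCast]
  ring

/-- Division of `n - 1` by `N - 1` with quotient `q` and remainder `r`: take `k = q + 1` and `j = N
- 2 - r`. Every order down to `-M (N-1)` is thus reached by some `∂^j Z^k` with `j ≤ N - 2`. -/
theorem exists_eq_mul_sub {N n M : ℕ} (hN : 2 ≤ N) (hn : 1 ≤ n) (hM : n ≤ M * (N - 1)) :
    ∃ k j : ℕ, 1 ≤ k ∧ k ≤ M ∧ j + 2 ≤ N ∧ n + j = k * (N - 1) := by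
  obtain ⟨d, rfl⟩ : ∃ d, N = d + 2 := ⟨N - 2, by omega⟩
  rw [show d + 2 - 1 = d + 1 by omega] at hM ⊢
  obtain ⟨q, r, hr, hqr⟩ : ∃ q r : ℕ, r < d + 1 ∧ n - 1 = q * (d + 1) + r :=
    ⟨(n - 1) / (d + 1), (n - 1) % (d + 1), Nat.mod_lt _ (Nat.succ_pos d),
      (Nat.div_add_mod' _ _).symm⟩
  have hq : (q + 1) * (d + 1) = q * (d + 1) + (d + 1) := by ring
  refine ⟨q + 1, d - r, by omega, ?_, by omega, by omega⟩
  exact lt_of_mul_lt_mul_right (a := d + 1) (by omega) (Nat.zero_le _)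

/-- Uniqueness of the intertwiner, by descent on the order of `V - W`: the equation makes each
leading coefficient constant, and the behaviour at the diagonal makes the constant zero. -/
theorem hadamard_eq_coeff (hI : IsOpen I) (hyI : y ∈ I)
    (hu : ∀ i, i + 2 ≤ N → ContDiffOn ℝ ∞ (u i) I) (hw : IsResolventCoeffs I N u w)
    (hpre : IsPreconnected (O : Set ℝ)) (hcl : y ∈ closure (O : Set ℝ)) (hO : (O : Set ℝ) ⊆ I)
    {U : Set (ℝ × ℝ)} (hU : IsOpen U) (hyU : (y, y) ∈ U) (hOU : ∀ s ∈ O, (s, y) ∈ U)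
    {H : ℕ → ℕ → ℝ → ℝ → ℂ} (hH : IsHadamardCoeffs U N κ u H)
    (hW : W.Ord 0) (hW0 : W.coeff 0 = 1) (hWw : ∀ (n : ℕ) (x : O), ev x (W.coeff (-n)) = w n x y)
    (hWL : laxPsi hO hu * W = W * dp N) {k j : ℕ} (hk : 1 ≤ k) (hj : j + 2 ≤ N) (x : O) :
    H k j x y = ev x ((W * timePow hy hN hκ (-k)).coeff j) := by
  have hsm : ∀ k j, 1 ≤ k → j + 2 ≤ N → ContDiffOn ℝ ∞ (fun s => H k j s y) O := fun k j hk hj =>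
    (hH.1 k j hk hj).comp (f := fun s : ℝ => (s, y)) (by fun_prop) fun s hs => hOU s hs
  have hcont : ∀ k j, 1 ≤ k → j + 2 ≤ N → ContinuousAt (fun s => H k j s y) y := fun k j hk hj =>
    ((hH.1 k j hk hj).continuousOn.continuousAt (hU.mem_nhds hyU)).comp (f := fun s : ℝ => (s, y))
      (by fun_prop)
  have hex : ∀ k j, ∃ f : SmoothFn O, 1 ≤ k → j + 2 ≤ N → ∀ x : O, ev x f = H k j x y := by
    intro k j
    by_cases h : 1 ≤ k ∧ j + 2 ≤ N
    · exact ⟨ofSmooth _ (hsm k j h.1 h.2), fun _ _ x => rfl⟩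
    · exact ⟨0, fun h1 h2 => absurd ⟨h1, h2⟩ h⟩
  choose h hh using hex
  set V := heatOp hy hN hκ h k with hV
  have hcomm := ord_lax_heatOp hy hN hκ hO hu hOU hH.2 h k hh
  have hcomm' : laxPsi hO hu * (V - W) - (V - W) * dp N = laxPsi hO hu * V - V * dp N := by
    rw [mul_sub, sub_mul, hWL]; abel
  rw [← hV, ← hcomm'] at hcomm
  have hneBot : (nhdsWithin y (O : Set ℝ)).NeBot := mem_closure_iff_nhdsWithin_neBot.mp hcl
  have key : ∀ n : ℕ, n ≤ k * (N - 1) → (V - W).Ord (-(n : ℤ) - 1) := by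
    intro n
    induction n with
    | zero =>
      intro _ i hi
      have e : V - W = (V - 1) - (W - 1) := by abel
      rw [e, coeff_sub, ord_heatOp_sub_one hy hN hκ h k i (by push_cast at hi; omega), zero_sub,
        neg_eq_zero, coeff_sub]
      rcases eq_or_lt_of_le (show 0 ≤ i by push_cast at hi; omega) with rfl | hi'
      · rw [hW0]; exact sub_self _
      · have h1 : (1 : Psi (SmoothFn O)).coeff i = 0 := ord_dp 0 i hi'
        rw [hW i hi', h1, sub_zero]
    | succ n ih =>
      intro hn
      have hD : (V - W).Ord (-((n + 1 : ℕ) : ℤ)) := (ih (by omega)).mono (by push_cast; omega)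
      have hcast : ((k * (N - 1) : ℕ) : ℤ) = k * ((N : ℤ) - 1) := by
        rw [Nat.cast_mul, Nat.cast_sub (by omega), Nat.cast_one]
      have hd := coeff_lax_commutator hO hu hD
      rw [hcomm _ (by rw [← hcast]; push_cast at hn ⊢; omega)] at hd
      have hd' : (((V - W).coeff (-((n + 1 : ℕ) : ℤ)))′ : SmoothFn O) = 0 := ext_ev fun x => by
        have h1 := congrArg (ev x) hd
        rw [map_zero, map_zsmul, zsmul_eq_mul] at h1
        rw [map_zero]
        exact (mul_eq_zero.mp h1.symm).resolve_left (by norm_cast; omega)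
      -- Connectedness of `O` makes the leading coefficient a single constant.
      obtain ⟨c, hc⟩ := eq_algebraMap_of_deriv_eq_zero hpre _ hd'
      obtain ⟨l, i, hl, hlk, hi, hli⟩ := exists_eq_mul_sub hN (show 1 ≤ n + 1 by omega) hn
      have hli' : (l : ℤ) * ((N : ℤ) - 1) = ((n + 1 : ℕ) : ℤ) + i := by
        have h1 : ((l * (N - 1) : ℕ) : ℤ) = l * ((N : ℤ) - 1) := by
          rw [Nat.cast_mul, Nat.cast_sub (by omega), Nat.cast_one]
        rw [← h1, ← hli]; push_cast; ring
      -- The leading coefficient of `(V - W) Z^{-l}` sits in order `i ≤ N - 2`, where that of `V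
      -- Z^{-l}` is `H_l^i`. Clearing `(z-y)^{-l}` leaves two terms that tend to zero at `y`.
      have hval : ∀ z : O, (-(κ : ℂ) * N) ^ l * c =
          (((z : ℝ) : ℂ) - y) ^ l * H l i z y -
            (((z : ℝ) : ℂ) - y) ^ l * ev z ((W * timePow hy hN hκ (-l)).coeff i) := by
        intro z
        have h1 := coeff_mul_top hD (ord_timePow_neg hy hN hκ l)
        have e : -((n + 1 : ℕ) : ℤ) + l * ((N : ℤ) - 1) = i := by rw [hli']; ring
        rw [e, hc, sub_mul, coeff_sub, coeff_heatOp_mul_timePow hy hN hκ h hl hlk hi] at h1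
        have h2 := congrArg (ev z) h1
        rw [map_sub, map_mul, hh l i hl hi, ev_coeff_timePow_neg_top, ev_algebraMap] at h2
        have hne := sub_ne_zero_of_mem hy z
        rw [← mul_sub, h2, zpow_neg, zpow_natCast]
        field_simp
      have ht : Filter.Tendsto (fun _ : ℝ => (-(κ : ℂ) * N) ^ l * c)
          (nhdsWithin y (O : Set ℝ)) (nhds (0 - 0)) := by
        refine (((tendsto_sub_pow_mul (hcont l i hl hi) hl).mono_left nhdsWithin_le_nhds).sub
          (tendsto_resolvent_coeff hy hN hκ hI hyI hu hw hW hWw hl hi)).congr' ?_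
        filter_upwards [self_mem_nhdsWithin] with z hz
        rw [toFun_eq_ev _ hz, hval ⟨z, hz⟩]
      have hc0 : (-(κ : ℂ) * N) ^ l * c = 0 := by
        have := tendsto_nhds_unique ht tendsto_const_nhds
        rw [← this, sub_zero]
      have hc0' : c = 0 :=
        (mul_eq_zero.mp hc0).resolve_left (pow_ne_zero _ (heatConst_ne_zero hN hκ))
      intro m hm
      rcases eq_or_lt_of_le (show -((n + 1 : ℕ) : ℤ) ≤ m by omega) with rfl | hm'
      · rw [hc, hc0', map_zero]
      · exact hD m hm'
  -- Now `V - W` has order at most `-k (N-1) - 1`, so `(V - W) Z^{-k}` has negative order and its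
  -- coefficient of `∂^j` vanishes.
  have hfin := ((key _ le_rfl).mul (ord_timePow_neg hy hN hκ k)) j (by
    rw [Nat.cast_mul, Nat.cast_sub (by omega), Nat.cast_one]; omega)
  rw [sub_mul, coeff_sub, coeff_heatOp_mul_timePow hy hN hκ h hk le_rfl hj, sub_eq_zero] at hfin
  rw [← hfin, hh k j hk hj]

end Uniqueness

/-! ### Transfer of residues to `PsiDO` and assembly. -/

theorem res_eq_ev {O : Opens ℝ} {y : ℝ} (hy : y ∉ O) (m : ℤ) (k : ℕ) (a b : ℤ) (x : O) :
    (PsiDO.dpow a * (PsiDO.ofFun (fun s => ((s : ℂ) - (y : ℂ))⁻¹) * PsiDO.dpow m) ^ k *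
      PsiDO.dpow b).res x =
      ev x ((dp a * (C (spow hy (-1)) * dp m) ^ k * dp b).coeff (-1)) := by
  have hf : ContDiffOn ℝ ∞ (fun s : ℝ => ((s : ℂ) - (y : ℂ))⁻¹) O := by
    simpa only [zpow_neg_one] using contDiffOn_sub_zpow hy (-1)
  have hs : ofSmooth _ hf = spow hy (-1) := ext_ev fun x => by
    rw [ev_spow, ev_ofSmooth, zpow_neg_one]
  have h1 := (PsiDO.smoothOn_ofFun hf).mul (PsiDO.smoothOn_dpow (O := O) m)
  have h2 := (PsiDO.smoothOn_dpow (O := O) a).mul (h1.pow k)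
  have h3 := PsiDO.ev_coeff_toPsi _ (h2.mul (PsiDO.smoothOn_dpow (O := O) b)) (-1) x
  rw [PsiDO.toPsi_mul h2 (PsiDO.smoothOn_dpow b), PsiDO.toPsi_mul (PsiDO.smoothOn_dpow a) (h1.pow k),
    PsiDO.toPsi_pow h1, PsiDO.toPsi_mul (PsiDO.smoothOn_ofFun hf) (PsiDO.smoothOn_dpow m),
    PsiDO.toPsi_ofFun hf, PsiDO.toPsi_dpow, PsiDO.toPsi_dpow, PsiDO.toPsi_dpow, hs] at h3
  exact h3.symm

/-- The part of an open set seen from one of its points `y` in the direction of `x`. -/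
theorem exists_onesided_nhd {V : Set ℝ} (hV : IsOpen V) {x y : ℝ} (hxy : x ≠ y)
    (hseg : Set.uIcc x y ⊆ V) : ∃ O : Opens ℝ, y ∉ O ∧ x ∈ O ∧ (O : Set ℝ) ⊆ V ∧
      IsPreconnected (O : Set ℝ) ∧ y ∈ closure (O : Set ℝ) := by
  have hxc : x ∈ connectedComponentIn V y :=
    isPreconnected_uIcc.subset_connectedComponentIn Set.right_mem_uIcc hseg Set.left_mem_uIcc
  have hyc : y ∈ connectedComponentIn V y := mem_connectedComponentIn (hseg Set.right_mem_uIcc)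
  have hopen : IsOpen (connectedComponentIn V y) := hV.connectedComponentIn
  have hord : (connectedComponentIn V y).OrdConnected :=
    isPreconnected_connectedComponentIn.ordConnected
  have key : ∀ J : Set ℝ, IsOpen J → J.OrdConnected → y ∉ J → x ∈ J → y ∈ closure J →
      ∃ O : Opens ℝ, y ∉ O ∧ x ∈ O ∧ (O : Set ℝ) ⊆ V ∧
        IsPreconnected (O : Set ℝ) ∧ y ∈ closure (O : Set ℝ) := by
    intro J hJ hJo hyJ hxJ hyJc
    refine ⟨⟨connectedComponentIn V y ∩ J, hopen.inter hJ⟩, fun h => hyJ h.2, ⟨hxc, hxJ⟩,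
      fun s hs => connectedComponentIn_subset V y hs.1, ?_, hopen.inter_closure ⟨hyc, hyJc⟩⟩
    exact (hord.inter hJo).isPreconnected
  rcases lt_or_gt_of_ne hxy with h | h
  · exact key (Set.Iio y) isOpen_Iio Set.ordConnected_Iio (lt_irrefl y) h
      (by rw [closure_Iio]; exact Set.self_mem_Iic)
  · exact key (Set.Ioi y) isOpen_Ioi Set.ordConnected_Ioi (lt_irrefl y) h
      (by rw [closure_Ioi]; exact Set.self_mem_Ici)
end

theorem theorem4p4 (N : ℕ) (hN : 2 ≤ N) (κ : ℝ) (hκ : IsHeatSign N κ)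
    (I : Set ℝ) (hI : IsOpen I)
    (u : ℕ → ℝ → ℂ) (hu : ∀ i, i + 2 ≤ N → ContDiffOn ℝ ∞ (u i) I)
    (U : Set (ℝ × ℝ)) (hU : IsOpen U) (hUI : U ⊆ I ×ˢ I) (hdiag : ∀ x ∈ I, (x, x) ∈ U)
    (H : ℕ → ℕ → ℝ → ℝ → ℂ) (hH : IsHadamardCoeffs U N κ u H)
    (w : ℕ → ℝ → ℝ → ℂ) (hw : IsResolventCoeffs I N u w)
    (k j : ℕ) (hk : 1 ≤ k) (hj : j + 2 ≤ N)
    (x y : ℝ) (hxy : x ≠ y) (hseg : ∀ s ∈ Set.uIcc x y, (s, y) ∈ U) :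
    H k j x y = (-(κ : ℂ) * N) ^ k *
      ∑ n ∈ Finset.Icc 1 (k * (N - 1) - j),
        w n x y *
          (PsiDO.dpow (-(n : ℤ)) *
            (PsiDO.ofFun (fun s => ((s : ℂ) - (y : ℂ))⁻¹) * PsiDO.dpow ((N : ℤ) - 1)) ^ k *
            PsiDO.dpow (-(j : ℤ) - 1)).res x := by
  have hyU : (y, y) ∈ U := hseg y Set.right_mem_uIcc
  have hyI : y ∈ I := (hUI hyU).1
  -- `Z⁻¹` contains `(x-y)⁻¹`, so the operators live on one side of `y`; keeping `y` in the closure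
  -- of a connected `O` preserves the limit at the diagonal.
  obtain ⟨O, hyO, hxO, hOU, hpre, hcl⟩ := exists_onesided_nhd (V := {s | (s, y) ∈ U})
    (hU.preimage (by fun_prop : Continuous fun s : ℝ => (s, y))) hxy hseg
  have hO : (O : Set ℝ) ⊆ I := fun s hs => (hUI (hOU hs)).1
  obtain ⟨W, hW, hW0, hWw, hWL, -⟩ := exists_resolvent_op hI hu hw hyI hO
  have hx := hadamard_eq_coeff hyO hN hκ hI hyI hu hw hpre hcl hO hU hyU (fun s hs => hOU hs) hH
    hW hW0 hWw hWL hk hj ⟨x, hxO⟩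
  rw [coeff_mul_timePow_neg hyO hN hκ hW hk hj] at hx
  rw [hx]
  congr 1
  refine Finset.sum_congr rfl fun n _ => ?_
  rw [hWw, ← res_eq_ev]
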